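/- Let $f:\mathbb R^n\to\mathbb R^n$ be a smooth vector field that is equivariant under the group $\mathbf Z_2^n$ of all sign changes of coordinates, and consider the dynamics of $\dot x=f(x)$ in the orthant $\mathbb R^n_+=\{x: x_k\ge 0 \text{ for all } k\}$. The flow need not be complete; a set is called invariant if through each of its points there passes a solution that is defined for all times and stays in the set. For a set $X$ let $W^u(X)$ be the set of $x\in\mathbb R^n_+$ whose backward solution exists for all negative times and has a nonempty $\alpha$-limit set contained in $X$, and let $W^s(X)$ be defined likewise with forward solutions and $\omega$-limit sets. For equilibria $p,q$ the connection from $p$ to $q$ is $[p\to q]=W^u(\{p\})\cap W^s(\{q\})$; a connecting trajectory from $p$ to $q$ is the full trajectory of one point of $[p\to q]$. The dimension of a connection is its Hausdorff dimension. A heteroclinic cycle is the union of finitely many hyperbolic equilibria $\xi_1,\dots,\xi_m\in\mathbb R^n_+$ and of nonempty connections $[\xi_j\to\xi_{j+1}]$ with $\xi_j\ne\xi_{j+1}$ (indices mod $m$). It is robust if every $[\xi_j\to\xi_{j+1}]$ is contained in a flow-invariant linear subspace $P_j\subseteq\mathbb R^n$ such that, for the system restricted to $P_j$, $\xi_j$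 is a saddle ($df(\xi_j)|_{P_j}$ has eigenvalues with positive and with negative real part) and $\xi_{j+1}$ is a sink (all eigenvalues of $df(\xi_{j+1})|_{P_j}$ have negative real part). A robust heteroclinic network is a connected union of finitely many robust heteroclinic cycles. A compact invariant set $Y$ is clean if $W^u(X)\subseteq Y$ for every invariant subset $X\subseteq Y$. An ac-network of $f$ is a robust heteroclinic network $Y\subset\mathbb R^n_+$ that is clean and such that all equilibria in $Y$ are hyperbolic and lie on coordinate axes, each axis contains at most one of them, and the unstable manifold in $\mathbb R^n$ of each of them has dimension one or two (i.e. $df$ has there one or two eigenvalues with positive real part, counted with multiplicity). A $\Delta$-clique with pairwise distinct equilibria $p,q,r$ is a set of the form $$\Delta_{pqr}=\{p,q,r\}\cup\kappa_{pq}\cup\kappa_{qr}\cup\bigcup_{\theta\in[0,1)}\kappa_{pr}(\theta),$$ where $\kappa_{pq}$, $\kappa_{qr}$ are connecting trajectories from $p$ to $q$ and from $q$ to $r$, $\kappa_{pr}(\theta)$ is the trajectory of a point $x(\theta)\in[p\to r]$ with $x:[0,1)\to\mathbb R^n$ continuous, $\kappa_{pr}(\theta_1)\neq\kappa_{pr}(\theta_2)$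 for $\theta_1\ne\theta_2$, and $\kappa_{pr}(\theta)\to\kappa_{pq}\cup\{q\}\cup\kappa_{qr}$ in the Hausdorff distance as $\theta\to1$. Let $Y$ be an ac-network. Then $Y$ is the union of its equilibria, of the one-dimensional connections $[p\to q]\subseteq Y$ between distinct equilibria $p,q$ of $Y$, and of the $\Delta$-cliques $\Delta_{pqr}\subseteq Y$ with $p,q,r$ equilibria of $Y$. In particular, if $p,r$ are equilibria of $Y$ and $[p\to r]$ is two-dimensional, then there is an equilibrium $q$ of $Y$ such that the closure of $[p\to r]$ is a $\Delta$-clique $\Delta_{pqr}$. -/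

import Mathlib

open Set Filter Topology
open scoped ContDiff

/-- Phase space `ℝⁿ` with its Euclidean metric. -/
abbrev Phase (n : ℕ) : Type := EuclideanSpace ℝ (Fin n)

/-- The closed positive orthant `ℝⁿ₊`, the state space of the networks. -/
def orthant (n : ℕ) : Set (Phase n) := {x | ∀ k, 0 ≤ x k}

/-- An element of `ℤ₂ⁿ`, given as a vector of signs, acts by changing signs of coordinates. -/
def signAct {n : ℕ} (s : Fin n → ℤˣ) (x : Phase n) : Phase n :=
  WithLp.toLp 2 fun k => ((s k : ℤ) : ℝ) * x k

/-- `ℤ₂ⁿ`-equivariance of a vector field. -/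
def IsZ2Equivariant {n : ℕ} (f : Phase n → Phase n) : Prop :=
  ∀ (s : Fin n → ℤˣ) (x : Phase n), f (signAct s x) = signAct s (f x)

/-! ### Solutions, limit sets, invariant sets

The flow of a smooth vector field need not be complete, so everything is phrased through solutions
`γ` of `γ' = f(γ)` on the interval of time that is needed. -/

/-- `γ` solves `γ' = f(γ)` on the time set `I` (one-sided derivatives at end points of `I`). -/
def IsSolutionOn {n : ℕ} (f : Phase n → Phase n) (γ : ℝ → Phase n) (I : Set ℝ) : Prop :=
  IsIntegralCurveOn γ (fun _ => f) I

/-- The `α`-limit set of a curve. -/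
def alphaLimit {n : ℕ} (γ : ℝ → Phase n) : Set (Phase n) := {y | MapClusterPt y atBot γ}

/-- The `ω`-limit set of a curve. -/
def omegaLimitSet {n : ℕ} (γ : ℝ → Phase n) : Set (Phase n) := {y | MapClusterPt y atTop γ}

/-- The full trajectory `{Φ(τ, x) : τ ∈ ℝ}` of a point whose solution exists for all times. -/
def trajectory {n : ℕ} (f : Phase n → Phase n) (x : Phase n) : Set (Phase n) :=
  {y | ∃ γ : ℝ → Phase n, IsSolutionOn f γ univ ∧ γ 0 = x ∧ y ∈ range γ}

/-- Invariance `Φ(τ, X) = X` for all `τ ∈ ℝ`: through each point of `X` there passes a solution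
defined for all times that stays in `X`. -/
def IsFlowInvariantSet {n : ℕ} (f : Phase n → Phase n) (X : Set (Phase n)) : Prop :=
  ∀ x ∈ X, ∃ γ : ℝ → Phase n, IsSolutionOn f γ univ ∧ γ 0 = x ∧ ∀ t, γ t ∈ X

/-- A flow-invariant linear subspace: solutions that meet `P` stay in `P` as long as they exist
(they may exist on a bounded time interval only). -/
def IsFlowInvariantSubspace {n : ℕ} (f : Phase n → Phase n) (P : Submodule ℝ (Phase n)) : Prop :=
  ∀ (γ : ℝ → Phase n) (a b : ℝ), IsSolutionOn f γ (Ioo a b) →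
    ∀ t₀ ∈ Ioo a b, γ t₀ ∈ P → ∀ t ∈ Ioo a b, γ t ∈ P

/-- The unstable set `W^u(X)` in `ℝⁿ₊`: the points whose backward solution exists for all negative
times and has a nonempty `α`-limit set contained in `X`. For `X = {ξ}` this reads `α(x) = {ξ}`. -/
def unstableSet {n : ℕ} (f : Phase n → Phase n) (X : Set (Phase n)) : Set (Phase n) :=
  {x | x ∈ orthant n ∧ ∃ γ : ℝ → Phase n, IsSolutionOn f γ (Iic 0) ∧ γ 0 = x ∧
    (alphaLimit γ).Nonempty ∧ alphaLimit γ ⊆ X}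

/-- The stable set `W^s(X)` in `ℝⁿ₊`. For `X = {ξ}` this reads `ω(x) = {ξ}`. -/
def stableSet {n : ℕ} (f : Phase n → Phase n) (X : Set (Phase n)) : Set (Phase n) :=
  {x | x ∈ orthant n ∧ ∃ γ : ℝ → Phase n, IsSolutionOn f γ (Ici 0) ∧ γ 0 = x ∧
    (omegaLimitSet γ).Nonempty ∧ omegaLimitSet γ ⊆ X}

/-- The connection `[p → q] = W^u(p) ∩ W^s(q)`: the full set of connecting trajectories. -/
def connection {n : ℕ} (f : Phase n → Phase n) (p q : Phase n) : Set (Phase n) :=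
  unstableSet f {p} ∩ stableSet f {q}

/-- `κ` is a single connecting trajectory from `p` to `q`. -/
def IsConnectingTrajectory {n : ℕ} (f : Phase n → Phase n) (p q : Phase n)
    (κ : Set (Phase n)) : Prop :=
  ∃ x ∈ connection f p q, κ = trajectory f x

/-! ### Linearisation at equilibria -/

/-- The complex eigenvalues of a real endomorphism, with algebraic multiplicity. -/
noncomputable def complexEigenvalues {V : Type*} [AddCommGroup V] [Module ℝ V]
    [Module.Finite ℝ V] (T : V →ₗ[ℝ] V) : Multiset ℂ :=
  T.charpoly.aroots ℂ

/-- The Jacobian `df(p)` as a linear map. -/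
noncomputable def jacobian {n : ℕ} (f : Phase n → Phase n) (p : Phase n) :
    Phase n →ₗ[ℝ] Phase n :=
  (fderiv ℝ f p : Phase n →L[ℝ] Phase n)

/-- Hyperbolic equilibrium: no eigenvalue of `df(p)` on the imaginary axis. -/
def IsHyperbolicEquilibrium {n : ℕ} (f : Phase n → Phase n) (p : Phase n) : Prop :=
  f p = 0 ∧ ∀ z ∈ complexEigenvalues (jacobian f p), z.re ≠ 0

open Classical in
/-- The dimension of the unstable manifold of a hyperbolic equilibrium in `ℝⁿ`: the number of
eigenvalues of `df(p)` with positive real part, counted with multiplicity. -/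
noncomputable def unstableDim {n : ℕ} (f : Phase n → Phase n) (p : Phase n) : ℕ :=
  ((complexEigenvalues (jacobian f p)).filter fun z => 0 < z.re).card

/-- `p` is a sink of the system restricted to the subspace `P`. -/
def IsSinkIn {n : ℕ} (f : Phase n → Phase n) (P : Submodule ℝ (Phase n)) (p : Phase n) : Prop :=
  p ∈ P ∧ ∃ h : ∀ v ∈ P, jacobian f p v ∈ P,
    ∀ z ∈ complexEigenvalues ((jacobian f p).restrict h), z.re < 0

/-- `p` is a saddle of the system restricted to the subspace `P`. -/
def IsSaddleIn {n : ℕ} (f : Phase n → Phase n) (P : Submodule ℝ (Phase n)) (p : Phase n) : Prop :=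
  p ∈ P ∧ ∃ h : ∀ v ∈ P, jacobian f p v ∈ P,
    (∃ z ∈ complexEigenvalues ((jacobian f p).restrict h), 0 < z.re) ∧
    (∃ z ∈ complexEigenvalues ((jacobian f p).restrict h), z.re < 0)

/-! ### Heteroclinic cycles and networks -/

/-- A heteroclinic cycle in `ℝⁿ₊`: hyperbolic equilibria `ξ₁, …, ξ_m` and nonempty heteroclinic
connections `[ξ_j → ξ_{j+1}]`, the index `j + 1` being taken modulo `m`. -/
structure HeteroclinicCycle {n : ℕ} (f : Phase n → Phase n) where
  /-- the number `m ≥ 1` of equilibria -/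
  length : ℕ
  [length_ne_zero : NeZero length]
  /-- the equilibria, in cyclic order -/
  node : Fin length → Phase n
  node_mem : ∀ j, node j ∈ orthant n
  hyperbolic : ∀ j, IsHyperbolicEquilibrium f (node j)
  heteroclinic : ∀ j, node j ≠ node (j + 1)
  connected : ∀ j, (connection f (node j) (node (j + 1))).Nonempty

attribute [instance] HeteroclinicCycle.length_ne_zero

/-- The cycle as a set: the union of its equilibria and connections. -/
def HeteroclinicCycle.carrier {n : ℕ} {f : Phase n → Phase n} (X : HeteroclinicCycle f) :
    Set (Phase n) :=
  range X.node ∪ ⋃ j, connection f (X.node j) (X.node (j + 1))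

/-- A cycle is robust if each of its connections lies in a flow-invariant subspace in which it is
of saddle-sink type. -/
def HeteroclinicCycle.IsRobust {n : ℕ} {f : Phase n → Phase n} (X : HeteroclinicCycle f) : Prop :=
  ∀ j, ∃ P : Submodule ℝ (Phase n), IsFlowInvariantSubspace f P ∧
    connection f (X.node j) (X.node (j + 1)) ⊆ P ∧
    IsSaddleIn f P (X.node j) ∧ IsSinkIn f P (X.node (j + 1))

/-- A robust heteroclinic network: a connected union of finitely many robust cycles. -/
def IsRobustHeteroclinicNetwork {n : ℕ} (f : Phase n → Phase n) (Y : Set (Phase n)) : Prop :=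
  IsConnected Y ∧ ∃ (N : ℕ) (X : Fin N → HeteroclinicCycle f),
    (∀ i, (X i).IsRobust) ∧ Y = ⋃ i, (X i).carrier

/-- A compact invariant set `Y` is clean if `W^u(X) ⊆ Y` for each of its invariant subsets `X`. -/
def IsClean {n : ℕ} (f : Phase n → Phase n) (Y : Set (Phase n)) : Prop :=
  IsCompact Y ∧ IsFlowInvariantSet f Y ∧
    ∀ X ⊆ Y, IsFlowInvariantSet f X → unstableSet f X ⊆ Y

/-- The equilibria that belong to `Y`. -/
def equilibriaIn {n : ℕ} (f : Phase n → Phase n) (Y : Set (Phase n)) : Set (Phase n) :=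
  {p | p ∈ Y ∧ f p = 0}

/-- The `i`-th coordinate axis. -/
def coordAxis {n : ℕ} (i : Fin n) : Set (Phase n) := {x | ∀ k, k ≠ i → x k = 0}

/-- An ac-network (axial and clean) of the vector field `f`. -/
structure IsACNetwork {n : ℕ} (f : Phase n → Phase n) (Y : Set (Phase n)) : Prop where
  smooth : ContDiff ℝ ∞ f
  equivariant : IsZ2Equivariant f
  subset_orthant : Y ⊆ orthant n
  network : IsRobustHeteroclinicNetwork f Y
  hyperbolic : ∀ p ∈ equilibriaIn f Y, IsHyperbolicEquilibrium f p
  axial : ∀ p ∈ equilibriaIn f Y, ∃ i, p ∈ coordAxis i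
  one_per_axis : ∀ i, (equilibriaIn f Y ∩ coordAxis i).Subsingleton
  unstable_dim : ∀ p ∈ equilibriaIn f Y, unstableDim f p = 1 ∨ unstableDim f p = 2
  clean : IsClean f Y

/-- `D` is a `Δ`-clique with equilibria `p` (beginning), `q` (middle), `r` (end). The limit of the
trajectories `κ_{pr}(θ)` as `θ → 1` is taken with respect to the Hausdorff distance of sets. -/
def IsDeltaClique {n : ℕ} (f : Phase n → Phase n) (p q r : Phase n) (D : Set (Phase n)) : Prop :=
  f p = 0 ∧ f q = 0 ∧ f r = 0 ∧ p ≠ q ∧ q ≠ r ∧ p ≠ r ∧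
  ∃ (κpq κqr : Set (Phase n)) (x : ℝ → Phase n),
    IsConnectingTrajectory f p q κpq ∧ IsConnectingTrajectory f q r κqr ∧
    ContinuousOn x (Ico 0 1) ∧
    (∀ θ ∈ Ico (0 : ℝ) 1, x θ ∈ connection f p r) ∧
    (∀ θ₁ ∈ Ico (0 : ℝ) 1, ∀ θ₂ ∈ Ico (0 : ℝ) 1, θ₁ ≠ θ₂ →
      trajectory f (x θ₁) ≠ trajectory f (x θ₂)) ∧
    Tendsto (fun θ => Metric.hausdorffEDist (trajectory f (x θ)) (κpq ∪ {q} ∪ κqr))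
      (𝓝[<] 1) (𝓝 0) ∧
    D = {p, q, r} ∪ κpq ∪ κqr ∪ ⋃ θ ∈ Ico (0 : ℝ) 1, trajectory f (x θ)

/-! Only points of `Y` and of the unstable sets of its equilibria matter, so `f` may be cut off to a
bounded Lipschitz field whose global flow keeps the sign symmetries (`exists_networkFlow`). The
symmetries make coordinate subspaces invariant and the Jacobian at an axial equilibrium diagonal
(`fderiv_apply_eq_rate`). Hence the unstable directions of an equilibrium are one or two coordinate
directions. Its own axis is not among them, because robustness makes it a sink in a subspace
containing that axis (`rate_axis_neg`).

The local unstable set is described by cones. Along differences of orbits near `p` the form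
(unstable part)² - (stable part)² grows, so points whose backward orbits stay near `p` form a
Lipschitz graph over the unstable coordinates (`norm_sub_sq_le`). By symmetry the stable coordinates
off the axis of `p` vanish on this graph, so a one-parameter shooting argument along the axis shows
that the graph lies over every small unstable vector (`exists_backwardIn_over`).

If `p`, on axis `i`, has the single unstable direction `k`, its unstable set in the orthant is `p`
and at most one trajectory. If it has two, `j` and `k`, the trajectories leaving `p` are
parametrised by a quarter circle, `θ ∈ [0, 1]` (`exists_isCrossSection`). Cleanness puts them into
`Y`, so each tends to an equilibrium other than `p` with coordinates among `i`, `j`, `k`, hence to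
one on axis `j` or `k`. The edges `θ = 1` and `θ = 0` tend to `q` on axis `j` and to `r` on axis
`k`. An interior trajectory has three nonzero coordinates, so its robustness subspace contains all
three axes and its limit attracts in their span (`notMem_unstableIdx_of_interior`). Basins are
therefore open in `(0, 1)`, and by connectedness all interior trajectories share one limit, say `r`
(`exists_cliqueConfiguration`).

Then `k` is unstable at `q`, for otherwise `q` would also attract the neighbours of the edge.
Trajectories with `θ` near `1` follow the edge to `q`, stay there for a long time, and leave along
the only trajectory that emanates from `q` within the span; it ends at `r` (`exists_exit`,
`exists_hausdorffEDist_le`). This gives the clique (`isDeltaClique`). The remaining connections are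
single trajectories, of Hausdorff dimension one, whence the dichotomy
`dimH_eq_one_or_isDeltaClique`. -/

open scoped NNReal

/-! ### The flow of a bounded Lipschitz vector field -/

section GlobalFlow

variable {E : Type*} [NormedAddCommGroup E] [NormedSpace ℝ E]

/-- Global solutions of an autonomous Lipschitz equation are determined by one value. -/
theorem solution_unique_of_lipschitz {g : E → E} {K : ℝ≥0} (hg : LipschitzWith K g)
    {γ δ : ℝ → E} (hγ : ∀ t, HasDerivAt γ (g (γ t)) t) (hδ : ∀ t, HasDerivAt δ (g (δ t)) t)
    {t₀ : ℝ} (h : γ t₀ = δ t₀) : γ = δ :=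
  ODE_solution_unique_univ (v := fun _ => g) (s := fun _ => univ) (t₀ := t₀) (K := K)
    (fun _ => hg.lipschitzOnWith) (fun t => ⟨hγ t, trivial⟩) (fun t => ⟨hδ t, trivial⟩) h

/-- A bounded Lipschitz vector field has a global solution through each point. -/
theorem exists_global_solution [CompleteSpace E] {g : E → E} {K M : ℝ≥0}
    (hg : LipschitzWith K g) (hM : ∀ x, ‖g x‖ ≤ M) (x : E) :
    ∃ γ : ℝ → E, γ 0 = x ∧ ∀ t, HasDerivAt γ (g (γ t)) t := by
  have key : ∀ T : ℝ, 0 < T → ∃ α : ℝ → E, α 0 = x ∧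
      ∀ t ∈ Ioo (-T) T, HasDerivAt α (g (α t)) t := by
    intro T hT
    have h0 : (0 : ℝ) ∈ Icc (-T) T := ⟨by linarith, hT.le⟩
    -- The radius `M * T` is the farthest that speed `M` reaches in time `T`, so the length of the
    -- time interval is not restricted.
    have hPL : IsPicardLindelof (fun _ => g) (⟨0, h0⟩ : Icc (-T) T) x (M * T.toNNReal) 0 M K :=
      IsPicardLindelof.of_time_independent (fun y _ => hM y) hg.lipschitzOnWith
        (by simp [hT.le])
    obtain ⟨α, hα0, hα⟩ := hPL.exists_eq_forall_mem_Icc_hasDerivWithinAt₀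
    exact ⟨α, hα0, fun t ht => (hα t (Ioo_subset_Icc_self ht)).hasDerivAt
      (Icc_mem_nhds ht.1 ht.2)⟩
  choose! α hα0 hα using key
  have agree : ∀ S T : ℝ, 0 < S → S ≤ T → EqOn (α S) (α T) (Ioo (-S) S) := by
    intro S T hS hST
    refine ODE_solution_unique_of_mem_Ioo (v := fun _ => g) (s := fun _ => univ) (t₀ := 0) (K := K)
      (fun _ _ => hg.lipschitzOnWith) ⟨by linarith, hS⟩
      (fun t ht => ⟨hα S hS t ht, trivial⟩)
      (fun t ht => ⟨hα T (by linarith) t ⟨by linarith [ht.1], by linarith [ht.2]⟩, trivial⟩) ?_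
    rw [hα0 S hS, hα0 T (by linarith)]
  -- The solutions on growing intervals are glued; the summand `1` makes `t` an interior point of
  -- the interval whose solution is used at `t`.
  refine ⟨fun t => α (|t| + 1) t, by simpa using hα0 (|0| + 1) (by positivity), fun t => ?_⟩
  have ht : t ∈ Ioo (-(|t| + 1)) (|t| + 1) := by
    rw [mem_Ioo, ← abs_lt]; exact lt_add_one _
  refine (hα (|t| + 1) (by positivity) t ht).congr_of_eventuallyEq ?_
  filter_upwards [Ioo_mem_nhds ht.1 ht.2] with s hs
  have hs' : s ∈ Ioo (-(|s| + 1)) (|s| + 1) := by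
    rw [mem_Ioo, ← abs_lt]; exact lt_add_one _
  rcases le_total (|s| + 1) (|t| + 1) with h | h
  · exact agree _ _ (by positivity) h hs'
  · exact (agree _ _ (by positivity) h hs).symm

/-- Two global solutions of a Lipschitz equation separate at most exponentially, in both
directions of time. -/
theorem dist_solution_le {g : E → E} {K : ℝ≥0} (hg : LipschitzWith K g)
    {γ δ : ℝ → E} (hγ : ∀ t, HasDerivAt γ (g (γ t)) t) (hδ : ∀ t, HasDerivAt δ (g (δ t)) t)
    (t : ℝ) : dist (γ t) (δ t) ≤ Real.exp (K * |t|) * dist (γ 0) (δ 0) := by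
  have fwd : ∀ {h : E → E} {γ δ : ℝ → E}, LipschitzWith K h →
      (∀ t, HasDerivAt γ (h (γ t)) t) → (∀ t, HasDerivAt δ (h (δ t)) t) →
      ∀ t, 0 ≤ t → dist (γ t) (δ t) ≤ Real.exp (K * t) * dist (γ 0) (δ 0) := by
    intro h γ δ hh hγ hδ t ht
    have := dist_le_of_trajectories_ODE (v := fun _ => h) (a := 0) (b := t) (fun _ => hh)
      (fun s _ => (hγ s).continuousAt.continuousWithinAt) (fun s _ => (hγ s).hasDerivWithinAt)
      (fun s _ => (hδ s).continuousAt.continuousWithinAt) (fun s _ => (hδ s).hasDerivWithinAt)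
      le_rfl t ⟨ht, le_rfl⟩
    simpa [mul_comm] using this
  rcases le_total 0 t with ht | ht
  · rw [abs_of_nonneg ht]; exact fwd hg hγ hδ t ht
  · have hneg : ∀ {γ : ℝ → E}, (∀ t, HasDerivAt γ (g (γ t)) t) →
        ∀ t, HasDerivAt (fun s => γ (-s)) ((fun y => -g y) (γ (-t))) t := by
      intro γ hγ t
      simpa [Function.comp_def] using (hγ (-t)).scomp t (hasDerivAt_neg t)
    have := fwd (h := fun y => -g y) hg.neg (hneg hγ) (hneg hδ) (-t)
      (by linarith)
    simpa [abs_of_nonpos ht] using this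

/-- The global flow of a bounded Lipschitz vector field. -/
theorem exists_global_flow [CompleteSpace E] {g : E → E} {K M : ℝ≥0}
    (hg : LipschitzWith K g) (hM : ∀ x, ‖g x‖ ≤ M) :
    ∃ φ : ℝ → E → E, (∀ x, φ 0 x = x) ∧ (∀ s t x, φ (s + t) x = φ s (φ t x)) ∧
      (∀ x t, HasDerivAt (fun s => φ s x) (g (φ t x)) t) ∧
      (∀ t x y, dist (φ t x) (φ t y) ≤ Real.exp (K * |t|) * dist x y) ∧
      (∀ x, LipschitzWith M fun t => φ t x) ∧
      (∀ γ : ℝ → E, (∀ t, HasDerivAt γ (g (γ t)) t) → ∀ t, φ t (γ 0) = γ t) := by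
  choose φ hφ0 hφ using exists_global_solution hg hM
  refine ⟨fun t x => φ x t, hφ0, fun s t x => ?_, hφ, fun t x y => ?_, fun x => ?_,
    fun γ hγ t => ?_⟩
  · have h1 : ∀ r, HasDerivAt (fun s => φ x (s + t)) (g (φ x (r + t))) r :=
      fun r => (hφ x (r + t)).comp_add_const r t
    have := solution_unique_of_lipschitz hg h1 (hφ (φ x t)) (t₀ := 0) (by simp [hφ0])
    exact congrFun this s
  · simpa [hφ0] using dist_solution_le hg (hφ x) (hφ y) t
  · exact lipschitzWith_of_nnnorm_deriv_le (fun t => (hφ x t).differentiableAt)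
      fun t => by rw [(hφ x t).deriv]; exact hM _
  · exact congrFun (solution_unique_of_lipschitz hg (hφ (γ 0)) hγ (t₀ := 0) (hφ0 _)) t

/-- A smooth vector field agrees on a given ball with a bounded Lipschitz field that has the same
linear isometric symmetries. -/
theorem exists_cutoff {E : Type*} [NormedAddCommGroup E] [InnerProductSpace ℝ E]
    [FiniteDimensional ℝ E] {f : E → E} (hf : ContDiff ℝ 1 f) (R : ℝ) :
    ∃ (g : E → E) (K M : ℝ≥0), LipschitzWith K g ∧ (∀ x, ‖g x‖ ≤ M) ∧
      (∀ x, ‖x‖ < R → g x = f x) ∧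
      ∀ A : E →ₗ[ℝ] E, (∀ x, ‖A x‖ = ‖x‖) → (∀ x, f (A x) = A (f x)) → ∀ x, g (A x) = A (g x) := by
  -- The cutoff depends on the norm alone, so multiplying by it preserves every isometric symmetry;
  -- it is `1` on the ball of radius `R` and `0` where `‖x‖ ^ 2 ≥ R ^ 2 + 1`.
  set χ : E → ℝ := fun x => Real.smoothTransition (R ^ 2 + 1 - ‖x‖ ^ 2) with hχ
  have hχs : ContDiff ℝ 1 χ :=
    (Real.smoothTransition.contDiff (n := 1)).comp (contDiff_const.sub (contDiff_norm_sq ℝ))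
  have hg1 : ContDiff ℝ 1 fun x => χ x • f x := hχs.smul hf
  have hsupp : HasCompactSupport fun x => χ x • f x := by
    refine HasCompactSupport.of_support_subset_isCompact
      (isCompact_closedBall (0 : E) (Real.sqrt (R ^ 2 + 1))) fun x hx => ?_
    by_contra hx'
    apply hx
    have : R ^ 2 + 1 < ‖x‖ ^ 2 := by
      rw [mem_closedBall_zero_iff, not_le] at hx'
      exact (Real.sqrt_lt' (lt_of_le_of_lt (Real.sqrt_nonneg _) hx')).1 hx'
    have h0 : χ x = 0 := Real.smoothTransition.zero_of_nonpos (by linarith)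
    simp [h0]
  obtain ⟨K, hK⟩ := ContDiff.lipschitzWith_of_hasCompactSupport hsupp hg1 one_ne_zero
  obtain ⟨M, hM⟩ := hsupp.exists_bound_of_continuous hg1.continuous
  refine ⟨_, K, ⟨max M 0, le_max_right _ _⟩, hK, fun x => (hM x).trans (le_max_left _ _),
    fun x hx => ?_, fun A hA hfA x => ?_⟩
  · have h1 : χ x = 1 := by
      refine Real.smoothTransition.one_of_one_le ?_
      nlinarith [norm_nonneg x]
    simp [h1]
  · have : χ (A x) = χ x := by simp [hχ, hA]
    simp [this, hfA]

end GlobalFlow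

/-! ### Sign changes and coordinate subspaces -/

section SignChanges

variable {n : ℕ}

@[simp] theorem signAct_apply (s : Fin n → ℤˣ) (x : Phase n) (k : Fin n) :
    signAct s x k = ((s k : ℤ) : ℝ) * x k := rfl

/-- A sign change as a linear map. -/
def signLinear (s : Fin n → ℤˣ) : Phase n →ₗ[ℝ] Phase n where
  toFun := signAct s
  map_add' x y := by ext k; simp [mul_add]
  map_smul' c x := by ext k; simp; ring

@[simp] theorem signLinear_apply (s : Fin n → ℤˣ) (x : Phase n) : signLinear s x = signAct s x :=
  rfl

theorem intUnit_sq (u : ℤˣ) : ((u : ℤ) : ℝ) ^ 2 = 1 := by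
  rcases Int.units_eq_one_or u with h | h <;> simp [h]

theorem norm_signAct (s : Fin n → ℤˣ) (x : Phase n) : ‖signAct s x‖ = ‖x‖ := by
  simp [EuclideanSpace.norm_eq, mul_pow, intUnit_sq]

/-- The sign change of a single coordinate. -/
def flipSign (l : Fin n) : Fin n → ℤˣ := Function.update 1 l (-1)

theorem signAct_flipSign_self (l : Fin n) (x : Phase n) : signAct (flipSign l) x l = -x l := by
  simp [flipSign]

theorem signAct_flipSign_of_ne {l k : Fin n} (h : k ≠ l) (x : Phase n) :
    signAct (flipSign l) x k = x k := by
  simp [flipSign, h]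

theorem signAct_flipSign_eq_self_iff {l : Fin n} {x : Phase n} :
    signAct (flipSign l) x = x ↔ x l = 0 := by
  constructor
  · intro h
    have := congrArg (fun y : Phase n => y l) h
    simp only [signAct_flipSign_self] at this
    linarith
  · intro h
    ext k
    by_cases hk : k = l
    · subst hk; rw [signAct_flipSign_self, h, neg_zero]
    · exact signAct_flipSign_of_ne hk x

/-- The vectors whose coordinates outside `I` vanish. -/
def coordSubspace (I : Finset (Fin n)) : Set (Phase n) := {x | ∀ l ∉ I, x l = 0}

theorem isClosed_coordSubspace (I : Finset (Fin n)) : IsClosed (coordSubspace I) := by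
  have : coordSubspace I = ⋂ l, ⋂ (_ : l ∉ I), {x : Phase n | x l = 0} := by
    ext x; simp [coordSubspace]
  rw [this]
  exact isClosed_iInter fun l => isClosed_iInter fun _ =>
    isClosed_eq (EuclideanSpace.proj (𝕜 := ℝ) l).continuous continuous_const

end SignChanges

/-! ### The flow near a compact invariant set -/

/-- The flow of a bounded Lipschitz field which agrees with `f` on an open set `dom` around `Y` and
has the sign symmetries of `f`. -/
structure NetworkFlow {n : ℕ} (f : Phase n → Phase n) (Y : Set (Phase n)) where
  /-- the flow map -/
  φ : ℝ → Phase n → Phase n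
  /-- the neighbourhood of `Y` in which the flow solves the original equation -/
  dom : Set (Phase n)
  /-- the Lipschitz constant of the field -/
  K : ℝ≥0
  /-- a bound for the speed -/
  M : ℝ≥0
  map_zero : ∀ x, φ 0 x = x
  map_add : ∀ s t x, φ (s + t) x = φ s (φ t x)
  isOpen_dom : IsOpen dom
  subset_dom : Y ⊆ dom
  hasDerivAt : ∀ x t, φ t x ∈ dom → HasDerivAt (fun s => φ s x) (f (φ t x)) t
  dist_le : ∀ t x y, dist (φ t x) (φ t y) ≤ Real.exp (K * |t|) * dist x y
  lipschitz : ∀ x, LipschitzWith M fun t => φ t x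
  symm : ∀ (s : Fin n → ℤˣ) t x, φ t (signAct s x) = signAct s (φ t x)
  invariant : ∀ x ∈ Y, ∀ t, φ t x ∈ Y

/-- A bounded invariant set of an equivariant vector field has a `NetworkFlow`. -/
theorem exists_networkFlow {n : ℕ} {f : Phase n → Phase n} {Y : Set (Phase n)}
    (hf : ContDiff ℝ 1 f) (heq : IsZ2Equivariant f) (hb : Bornology.IsBounded Y)
    (hinv : IsFlowInvariantSet f Y) : Nonempty (NetworkFlow f Y) := by
  obtain ⟨R, hR⟩ := hb.subset_ball 0
  obtain ⟨g, K, M, hK, hM, hgf, hsymm⟩ := exists_cutoff hf R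
  obtain ⟨φ, h0, hadd, hder, hdist, hlip, huniq⟩ := exists_global_flow hK hM
  have hgf' : ∀ x ∈ Metric.ball (0 : Phase n) R, g x = f x :=
    fun x hx => hgf x (mem_ball_zero_iff.1 hx)
  refine ⟨⟨φ, Metric.ball 0 R, K, M, h0, hadd, Metric.isOpen_ball, hR, fun x t hx => ?_, hdist,
    hlip, fun s t x => ?_, fun x hx t => ?_⟩⟩
  · rw [← hgf' _ hx]; exact hder x t
  · have hs : ∀ x, g (signAct s x) = signAct s (g x) :=
      hsymm (signLinear s) (norm_signAct s) (heq s)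
    have hd : ∀ t, HasDerivAt (fun r => signAct s (φ r x)) (g (signAct s (φ t x))) t := by
      intro t
      rw [hs]
      exact ((signLinear s).toContinuousLinearMap.hasFDerivAt.comp_hasDerivAt t (hder x t))
    have := huniq _ hd t
    rwa [h0] at this
  -- A solution of the original equation inside `Y` never meets the region changed by the cutoff, so
  -- it is the orbit of the new flow.
  · obtain ⟨γ, hγ, hγ0, hγY⟩ := hinv x hx
    have := huniq γ (fun t => by
      rw [hgf' _ (hR (hγY t))]
      exact (isIntegralCurveOn_univ.1 hγ) t) t
    rw [hγ0] at this
    rw [this]; exact hγY t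

/-- Solutions on an interval of a `C¹` equation that agree at a point of it agree. -/
theorem solution_unique_of_contDiff {n : ℕ} {f : Phase n → Phase n} (hf : ContDiff ℝ 1 f)
    {γ δ : ℝ → Phase n} {a b : ℝ} (hγ : IsSolutionOn f γ (Icc a b))
    (hδ : IsSolutionOn f δ (Icc a b)) (h : γ a = δ a ∨ γ b = δ b) : EqOn γ δ (Icc a b) := by
  have hγc : ContinuousOn γ (Icc a b) := hγ.continuousOn
  have hδc : ContinuousOn δ (Icc a b) := hδ.continuousOn
  obtain ⟨R, hR⟩ := ((isCompact_Icc.image_of_continuousOn hγc).union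
    (isCompact_Icc.image_of_continuousOn hδc)).isBounded.subset_closedBall 0
  have hγR : ∀ t ∈ Icc a b, γ t ∈ Metric.closedBall 0 R :=
    fun t ht => hR (Or.inl (mem_image_of_mem _ ht))
  have hδR : ∀ t ∈ Icc a b, δ t ∈ Metric.closedBall 0 R :=
    fun t ht => hR (Or.inr (mem_image_of_mem _ ht))
  obtain ⟨K, hK⟩ := (hf.contDiffOn (s := Metric.closedBall (0 : Phase n) R)).exists_lipschitzOnWith
    one_ne_zero (convex_closedBall _ _) (isCompact_closedBall _ _)
  rcases h with h | h
  · exact ODE_solution_unique_of_mem_Icc_right (v := fun _ => f)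
      (s := fun _ => Metric.closedBall 0 R) (fun _ _ => hK) hγc
      (fun t ht => (hγ t (Ico_subset_Icc_self ht)).mono_of_mem_nhdsWithin
        (Icc_mem_nhdsGE_of_mem ht)) (fun t ht => hγR t (Ico_subset_Icc_self ht)) hδc
      (fun t ht => (hδ t (Ico_subset_Icc_self ht)).mono_of_mem_nhdsWithin
        (Icc_mem_nhdsGE_of_mem ht)) (fun t ht => hδR t (Ico_subset_Icc_self ht)) h
  · exact ODE_solution_unique_of_mem_Icc_left (v := fun _ => f)
      (s := fun _ => Metric.closedBall 0 R) (fun _ _ => hK) hγc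
      (fun t ht => (hγ t (Ioc_subset_Icc_self ht)).mono_of_mem_nhdsWithin
        (Icc_mem_nhdsLE_of_mem ht)) (fun t ht => hγR t (Ioc_subset_Icc_self ht)) hδc
      (fun t ht => (hδ t (Ioc_subset_Icc_self ht)).mono_of_mem_nhdsWithin
        (Icc_mem_nhdsLE_of_mem ht)) (fun t ht => hδR t (Ioc_subset_Icc_self ht)) h

namespace NetworkFlow

variable {n : ℕ} {f : Phase n → Phase n} {Y : Set (Phase n)} (F : NetworkFlow f Y)

theorem continuous_time (x : Phase n) : Continuous fun t => F.φ t x := (F.lipschitz x).continuous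

theorem continuous_map (t : ℝ) : Continuous (F.φ t) := by
  have : LipschitzWith (Real.exp (F.K * |t|)).toNNReal (F.φ t) :=
    LipschitzWith.of_dist_le_mul fun x y => by
      rw [Real.coe_toNNReal _ (Real.exp_pos _).le]; exact F.dist_le t x y
  exact this.continuous

theorem map_neg_map (t : ℝ) (x : Phase n) : F.φ (-t) (F.φ t x) = x := by
  rw [← F.map_add, neg_add_cancel, F.map_zero]

/-- A coordinate hyperplane is the fixed-point set of a sign flip that commutes with the flow; the
converse uses time reversal. -/
theorem coord_eq_zero_iff (t : ℝ) (x : Phase n) (l : Fin n) : F.φ t x l = 0 ↔ x l = 0 := by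
  have key : ∀ t x, x l = 0 → F.φ t x l = 0 := by
    intro t x h
    rw [← signAct_flipSign_eq_self_iff] at h ⊢
    rw [← F.symm, h]
  refine ⟨fun h => ?_, key t x⟩
  have := key (-t) _ h
  rwa [F.map_neg_map] at this

theorem mem_coordSubspace_iff (t : ℝ) (x : Phase n) (I : Finset (Fin n)) :
    F.φ t x ∈ coordSubspace I ↔ x ∈ coordSubspace I := by
  simp [coordSubspace, F.coord_eq_zero_iff]

theorem isSolutionOn {x : Phase n} {I : Set ℝ} (h : ∀ t ∈ I, F.φ t x ∈ F.dom) :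
    IsSolutionOn f (fun t => F.φ t x) I :=
  fun t ht => (F.hasDerivAt x t (h t ht)).hasDerivWithinAt

/-- Translates the solutions in the definitions of limit and unstable sets into the flow. Starting
in `Y` matters: there the whole orbit stays where the flow solves the original equation. -/
theorem eq_of_isSolutionOn_Iic (hf : ContDiff ℝ 1 f) {γ : ℝ → Phase n}
    (hγ : IsSolutionOn f γ (Iic 0)) (h0 : γ 0 ∈ Y) {t : ℝ} (ht : t ≤ 0) : γ t = F.φ t (γ 0) :=
  solution_unique_of_contDiff hf (hγ.mono Icc_subset_Iic_self)
    (F.isSolutionOn fun s _ => F.subset_dom (F.invariant _ h0 s)) (Or.inr (F.map_zero _).symm)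
    (left_mem_Icc.2 ht)

theorem eq_of_isSolutionOn_Ici (hf : ContDiff ℝ 1 f) {γ : ℝ → Phase n}
    (hγ : IsSolutionOn f γ (Ici 0)) (h0 : γ 0 ∈ Y) {t : ℝ} (ht : 0 ≤ t) : γ t = F.φ t (γ 0) :=
  solution_unique_of_contDiff hf (hγ.mono Icc_subset_Ici_self)
    (F.isSolutionOn fun s _ => F.subset_dom (F.invariant _ h0 s)) (Or.inl (F.map_zero _).symm)
    (right_mem_Icc.2 ht)

theorem map_equilibrium (hf : ContDiff ℝ 1 f) {p : Phase n} (hp : p ∈ equilibriaIn f Y) (t : ℝ) :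
    F.φ t p = p := by
  have hc : ∀ I, IsSolutionOn f (fun _ => p) I := fun I t _ => by
    simpa [hp.2] using hasDerivWithinAt_const t I p
  rcases le_total t 0 with ht | ht
  · exact (F.eq_of_isSolutionOn_Iic hf (hc _) hp.1 ht).symm
  · exact (F.eq_of_isSolutionOn_Ici hf (hc _) hp.1 ht).symm

theorem trajectory_eq (hf : ContDiff ℝ 1 f) {x : Phase n} (hx : x ∈ Y) :
    trajectory f x = range fun t => F.φ t x := by
  ext y
  constructor
  · rintro ⟨γ, hγ, rfl, t, rfl⟩
    refine ⟨t, ?_⟩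
    rcases le_total t 0 with ht | ht
    · exact (F.eq_of_isSolutionOn_Iic hf (hγ.mono (subset_univ _)) hx ht).symm
    · exact (F.eq_of_isSolutionOn_Ici hf (hγ.mono (subset_univ _)) hx ht).symm
  · intro hy
    exact ⟨_, F.isSolutionOn fun s _ => F.subset_dom (F.invariant _ hx s), F.map_zero x, hy⟩

/-- In the compact set `Y` a curve with only one cluster point converges, so a one-point `α`-limit
set is a genuine limit. -/
theorem tendsto_atBot_of_mem_unstableSet (hf : ContDiff ℝ 1 f) (hY : IsCompact Y)
    {x a : Phase n} (hx : x ∈ Y) (h : x ∈ unstableSet f {a}) :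
    Tendsto (fun t => F.φ t x) atBot (𝓝 a) := by
  obtain ⟨-, γ, hγ, rfl, -, hα⟩ := h
  have he : γ =ᶠ[atBot] fun t => F.φ t (γ 0) := by
    filter_upwards [eventually_le_atBot 0] with t ht using F.eq_of_isSolutionOn_Iic hf hγ hx ht
  refine Tendsto.congr' he ?_
  refine hY.le_nhds_of_unique_clusterPt (l := map γ atBot) ?_ fun y _ hy => hα hy
  rw [mem_map]
  filter_upwards [he] with t ht
  rw [mem_preimage, ht]
  exact F.invariant _ hx t

theorem tendsto_atTop_of_mem_stableSet (hf : ContDiff ℝ 1 f) (hY : IsCompact Y)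
    {x a : Phase n} (hx : x ∈ Y) (h : x ∈ stableSet f {a}) :
    Tendsto (fun t => F.φ t x) atTop (𝓝 a) := by
  obtain ⟨-, γ, hγ, rfl, -, hα⟩ := h
  have he : γ =ᶠ[atTop] fun t => F.φ t (γ 0) := by
    filter_upwards [eventually_ge_atTop 0] with t ht using F.eq_of_isSolutionOn_Ici hf hγ hx ht
  refine Tendsto.congr' he ?_
  refine hY.le_nhds_of_unique_clusterPt (l := map γ atTop) ?_ fun y _ hy => hα hy
  rw [mem_map]
  filter_upwards [he] with t ht
  rw [mem_preimage, ht]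
  exact F.invariant _ hx t

/-- Membership in `Y` is deliberately not required: cleanness is applied to the result in order to
place newly constructed points in `Y`. -/
theorem mem_unstableSet_of_tendsto {x a : Phase n} (hx : x ∈ orthant n)
    (hd : ∀ t ≤ 0, F.φ t x ∈ F.dom) (h : Tendsto (fun t => F.φ t x) atBot (𝓝 a)) :
    x ∈ unstableSet f {a} := by
  refine ⟨hx, _, F.isSolutionOn hd, F.map_zero x, ⟨a, ?_⟩, fun y hy => ?_⟩
  · exact h.mapClusterPt
  · have hy' : ClusterPt y (𝓝 a) := ClusterPt.mono hy h
    exact eq_of_nhds_neBot hy'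

theorem mem_stableSet_of_tendsto {x a : Phase n} (hx : x ∈ orthant n)
    (hd : ∀ t ≥ 0, F.φ t x ∈ F.dom) (h : Tendsto (fun t => F.φ t x) atTop (𝓝 a)) :
    x ∈ stableSet f {a} := by
  refine ⟨hx, _, F.isSolutionOn hd, F.map_zero x, ⟨a, ?_⟩, fun y hy => ?_⟩
  · exact h.mapClusterPt
  · have hy' : ClusterPt y (𝓝 a) := ClusterPt.mono hy h
    exact eq_of_nhds_neBot hy'

theorem mem_connection_iff (hf : ContDiff ℝ 1 f) (hY : IsCompact Y) (hor : Y ⊆ orthant n)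
    {x a b : Phase n} (hx : x ∈ Y) :
    x ∈ connection f a b ↔ Tendsto (fun t => F.φ t x) atBot (𝓝 a) ∧
      Tendsto (fun t => F.φ t x) atTop (𝓝 b) := by
  have hd : ∀ t, F.φ t x ∈ F.dom := fun t => F.subset_dom (F.invariant x hx t)
  exact ⟨fun h => ⟨F.tendsto_atBot_of_mem_unstableSet hf hY hx h.1,
      F.tendsto_atTop_of_mem_stableSet hf hY hx h.2⟩,
    fun h => ⟨F.mem_unstableSet_of_tendsto (hor hx) (fun t _ => hd t) h.1,
      F.mem_stableSet_of_tendsto (hor hx) (fun t _ => hd t) h.2⟩⟩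

theorem tendsto_atBot_map {x a : Phase n} (h : Tendsto (fun t => F.φ t x) atBot (𝓝 a)) (s : ℝ) :
    Tendsto (fun t => F.φ t (F.φ s x)) atBot (𝓝 a) := by
  simp_rw [← F.map_add]
  exact h.comp (tendsto_atBot_add_const_right _ s tendsto_id)

theorem tendsto_atTop_map {x a : Phase n} (h : Tendsto (fun t => F.φ t x) atTop (𝓝 a)) (s : ℝ) :
    Tendsto (fun t => F.φ t (F.φ s x)) atTop (𝓝 a) := by
  simp_rw [← F.map_add]
  exact h.comp (tendsto_atTop_add_const_right _ s tendsto_id)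

/-- Points of one orbit have the same orbit. -/
theorem range_map (s : ℝ) (x : Phase n) :
    (range fun t => F.φ t (F.φ s x)) = range fun t => F.φ t x := by
  ext y
  constructor
  · rintro ⟨t, rfl⟩
    exact ⟨t + s, F.map_add t s x⟩
  · rintro ⟨t, rfl⟩
    exact ⟨t - s, by simp only [← F.map_add, sub_add_cancel]⟩

end NetworkFlow

/-! ### Linearisation at an equilibrium on a coordinate axis -/

section Linearisation

variable {n : ℕ} {f : Phase n → Phase n}

/-- The diagonal entries of the Jacobian. -/
noncomputable def rate (f : Phase n → Phase n) (p : Phase n) (l : Fin n) : ℝ :=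
  fderiv ℝ f p (EuclideanSpace.single l 1) l

/-- The Jacobian commutes with the sign changes that fix the base point. -/
theorem fderiv_signAct (hf : ContDiff ℝ 1 f) (heq : IsZ2Equivariant f) {s : Fin n → ℤˣ}
    {p : Phase n} (hp : signAct s p = p) (v : Phase n) :
    fderiv ℝ f p (signAct s v) = signAct s (fderiv ℝ f p v) := by
  have hd : HasFDerivAt f (fderiv ℝ f p) p := (hf.differentiable one_ne_zero p).hasFDerivAt
  set S := (signLinear s).toContinuousLinearMap with hS
  have h1 : HasFDerivAt (fun x => f (S x)) ((fderiv ℝ f p).comp S) p := by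
    refine HasFDerivAt.comp p ?_ S.hasFDerivAt
    have : S p = p := hp
    rwa [this]
  have h2 : HasFDerivAt (fun x => S (f x)) (S.comp (fderiv ℝ f p)) p :=
    S.hasFDerivAt.comp p hd
  have h3 : (fun x => f (S x)) = fun x => S (f x) := funext fun x => heq s x
  rw [h3] at h1
  exact DFunLike.congr_fun (h1.unique h2) v

/-- At an equilibrium on a coordinate axis the Jacobian is diagonal. -/
theorem fderiv_apply_eq_rate (hf : ContDiff ℝ 1 f) (heq : IsZ2Equivariant f) {i : Fin n}
    {p : Phase n} (hp : p ∈ coordAxis i) (v : Phase n) (l : Fin n) :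
    fderiv ℝ f p v l = rate f p l * v l := by
  have hflip : ∀ t, t ≠ i → ∀ v,
      fderiv ℝ f p (signAct (flipSign t) v) = signAct (flipSign t) (fderiv ℝ f p v) :=
    fun t ht v => fderiv_signAct hf heq (signAct_flipSign_eq_self_iff.2 (hp t ht)) v
  -- At least one of `l` and `m` differs from `i`. Flipping that coordinate fixes `p` and reverses
  -- exactly one side of the commutation relation, so the entry equals its own negative.
  have hoff : ∀ m, m ≠ l → fderiv ℝ f p (EuclideanSpace.single m 1) l = 0 := by
    intro m hml
    by_cases hl : l = i
    · have hm : m ≠ i := fun h => hml (h.trans hl.symm)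
      have hs : signAct (flipSign m) (EuclideanSpace.single m (1 : ℝ)) =
          -EuclideanSpace.single m (1 : ℝ) := by
        ext k
        by_cases hk : k = m
        · subst hk; rw [signAct_flipSign_self]; rfl
        · rw [signAct_flipSign_of_ne hk]; simp [hk]
      have := congrArg (fun y : Phase n => y l) (hflip m hm (EuclideanSpace.single m 1))
      simp only [hs, map_neg, signAct_flipSign_of_ne hml.symm, PiLp.neg_apply] at this
      linarith
    · have hs : signAct (flipSign l) (EuclideanSpace.single m (1 : ℝ)) =
          EuclideanSpace.single m (1 : ℝ) := by
        rw [signAct_flipSign_eq_self_iff]; simp [hml.symm]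
      have := congrArg (fun y : Phase n => y l) (hflip l hl (EuclideanSpace.single m 1))
      simp only [hs, signAct_flipSign_self] at this
      linarith
  have hv : v = ∑ m, v m • EuclideanSpace.single m (1 : ℝ) := by
    ext k
    simp [Finset.sum_apply, Pi.single_apply]
  conv_lhs => rw [hv]
  rw [map_sum]
  simp only [map_smul, WithLp.ofLp_sum, Finset.sum_apply, PiLp.smul_apply, smul_eq_mul]
  rw [Finset.sum_eq_single l (fun m _ hm => by rw [hoff m hm, mul_zero]) (by simp)]
  rw [rate, mul_comm]

/-- Because the Jacobian is diagonal, every spectral hypothesis becomes a statement about the signs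
of `rate f p l`. -/
theorem complexEigenvalues_jacobian (hf : ContDiff ℝ 1 f) (heq : IsZ2Equivariant f) {i : Fin n}
    {p : Phase n} (hp : p ∈ coordAxis i) :
    complexEigenvalues (jacobian f p) = Finset.univ.val.map fun l => ((rate f p l : ℝ) : ℂ) := by
  have hmat : LinearMap.toMatrix (EuclideanSpace.basisFun (Fin n) ℝ).toBasis
      (EuclideanSpace.basisFun (Fin n) ℝ).toBasis (jacobian f p) =
      Matrix.diagonal (rate f p) := by
    ext a b
    rw [LinearMap.toMatrix_apply]
    simp only [OrthonormalBasis.coe_toBasis, EuclideanSpace.basisFun_apply,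
      OrthonormalBasis.coe_toBasis_repr_apply, EuclideanSpace.basisFun_repr, jacobian,
      ContinuousLinearMap.coe_coe]
    rw [fderiv_apply_eq_rate hf heq hp]
    by_cases hab : a = b
    · subst hab; simp
    · simp [hab]
  rw [complexEigenvalues, ← LinearMap.charpoly_toMatrix _
    (EuclideanSpace.basisFun (Fin n) ℝ).toBasis, hmat, Matrix.charpoly_diagonal]
  rw [Polynomial.aroots_def, Polynomial.map_prod]
  simp only [Polynomial.map_sub, Polynomial.map_X, Polynomial.map_C]
  have := Polynomial.roots_multiset_prod_X_sub_C
    (Finset.univ.val.map fun l => ((rate f p l : ℝ) : ℂ))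
  rw [Multiset.map_map] at this
  exact this

theorem rate_ne_zero (hf : ContDiff ℝ 1 f) (heq : IsZ2Equivariant f) {i : Fin n}
    {p : Phase n} (hp : p ∈ coordAxis i) (hh : IsHyperbolicEquilibrium f p) (l : Fin n) :
    rate f p l ≠ 0 := by
  have := hh.2 (rate f p l) (by rw [complexEigenvalues_jacobian hf heq hp]; simp)
  simpa using this

/-- The unstable coordinate directions. -/
noncomputable def unstableIdx (f : Phase n → Phase n) (p : Phase n) : Finset (Fin n) :=
  Finset.univ.filter fun l => 0 < rate f p l

@[simp] theorem mem_unstableIdx {p : Phase n} {l : Fin n} :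
    l ∈ unstableIdx f p ↔ 0 < rate f p l := by simp [unstableIdx]

theorem card_unstableIdx (hf : ContDiff ℝ 1 f) (heq : IsZ2Equivariant f) {i : Fin n}
    {p : Phase n} (hp : p ∈ coordAxis i) : (unstableIdx f p).card = unstableDim f p := by
  rw [unstableDim, complexEigenvalues_jacobian hf heq hp, Multiset.filter_map, Multiset.card_map]
  simp only [Function.comp_def, Complex.ofReal_re]
  rw [unstableIdx, Finset.card_def, Finset.filter_val]

/-- An axis direction contained in `P` is contracted at a sink of the restriction to `P`. -/
theorem rate_neg_of_isSinkIn (hf : ContDiff ℝ 1 f) (heq : IsZ2Equivariant f) {i : Fin n}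
    {p : Phase n} (hp : p ∈ coordAxis i) {P : Submodule ℝ (Phase n)} (hP : IsSinkIn f P p)
    {l : Fin n} (hl : EuclideanSpace.single l (1 : ℝ) ∈ P) : rate f p l < 0 := by
  obtain ⟨-, h, hneg⟩ := hP
  set v : P := ⟨EuclideanSpace.single l 1, hl⟩ with hv
  have hev : Module.End.HasEigenvector ((jacobian f p).restrict h) (rate f p l) v := by
    rw [Module.End.hasEigenvector_iff, Module.End.mem_eigenspace_iff]
    constructor
    · apply Subtype.ext
      ext k
      change fderiv ℝ f p (EuclideanSpace.single l 1) k =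
        (rate f p l • EuclideanSpace.single l (1 : ℝ) : Phase n) k
      rw [fderiv_apply_eq_rate hf heq hp]
      by_cases hk : k = l
      · subst hk; simp
      · simp [hk]
    · intro h0
      have := congrArg (fun y : P => (y : Phase n) l) h0
      simp [hv] at this
  have hroot := (Module.End.hasEigenvalue_iff_isRoot_charpoly _ _).1
    (Module.End.hasEigenvalue_of_hasEigenvector hev)
  have := hneg (rate f p l : ℂ) ?_
  · simpa using this
  · rw [complexEigenvalues, Polynomial.mem_aroots]
    refine ⟨(LinearMap.charpoly_monic _).ne_zero, ?_⟩
    rw [show ((rate f p l : ℝ) : ℂ) = algebraMap ℝ ℂ (rate f p l) from rfl,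
      Polynomial.aeval_algebraMap_apply, Polynomial.coe_aeval_eq_eval, hroot.eq_zero, map_zero]

end Linearisation

/-! ### Local analysis near a hyperbolic equilibrium on an axis -/

section LocalAnalysis

variable {n : ℕ} {f : Phase n → Phase n} {Y : Set (Phase n)}

theorem monotoneOn_of_hasDerivAt_nonneg {D : Set ℝ} (hD : Convex ℝ D) {q q' : ℝ → ℝ}
    (h : ∀ t ∈ D, HasDerivAt q (q' t) t) (h0 : ∀ t ∈ D, 0 ≤ q' t) : MonotoneOn q D :=
  monotoneOn_of_deriv_nonneg hD (fun t ht => (h t ht).continuousAt.continuousWithinAt)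
    (fun t ht => (h t (interior_subset ht)).differentiableAt.differentiableWithinAt)
    fun t ht => by rw [(h t (interior_subset ht)).deriv]; exact h0 t (interior_subset ht)

/-- The squared length of the projection to the coordinates in `I`. -/
def sqSum (I : Finset (Fin n)) (z : Phase n) : ℝ := ∑ l ∈ I, z l ^ 2

theorem sqSum_univ (z : Phase n) : sqSum Finset.univ z = ‖z‖ ^ 2 :=
  (EuclideanSpace.real_norm_sq_eq z).symm

theorem sqSum_nonneg (I : Finset (Fin n)) (z : Phase n) : 0 ≤ sqSum I z :=
  Finset.sum_nonneg fun _ _ => sq_nonneg _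

theorem sqSum_le_norm_sq (I : Finset (Fin n)) (z : Phase n) : sqSum I z ≤ ‖z‖ ^ 2 := by
  rw [← sqSum_univ]
  exact Finset.sum_le_sum_of_subset_of_nonneg (Finset.subset_univ _) fun _ _ _ => sq_nonneg _

theorem continuous_sqSum (I : Finset (Fin n)) : Continuous (sqSum I) :=
  continuous_finsetSum _ fun l _ => ((EuclideanSpace.proj (𝕜 := ℝ) l).continuous).pow 2

theorem hasDerivAt_coord {z : ℝ → Phase n} {z' : Phase n} {t : ℝ} (h : HasDerivAt z z' t)
    (l : Fin n) : HasDerivAt (fun s => z s l) (z' l) t :=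
  (EuclideanSpace.proj (𝕜 := ℝ) l).hasFDerivAt.comp_hasDerivAt t h

theorem hasDerivAt_sqSum {z : ℝ → Phase n} {z' : Phase n} {t : ℝ} (h : HasDerivAt z z' t)
    (I : Finset (Fin n)) :
    HasDerivAt (fun s => sqSum I (z s)) (2 * ∑ l ∈ I, z t l * z' l) t := by
  rw [Finset.mul_sum]
  refine HasDerivAt.fun_sum fun l _ => ?_
  refine ((hasDerivAt_coord h l).fun_pow 2).congr_deriv ?_
  push_cast; ring

/-- A closed ball around `p` in which the field is close to its hyperbolic linear part: differences
of solutions satisfy a cone condition, and the unstable part expands inside the cone. -/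
structure IsHyperbolicBall (F : NetworkFlow f Y) (p : Phase n) (ρ μ : ℝ) : Prop where
  radius_pos : 0 < ρ
  rate_pos : 0 < μ
  subset_dom : Metric.closedBall p ρ ⊆ F.dom
  cone : ∀ x ∈ Metric.closedBall p ρ, ∀ y ∈ Metric.closedBall p ρ,
    μ * ‖x - y‖ ^ 2 ≤ 2 * ∑ l ∈ unstableIdx f p, (x - y) l * (f x - f y) l -
      ∑ l, (x - y) l * (f x - f y) l
  expand : ∀ x ∈ Metric.closedBall p ρ, ‖x - p‖ ^ 2 ≤ 2 * sqSum (unstableIdx f p) (x - p) →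
    μ * sqSum (unstableIdx f p) (x - p) ≤ 2 * ∑ l ∈ unstableIdx f p, (x - p) l * f x l

theorem IsHyperbolicBall.mono {F : NetworkFlow f Y} {p : Phase n} {ρ ρ' μ : ℝ}
    (h : IsHyperbolicBall F p ρ μ) (h0 : 0 < ρ') (hle : ρ' ≤ ρ) : IsHyperbolicBall F p ρ' μ :=
  have hs := Metric.closedBall_subset_closedBall (x := p) hle
  ⟨h0, h.rate_pos, hs.trans h.subset_dom, fun x hx y hy => h.cone x (hs hx) y (hs hy),
    fun x hx => h.expand x (hs hx)⟩

/-- The linear part is diagonal with entries bounded away from zero, and strict differentiability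
bounds the remainder of `f x - f y` by a small multiple of `‖x - y‖`, which the linear part absorbs.
-/
theorem exists_isHyperbolicBall (F : NetworkFlow f Y) (hf : ContDiff ℝ 1 f)
    (heq : IsZ2Equivariant f) {i : Fin n} {p : Phase n} (hp : p ∈ equilibriaIn f Y)
    (hpi : p ∈ coordAxis i) (hh : IsHyperbolicEquilibrium f p) :
    ∃ ρ μ, IsHyperbolicBall F p ρ μ := by
  obtain ⟨m, hm0, hm⟩ : ∃ m > 0, ∀ l, m ≤ |rate f p l| := by
    have hne : ∀ l, 0 < |rate f p l| := fun l => abs_pos.2 (rate_ne_zero hf heq hpi hh l)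
    have : Nonempty (Fin n) := ⟨i⟩
    obtain ⟨l₀, hl₀⟩ := Finite.exists_min fun l => |rate f p l|
    exact ⟨_, hne l₀, hl₀⟩
  -- After Young's inequality the cone rate is at least `m - η = 3m/4` and the expansion rate at
  -- least `2m - 3η = 5m/4`; both exceed the claimed `m / 2`.
  set η : ℝ := m / 4 with hη
  have hη0 : 0 < η := by positivity
  have hstrict := (hf.contDiffAt (x := p)).hasStrictFDerivAt one_ne_zero
  have hR := hstrict.isLittleO.def hη0
  obtain ⟨V, hV, hVR⟩ : ∃ V ∈ 𝓝 p, ∀ x ∈ V, ∀ y ∈ V,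
      ‖f x - f y - fderiv ℝ f p (x - y)‖ ≤ η * ‖x - y‖ := by
    rw [nhds_prod_eq] at hR
    obtain ⟨V, hV, h⟩ := eventually_prod_self_iff'.1 hR
    exact ⟨V, hV, fun x hx y hy => h x hx y hy⟩
  obtain ⟨ρ, hρ0, hρ⟩ := Metric.nhds_basis_closedBall.mem_iff.1
    (inter_mem hV (F.isOpen_dom.mem_nhds (F.subset_dom hp.1)))
  have hrem : ∀ x ∈ Metric.closedBall p ρ, ∀ y ∈ Metric.closedBall p ρ,
      ∃ R : Phase n, (∀ l, (f x - f y) l = rate f p l * (x - y) l + R l) ∧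
        ∑ l, R l ^ 2 ≤ η ^ 2 * ‖x - y‖ ^ 2 := by
    intro x hx y hy
    refine ⟨f x - f y - fderiv ℝ f p (x - y), fun l => ?_, ?_⟩
    · have e := fderiv_apply_eq_rate hf heq hpi (x - y) l
      change (f x - f y) l = _ + ((f x - f y) l - fderiv ℝ f p (x - y) l)
      linarith
    · rw [← EuclideanSpace.real_norm_sq_eq, ← mul_pow]
      exact pow_le_pow_left₀ (norm_nonneg _) (hVR x (hρ hx).1 y (hρ hy).1) 2
  have young : ∀ a b : ℝ, -(η / 2 * a ^ 2 + b ^ 2 / (2 * η)) ≤ a * b ∧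
      a * b ≤ η / 2 * a ^ 2 + b ^ 2 / (2 * η) := by
    intro a b
    have h1 : η / 2 * a ^ 2 + b ^ 2 / (2 * η) - a * b = (η * a - b) ^ 2 / (2 * η) := by
      field_simp; ring
    have h2 : η / 2 * a ^ 2 + b ^ 2 / (2 * η) + a * b = (η * a + b) ^ 2 / (2 * η) := by
      field_simp; ring
    have h3 : 0 ≤ (η * a - b) ^ 2 / (2 * η) := by positivity
    have h4 : 0 ≤ (η * a + b) ^ 2 / (2 * η) := by positivity
    constructor <;> linarith
  refine ⟨ρ, m / 2, hρ0, by positivity, fun x hx => (hρ hx).2, fun x hx y hy => ?_,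
    fun x hx hcone => ?_⟩
  · obtain ⟨R, hRl, hRs⟩ := hrem x hx y hy
    set z := x - y
    have hsplit : 2 * ∑ l ∈ unstableIdx f p, z l * (f x - f y) l - ∑ l, z l * (f x - f y) l =
        ∑ l, (if 0 < rate f p l then (1 : ℝ) else -1) * (z l * (f x - f y) l) := by
      rw [unstableIdx, Finset.sum_filter, Finset.mul_sum, ← Finset.sum_sub_distrib]
      refine Finset.sum_congr rfl fun l _ => ?_
      split_ifs <;> ring
    have hterm : ∀ l, m * z l ^ 2 - (η / 2 * z l ^ 2 + R l ^ 2 / (2 * η)) ≤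
        (if 0 < rate f p l then (1 : ℝ) else -1) * (z l * (f x - f y) l) := by
      intro l
      rw [hRl l]
      have hy := young (z l) (R l)
      have hml := hm l
      split_ifs with hl
      · rw [abs_of_pos hl] at hml
        nlinarith [mul_le_mul_of_nonneg_right hml (sq_nonneg (z l)), hy.1]
      · rw [abs_of_nonpos (not_lt.1 hl)] at hml
        nlinarith [mul_le_mul_of_nonneg_right hml (sq_nonneg (z l)), hy.2]
    rw [hsplit]
    refine le_trans ?_ (Finset.sum_le_sum fun l _ => hterm l)
    rw [Finset.sum_sub_distrib, Finset.sum_add_distrib, ← Finset.mul_sum, ← Finset.mul_sum,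
      ← Finset.sum_div, ← EuclideanSpace.real_norm_sq_eq]
    have : (∑ l, R l ^ 2) / (2 * η) ≤ η / 2 * ‖z‖ ^ 2 := by
      rw [div_le_iff₀ (by positivity)]; nlinarith
    nlinarith [sq_nonneg ‖z‖]
  · obtain ⟨R, hRl, hRs⟩ := hrem x hx p (Metric.mem_closedBall_self hρ0.le)
    rw [hp.2, sub_zero] at hRl
    set z := x - p
    have hterm : ∀ l ∈ unstableIdx f p, m * z l ^ 2 - (η / 2 * z l ^ 2 + R l ^ 2 / (2 * η)) ≤
        z l * f x l := by
      intro l hl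
      rw [mem_unstableIdx] at hl
      rw [hRl l]
      have hml := hm l
      rw [abs_of_pos hl] at hml
      nlinarith [mul_le_mul_of_nonneg_right hml (sq_nonneg (z l)), (young (z l) (R l)).1]
    have hsum := Finset.sum_le_sum hterm
    rw [Finset.sum_sub_distrib, Finset.sum_add_distrib, ← Finset.mul_sum, ← Finset.mul_sum,
      ← Finset.sum_div] at hsum
    change m * sqSum _ z - (η / 2 * sqSum _ z + sqSum (unstableIdx f p) R / (2 * η)) ≤ _ at hsum
    have hRle : sqSum (unstableIdx f p) R ≤ η ^ 2 * ‖z‖ ^ 2 :=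
      (sqSum_le_norm_sq _ R).trans (by rw [EuclideanSpace.real_norm_sq_eq]; exact hRs)
    have : sqSum (unstableIdx f p) R / (2 * η) ≤ η / 2 * ‖z‖ ^ 2 := by
      rw [div_le_iff₀ (by positivity)]; nlinarith
    have h0 := sqSum_nonneg (unstableIdx f p) z
    nlinarith

namespace IsHyperbolicBall

variable {F : NetworkFlow f Y} {p : Phase n} {ρ μ : ℝ}

/-- The backward orbit of `x` stays in the ball. -/
def _root_.NetworkFlow.BackwardIn (F : NetworkFlow f Y) (p : Phase n) (ρ : ℝ) (x : Phase n) :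
    Prop :=
  ∀ t ≤ 0, F.φ t x ∈ Metric.closedBall p ρ

theorem _root_.NetworkFlow.BackwardIn.map {x : Phase n} (hx : F.BackwardIn p ρ x) {s : ℝ}
    (hs : s ≤ 0) : F.BackwardIn p ρ (F.φ s x) := fun t ht => by
  rw [← F.map_add]; exact hx _ (by linarith)

theorem _root_.NetworkFlow.BackwardIn.self {x : Phase n} (hx : F.BackwardIn p ρ x) :
    x ∈ Metric.closedBall p ρ := by simpa [F.map_zero] using hx 0 le_rfl

theorem hasDerivAt_sqSum_sub (h : IsHyperbolicBall F p ρ μ) {x y : Phase n} {t : ℝ}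
    (hx : F.φ t x ∈ Metric.closedBall p ρ) (hy : F.φ t y ∈ Metric.closedBall p ρ)
    (I : Finset (Fin n)) :
    HasDerivAt (fun s => sqSum I (F.φ s x - F.φ s y))
      (2 * ∑ l ∈ I, (F.φ t x - F.φ t y) l * (f (F.φ t x) - f (F.φ t y)) l) t :=
  hasDerivAt_sqSum ((F.hasDerivAt x t (h.subset_dom hx)).sub
    (F.hasDerivAt y t (h.subset_dom hy))) I

/-- The form is (unstable part)² - (stable part)² of the difference of two orbits. Its growth at a
rate controlled by the full squared norm plays the role of the unstable manifold theorem. -/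
theorem hasDerivAt_cone (h : IsHyperbolicBall F p ρ μ) {x y : Phase n} {t : ℝ}
    (hx : F.φ t x ∈ Metric.closedBall p ρ) (hy : F.φ t y ∈ Metric.closedBall p ρ) :
    ∃ d, HasDerivAt
      (fun s => 2 * sqSum (unstableIdx f p) (F.φ s x - F.φ s y) - ‖F.φ s x - F.φ s y‖ ^ 2) d t ∧
      2 * μ * ‖F.φ t x - F.φ t y‖ ^ 2 ≤ d := by
  have h1 := (h.hasDerivAt_sqSum_sub hx hy (unstableIdx f p)).const_mul 2
  have h2 := h.hasDerivAt_sqSum_sub hx hy Finset.univ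
  simp only [sqSum_univ] at h2
  exact ⟨_, h1.sub h2, by linarith [h.cone _ hx _ hy]⟩

/-- Points whose backward orbits stay in the ball lie in each other's unstable cones. -/
theorem norm_sub_sq_le (h : IsHyperbolicBall F p ρ μ) {x y : Phase n}
    (hx : F.BackwardIn p ρ x) (hy : F.BackwardIn p ρ y) :
    ‖x - y‖ ^ 2 ≤ 2 * sqSum (unstableIdx f p) (x - y) := by
  set q : ℝ → ℝ :=
    fun s => 2 * sqSum (unstableIdx f p) (F.φ s x - F.φ s y) - ‖F.φ s x - F.φ s y‖ ^ 2 with hq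
  have hder : ∀ t, ∃ d, t ≤ 0 → HasDerivAt q d t ∧ 2 * μ * ‖F.φ t x - F.φ t y‖ ^ 2 ≤ d := by
    intro t
    by_cases ht : t ≤ 0
    · obtain ⟨d, hd⟩ := h.hasDerivAt_cone (hx t ht) (hy t ht)
      exact ⟨d, fun _ => hd⟩
    · exact ⟨0, fun h => absurd h ht⟩
  choose d hd using hder
  have hμ := h.rate_pos
  have hmono : MonotoneOn q (Iic 0) := monotoneOn_of_hasDerivAt_nonneg (convex_Iic 0)
    (fun t ht => (hd t ht).1) fun t ht => le_trans (by positivity) (hd t ht).2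
  have hlow : ∀ t, -q t ≤ ‖F.φ t x - F.φ t y‖ ^ 2 := fun t => by
    simp only [hq]; linarith [sqSum_nonneg (unstableIdx f p) (F.φ t x - F.φ t y)]
  by_contra hcon
  have hq0 : q 0 < 0 := by
    simp only [hq, F.map_zero]; linarith [not_le.1 hcon]
  -- If the form is negative at time `0`, monotonicity keeps it below `q 0` in the past, so the
  -- squared distance stays above `-q 0` and the slope above `c`. The form then goes to `-∞`
  -- backwards, against the bound `(2 * ρ) ^ 2` on the squared distance.
  set c := 2 * μ * (-q 0) with hc
  have hc0 : 0 < c := by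
    have : 0 < -q 0 := by linarith
    positivity
  have hmono' : MonotoneOn (fun t => q t - c * t) (Iic 0) := by
    refine monotoneOn_of_hasDerivAt_nonneg (convex_Iic 0) (q' := fun t => d t - c)
      (fun t ht => ?_) fun t ht => ?_
    · simpa using (hd t ht).1.fun_sub ((hasDerivAt_id' t).const_mul c)
    · have h1 := hmono ht (mem_Iic.2 le_rfl) ht
      have h2 := (hd t ht).2
      have h3 := hlow t
      have h4 : c ≤ 2 * μ * ‖F.φ t x - F.φ t y‖ ^ 2 := by
        rw [hc]; gcongr; linarith
      linarith
  have hbound : ∀ t ≤ 0, -q t ≤ (2 * ρ) ^ 2 := by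
    intro t ht
    refine (hlow t).trans (pow_le_pow_left₀ (norm_nonneg _) ?_ 2)
    have h1 := hx t ht
    have h2 := hy t ht
    rw [← dist_eq_norm]
    rw [Metric.mem_closedBall] at h1 h2
    linarith [dist_triangle_right (F.φ t x) (F.φ t y) p]
  set T := -((2 * ρ) ^ 2 / c) with hT
  have hT0 : T ≤ 0 := by
    have : 0 ≤ (2 * ρ) ^ 2 / c := by positivity
    linarith
  have h1 : q T - c * T ≤ q 0 - c * 0 := hmono' (mem_Iic.2 hT0) (mem_Iic.2 le_rfl) hT0
  have h2 : c * T = -(2 * ρ) ^ 2 := by rw [hT]; field_simp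
  have h3 := hbound T hT0
  linarith

theorem backwardIn_self (h : IsHyperbolicBall F p ρ μ) (hp : ∀ t, F.φ t p = p) :
    F.BackwardIn p ρ p := fun t _ => by
  rw [hp]; exact Metric.mem_closedBall_self h.radius_pos.le

/-- Exponential backward decay of the unstable part. -/
theorem sqSum_map_le (h : IsHyperbolicBall F p ρ μ) (hp : ∀ t, F.φ t p = p) (hfp : f p = 0)
    {x : Phase n} {T : ℝ} (hT : T ≤ 0)
    (hx : ∀ t ∈ Icc T 0, F.φ t x ∈ Metric.closedBall p ρ ∧
      ‖F.φ t x - p‖ ^ 2 ≤ 2 * sqSum (unstableIdx f p) (F.φ t x - p)) :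
    sqSum (unstableIdx f p) (F.φ T x - p) ≤
      Real.exp (μ * T) * sqSum (unstableIdx f p) (x - p) := by
  set w : ℝ → ℝ := fun t => sqSum (unstableIdx f p) (F.φ t x - p) with hw
  have hmono : MonotoneOn (fun t => w t * Real.exp (-(μ * t))) (Icc T 0) := by
    refine monotoneOn_of_hasDerivAt_nonneg (convex_Icc T 0)
      (q' := fun t => (2 * ∑ l ∈ unstableIdx f p, (F.φ t x - p) l * f (F.φ t x) l - μ * w t) *
        Real.exp (-(μ * t))) (fun t ht => ?_) fun t ht => ?_
    · have h1 := h.hasDerivAt_sqSum_sub (hx t ht).1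
        (y := p) (by rw [hp]; exact Metric.mem_closedBall_self h.radius_pos.le) (unstableIdx f p)
      simp only [hp, hfp, sub_zero] at h1
      have h2 : HasDerivAt (fun t => Real.exp (-(μ * t))) (Real.exp (-(μ * t)) * (-(μ * 1))) t :=
        ((hasDerivAt_id t).const_mul μ).neg.exp
      refine (h1.fun_mul h2).congr_deriv ?_
      simp only [hw]; ring
    · exact mul_nonneg (sub_nonneg.2 (h.expand _ (hx t ht).1 (hx t ht).2)) (Real.exp_pos _).le
  have h1 := hmono (left_mem_Icc.2 hT) (right_mem_Icc.2 hT) hT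
  simp only [hw, F.map_zero, mul_zero, neg_zero, Real.exp_zero, mul_one] at h1
  calc w T = w T * Real.exp (-(μ * T)) * Real.exp (μ * T) := by
        rw [mul_assoc, ← Real.exp_add]; simp
    _ ≤ sqSum (unstableIdx f p) (x - p) * Real.exp (μ * T) := by gcongr
    _ = _ := mul_comm _ _

theorem norm_sub_sq_le_self (h : IsHyperbolicBall F p ρ μ) (hp : ∀ t, F.φ t p = p)
    {x : Phase n} (hx : F.BackwardIn p ρ x) :
    ‖x - p‖ ^ 2 ≤ 2 * sqSum (unstableIdx f p) (x - p) :=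
  h.norm_sub_sq_le hx (h.backwardIn_self hp)

theorem sqSum_map_le_of_backwardIn (h : IsHyperbolicBall F p ρ μ) (hp : ∀ t, F.φ t p = p)
    (hfp : f p = 0) {x : Phase n} (hx : F.BackwardIn p ρ x) {t : ℝ} (ht : t ≤ 0) :
    sqSum (unstableIdx f p) (F.φ t x - p) ≤
      Real.exp (μ * t) * sqSum (unstableIdx f p) (x - p) :=
  h.sqSum_map_le hp hfp ht fun _ hs =>
    ⟨hx _ hs.2, h.norm_sub_sq_le_self hp (hx.map hs.2)⟩

/-- The bound does not depend on `x`. This uniformity controls the initial parts of all trajectories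
of a cross section at once. -/
theorem dist_map_sq_le (h : IsHyperbolicBall F p ρ μ) (hp : ∀ t, F.φ t p = p) (hfp : f p = 0)
    {x : Phase n} (hx : F.BackwardIn p ρ x) {t : ℝ} (ht : t ≤ 0) :
    dist (F.φ t x) p ^ 2 ≤ 2 * ρ ^ 2 * Real.exp (μ * t) := by
  have h1 := h.norm_sub_sq_le_self hp (hx.map ht)
  have h2 := h.sqSum_map_le_of_backwardIn hp hfp hx ht
  have h3 : sqSum (unstableIdx f p) (x - p) ≤ ρ ^ 2 := by
    refine (sqSum_le_norm_sq _ _).trans (pow_le_pow_left₀ (norm_nonneg _) ?_ 2)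
    rw [← dist_eq_norm]; exact hx.self
  rw [dist_eq_norm]
  nlinarith [Real.exp_pos (μ * t)]

theorem tendsto_exp_bound (h : IsHyperbolicBall F p ρ μ) :
    Tendsto (fun t => 2 * ρ ^ 2 * Real.exp (μ * t)) atBot (𝓝 0) := by
  have : Tendsto (fun t : ℝ => Real.exp (μ * t)) atBot (𝓝 0) :=
    Real.tendsto_exp_atBot.comp (tendsto_id.const_mul_atBot h.rate_pos)
  simpa using this.const_mul (2 * ρ ^ 2)

theorem tendsto_of_backwardIn (h : IsHyperbolicBall F p ρ μ) (hp : ∀ t, F.φ t p = p)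
    (hfp : f p = 0) {x : Phase n} (hx : F.BackwardIn p ρ x) :
    Tendsto (fun t => F.φ t x) atBot (𝓝 p) := by
  rw [tendsto_iff_dist_tendsto_zero]
  have h2 : Tendsto (fun t => dist (F.φ t x) p ^ 2) atBot (𝓝 0) := by
    refine squeeze_zero' (Eventually.of_forall fun t => by positivity) ?_ h.tendsto_exp_bound
    filter_upwards [eventually_le_atBot 0] with t ht using h.dist_map_sq_le hp hfp hx ht
  have h3 := h2.sqrt
  simpa [Real.sqrt_sq dist_nonneg] using h3

/-- Two points with the same unstable coordinates whose backward orbits stay near `p` coincide. -/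
theorem eq_of_backwardIn (h : IsHyperbolicBall F p ρ μ) {x y : Phase n}
    (hx : F.BackwardIn p ρ x) (hy : F.BackwardIn p ρ y)
    (hxy : ∀ l ∈ unstableIdx f p, x l = y l) : x = y := by
  have h1 := h.norm_sub_sq_le hx hy
  have h2 : sqSum (unstableIdx f p) (x - y) = 0 :=
    Finset.sum_eq_zero fun l hl => by simp [hxy l hl]
  rw [h2, mul_zero] at h1
  have : ‖x - y‖ = 0 := by nlinarith [norm_nonneg (x - y)]
  exact sub_eq_zero.1 (norm_eq_zero.1 this)

end IsHyperbolicBall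

/-- A point whose orbit tends to `p` backwards is moved into the local unstable set by the
flow. -/
theorem NetworkFlow.exists_backwardIn (F : NetworkFlow f Y) {p x : Phase n} {ρ : ℝ} (hρ : 0 < ρ)
    (hx : Tendsto (fun t => F.φ t x) atBot (𝓝 p)) :
    ∃ T ≤ 0, ∀ t ≤ T, F.BackwardIn p ρ (F.φ t x) := by
  obtain ⟨T, hT⟩ := eventually_atBot.1 (hx.eventually (Metric.closedBall_mem_nhds p hρ))
  refine ⟨min T 0, min_le_right _ _, fun t ht s hs => ?_⟩
  rw [← F.map_add]
  exact hT _ (by linarith [min_le_left T 0])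

end LocalAnalysis

/-! ### Local unstable sets and sinks -/

section LocalUnstable

variable {n : ℕ} {f : Phase n → Phase n} {Y : Set (Phase n)}

/-- The first time at which a continuous function reaches a level. -/
theorem exists_first_eq {u : ℝ → ℝ} (hu : Continuous u) {a b c : ℝ} (hab : a ≤ b) (ha : u a < c)
    (hb : c ≤ u b) : ∃ t ∈ Ioc a b, u t = c ∧ ∀ s ∈ Ico a t, u s < c := by
  have hcomp : IsCompact (Icc a b ∩ {s | c ≤ u s}) :=
    isCompact_Icc.inter_right (isClosed_le continuous_const hu)
  obtain ⟨t, ⟨ht, htc⟩, hmin⟩ := hcomp.exists_isLeast ⟨b, ⟨hab, le_rfl⟩, hb⟩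
  have hlt : ∀ s ∈ Ico a t, u s < c := fun s hs => by
    by_contra hcon
    exact absurd (hmin ⟨⟨hs.1, hs.2.le.trans ht.2⟩, not_lt.1 hcon⟩) (not_le.2 hs.2)
  have hat : a < t := lt_of_le_of_ne ht.1 fun h => by
    rw [← h] at htc; exact absurd htc (not_le.2 ha)
  refine ⟨t, ⟨hat, ht.2⟩, le_antisymm ?_ htc, hlt⟩
  obtain ⟨s, hs, hsc⟩ := intermediate_value_Icc ht.1 hu.continuousOn ⟨ha.le, htc⟩
  rcases hs.2.lt_or_eq with h | h
  · exact absurd hsc (hlt s ⟨hs.1, h⟩).ne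
  · rw [← h, hsc]

namespace NetworkFlow

variable (F : NetworkFlow f Y)

theorem continuous_uncurry : Continuous fun z : ℝ × Phase n => F.φ z.1 z.2 :=
  continuous_prod_of_continuous_lipschitzWith _ F.M (fun t => F.continuous_map t) F.lipschitz

theorem continuous_coord (x : Phase n) (l : Fin n) : Continuous fun t => F.φ t x l :=
  (EuclideanSpace.proj (𝕜 := ℝ) l).continuous.comp (F.continuous_time x)

theorem coord_pos {x : Phase n} {l : Fin n} (h : 0 < x l) (t : ℝ) : 0 < F.φ t x l := by
  by_contra hcon
  have h0 : (0 : ℝ) ∈ uIcc (F.φ 0 x l) (F.φ t x l) := by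
    rw [F.map_zero, mem_uIcc]; exact Or.inr ⟨not_lt.1 hcon, h.le⟩
  obtain ⟨s, -, hs⟩ := intermediate_value_uIcc (F.continuous_coord x l).continuousOn h0
  exact h.ne' ((F.coord_eq_zero_iff s x l).1 hs)

end NetworkFlow

namespace IsHyperbolicBall

variable {F : NetworkFlow f Y} {p : Phase n} {ρ μ : ℝ}

/-- In a coordinate subspace of stable directions the distance to `p` does not increase. -/
theorem dist_map_le (h : IsHyperbolicBall F p ρ μ) (hp : ∀ t, F.φ t p = p)
    {I : Finset (Fin n)} (hI : ∀ l ∈ I, l ∉ unstableIdx f p) (hpI : p ∈ coordSubspace I)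
    {x : Phase n} (hxI : x ∈ coordSubspace I) (hx : dist x p < ρ) {t : ℝ} (ht : 0 ≤ t) :
    dist (F.φ t x) p ≤ dist x p := by
  -- With no unstable part the cone form is minus the squared distance to `p`, so its growth means
  -- that the distance does not increase.
  have hU : ∀ s, ∀ l ∈ unstableIdx f p, (F.φ s x - F.φ s p) l = 0 := by
    intro s l hl
    have hl' : l ∉ I := fun h' => hI l h' hl
    have h1 := (F.mem_coordSubspace_iff s x I).2 hxI l hl'
    have h2 := hpI l hl'
    rw [PiLp.sub_apply, hp, h1, h2, sub_zero]
  have anti : ∀ T, 0 ≤ T → (∀ s ∈ Icc 0 T, F.φ s x ∈ Metric.closedBall p ρ) →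
      dist (F.φ T x) p ≤ dist x p := by
    intro T hT hball
    have hder : ∀ s, ∃ d, s ∈ Icc 0 T → HasDerivAt
        (fun s => 2 * sqSum (unstableIdx f p) (F.φ s x - F.φ s p) - ‖F.φ s x - F.φ s p‖ ^ 2) d s ∧
        0 ≤ d := by
      intro s
      by_cases hs : s ∈ Icc 0 T
      · obtain ⟨d, hd, hd'⟩ := h.hasDerivAt_cone (hball s hs) (y := p)
          (by rw [hp]; exact Metric.mem_closedBall_self h.radius_pos.le)
        have := h.rate_pos
        exact ⟨d, fun _ => ⟨hd, le_trans (by positivity) hd'⟩⟩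
      · exact ⟨0, fun h' => absurd h' hs⟩
    choose d hd using hder
    have hm := monotoneOn_of_hasDerivAt_nonneg (convex_Icc 0 T) (fun s hs => (hd s hs).1)
      (fun s hs => (hd s hs).2) (left_mem_Icc.2 hT) (right_mem_Icc.2 hT) hT
    have h0 : ∀ s, sqSum (unstableIdx f p) (F.φ s x - F.φ s p) = 0 := fun s =>
      Finset.sum_eq_zero fun l hl => by rw [hU s l hl]; simp
    simp only [h0] at hm
    simp only [F.map_zero, hp] at hm
    rw [dist_eq_norm, dist_eq_norm]
    exact le_of_sq_le_sq (by linarith) (norm_nonneg _)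
  -- The orbit cannot leave the ball: up to the first time at distance `ρ` the estimate applies and
  -- keeps the distance below `ρ`.
  refine anti t ht ?_
  by_contra hcon
  push Not at hcon
  obtain ⟨s, hs, hsb⟩ := hcon
  have hc : Continuous fun s => dist (F.φ s x) p := (F.continuous_time x).dist continuous_const
  obtain ⟨τ, hτ, hτe, hτl⟩ := exists_first_eq hc hs.1 (by simpa [F.map_zero] using hx)
    (not_le.1 hsb).le
  have := anti τ hτ.1.le fun r hr => by
    rcases hr.2.lt_or_eq with h' | h'
    · exact (hτl r ⟨hr.1, h'⟩).le
    · rw [h']; exact hτe.le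
  linarith

/-- Stable coordinates off the axis of `p` vanish on the local unstable set. -/
theorem coord_eq_zero_of_backwardIn (h : IsHyperbolicBall F p ρ μ) {l : Fin n} (hpl : p l = 0)
    (hl : l ∉ unstableIdx f p) {x : Phase n} (hx : F.BackwardIn p ρ x) : x l = 0 := by
  -- The flip fixes `p`, so the flipped point also has its backward orbit in the ball; since it has
  -- the same unstable coordinates, it coincides with `x`.
  have hy : F.BackwardIn p ρ (signAct (flipSign l) x) := by
    intro t ht
    have h1 : signAct (flipSign l) (F.φ t x) - p = signLinear (flipSign l) (F.φ t x - p) := by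
      rw [map_sub, signLinear_apply, signLinear_apply, signAct_flipSign_eq_self_iff.2 hpl]
    rw [F.symm, Metric.mem_closedBall, dist_eq_norm, h1, signLinear_apply, norm_signAct,
      ← dist_eq_norm]
    exact hx t ht
  rw [← signAct_flipSign_eq_self_iff]
  refine h.eq_of_backwardIn hy hx fun m hm => signAct_flipSign_of_ne ?_ x
  rintro rfl
  exact hl hm

theorem coord_eq_zero_of_tendsto (h : IsHyperbolicBall F p ρ μ) {l : Fin n} (hpl : p l = 0)
    (hl : l ∉ unstableIdx f p) {x : Phase n} (hx : Tendsto (fun t => F.φ t x) atBot (𝓝 p)) :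
    x l = 0 := by
  obtain ⟨T, -, hT⟩ := F.exists_backwardIn h.radius_pos hx
  exact (F.coord_eq_zero_iff T x l).1 (h.coord_eq_zero_of_backwardIn hpl hl (hT T le_rfl))

/-- A point of the unstable set other than `p` has a nonzero unstable coordinate. -/
theorem eq_of_tendsto (h : IsHyperbolicBall F p ρ μ) (hp : ∀ t, F.φ t p = p)
    (hpU : ∀ l ∈ unstableIdx f p, p l = 0) {x : Phase n}
    (hx : Tendsto (fun t => F.φ t x) atBot (𝓝 p)) (hxU : ∀ l ∈ unstableIdx f p, x l = 0) :
    x = p := by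
  obtain ⟨T, -, hT⟩ := F.exists_backwardIn h.radius_pos hx
  have := h.eq_of_backwardIn (hT T le_rfl) (h.backwardIn_self hp) fun l hl => by
    rw [hpU l hl]; exact (F.coord_eq_zero_iff T x l).2 (hxU l hl)
  rw [← F.map_neg_map T x, this, hp]

/-- Points of the unstable set with a single, positive unstable coordinate lie on one
trajectory. -/
theorem exists_map_eq (h : IsHyperbolicBall F p ρ μ) {k : Fin n}
    (hpk : p k = 0) {x y : Phase n}
    (hx : Tendsto (fun t => F.φ t x) atBot (𝓝 p)) (hy : Tendsto (fun t => F.φ t y) atBot (𝓝 p))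
    (hxU : ∀ l ∈ unstableIdx f p, l ≠ k → x l = 0) (hyU : ∀ l ∈ unstableIdx f p, l ≠ k → y l = 0)
    (hxk : 0 < x k) (hyk : 0 < y k) : ∃ t, F.φ t x = y := by
  -- The point with the larger `k`-th coordinate is moved backwards until that coordinate equals the
  -- other one; uniqueness over the unstable coordinates then identifies the points.
  have loc : ∀ x y : Phase n, F.BackwardIn p ρ x → F.BackwardIn p ρ y →
      Tendsto (fun t => F.φ t x) atBot (𝓝 p) →
      (∀ l ∈ unstableIdx f p, l ≠ k → x l = 0) → (∀ l ∈ unstableIdx f p, l ≠ k → y l = 0) →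
      0 < y k → y k ≤ x k → ∃ t, F.φ t x = y := by
    intro x y hx hy hxt hxU hyU hyk hle
    have hlim : Tendsto (fun t => F.φ t x k) atBot (𝓝 0) := by
      rw [← hpk]
      exact ((EuclideanSpace.proj (𝕜 := ℝ) k).continuous.tendsto p).comp hxt
    obtain ⟨T, hT0, hT⟩ := ((eventually_le_atBot 0).and (hlim.eventually (gt_mem_nhds hyk))).exists
    obtain ⟨t, ht, hte⟩ := intermediate_value_Icc hT0 (F.continuous_coord x k).continuousOn
      ⟨hT.le, by rwa [F.map_zero]⟩
    refine ⟨t, h.eq_of_backwardIn (hx.map ht.2) hy fun l hl => ?_⟩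
    by_cases hlk : l = k
    · rw [hlk]; exact hte
    · rw [(F.coord_eq_zero_iff t x l).2 (hxU l hl hlk), hyU l hl hlk]
  obtain ⟨T₁, -, hT₁⟩ := F.exists_backwardIn h.radius_pos hx
  obtain ⟨T₂, -, hT₂⟩ := F.exists_backwardIn h.radius_pos hy
  have hx1 := hT₁ T₁ le_rfl
  have hy1 := hT₂ T₂ le_rfl
  have hxU' : ∀ l ∈ unstableIdx f p, l ≠ k → F.φ T₁ x l = 0 :=
    fun l hl hlk => (F.coord_eq_zero_iff _ _ _).2 (hxU l hl hlk)
  have hyU' : ∀ l ∈ unstableIdx f p, l ≠ k → F.φ T₂ y l = 0 :=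
    fun l hl hlk => (F.coord_eq_zero_iff _ _ _).2 (hyU l hl hlk)
  rcases le_total (F.φ T₂ y k) (F.φ T₁ x k) with hle | hle
  · obtain ⟨t, ht⟩ := loc _ _ hx1 hy1 (F.tendsto_atBot_map hx T₁) hxU' hyU' (F.coord_pos hyk _) hle
    refine ⟨-T₂ + (t + T₁), ?_⟩
    rw [F.map_add, F.map_add, ht, F.map_neg_map]
  · obtain ⟨t, ht⟩ := loc _ _ hy1 hx1 (F.tendsto_atBot_map hy T₂) hyU' hxU' (F.coord_pos hxk _) hle
    refine ⟨-T₂ + (-t + T₁), ?_⟩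
    rw [F.map_add, F.map_add, ← ht, F.map_neg_map, F.map_neg_map]

/-- Over each small vector of unstable directions there is a point whose backward orbit stays
near `p`, displaced along the axis of `p`. -/
theorem exists_backwardIn_over (h : IsHyperbolicBall F p ρ μ) (hp : ∀ t, F.φ t p = p)
    (hfp : f p = 0) {i : Fin n} (hpi : p ∈ coordAxis i) (hi : i ∉ unstableIdx f p) {w : Phase n}
    (hw : w ∈ coordSubspace (unstableIdx f p)) (hwn : ‖w‖ ≤ ρ / 4) :
    ∃ s : ℝ, F.BackwardIn p ρ (p + EuclideanSpace.single i s + w) := by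
  set U := unstableIdx f p with hU
  have hρ := h.radius_pos
  set X : ℝ → Phase n := fun s => p + EuclideanSpace.single i s + w with hX
  have hXc : Continuous X := by
    have : Continuous fun s : ℝ => (EuclideanSpace.single i s : Phase n) := by
      have he : (fun s : ℝ => (EuclideanSpace.single i s : Phase n)) =
          fun s => s • EuclideanSpace.single i (1 : ℝ) := by
        ext s k; by_cases hk : k = i <;> simp [hk]
      rw [he]; fun_prop
    exact (continuous_const.add this).add continuous_const
  have hXI : ∀ s, X s ∈ coordSubspace (insert i U) := by
    intro s l hl
    rw [Finset.mem_insert, not_or] at hl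
    simp [hX, hpi l hl.1, hw l hl.2, hl.1]
  -- The orbit stays in the span of axis `i` and the unstable directions, so its stable part is one
  -- real number. This is why shooting with one parameter suffices.
  have hnorm : ∀ s t, ‖F.φ t (X s) - p‖ ^ 2 =
      sqSum U (F.φ t (X s) - p) + (F.φ t (X s) - p) i ^ 2 := by
    intro s t
    rw [← sqSum_univ, add_comm]
    unfold sqSum
    rw [← Finset.sum_insert (f := fun l => (F.φ t (X s) - p) l ^ 2) hi]
    refine (Finset.sum_subset (Finset.subset_univ _) fun l _ hl => ?_).symm
    have h1 := (F.mem_coordSubspace_iff t (X s) _).2 (hXI s) l hl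
    have h2 := hpi l fun h' => hl (by simp [h'])
    rw [PiLp.sub_apply, h1, h2]; simp
  have hsqw : ∀ s, sqSum U (X s - p) = ‖w‖ ^ 2 := by
    intro s
    rw [← sqSum_univ]
    have h1 : sqSum U (X s - p) = sqSum U w := by
      refine Finset.sum_congr rfl fun l hl => ?_
      have : l ≠ i := fun h' => hi (h' ▸ hl)
      simp [hX, this]
    rw [h1]
    exact Finset.sum_subset (Finset.subset_univ _) fun l _ hl => by rw [hw l hl]; simp
  have hXi : ∀ s, (X s - p) i = s := by
    intro s
    simp [hX, hw i hi]
  by_contra hcon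
  push Not at hcon
  -- `A σ` collects the displacements whose backward orbit leaves the unstable cone on the side `σ`
  -- before leaving the ball. If no displacement worked, `A 1` and `A (-1)` would be a separation of
  -- an interval.
  set A : ℝ → Set ℝ := fun σ => {s | ∃ t ≤ 0, (∀ r ∈ Icc t 0, F.φ r (X s) ∈ Metric.ball p ρ) ∧
    2 * sqSum U (F.φ t (X s) - p) < ‖F.φ t (X s) - p‖ ^ 2 ∧ 0 < σ * (F.φ t (X s) - p) i} with hA
  have hAopen : ∀ σ, IsOpen (A σ) := by
    intro σ
    rw [isOpen_iff_mem_nhds]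
    rintro s ⟨t, ht, hball, hlt, hsgn⟩
    have hcs : Continuous fun s => F.φ t (X s) - p := ((F.continuous_map t).comp hXc).sub continuous_const
    have e1 : ∀ᶠ s' in 𝓝 s, ∀ r ∈ Icc t 0, F.φ r (X s') ∈ Metric.ball p ρ := by
      refine isCompact_Icc.eventually_forall_of_forall_eventually fun r hr => ?_
      have hc : Continuous fun z : ℝ × ℝ => F.φ z.2 (X z.1) :=
        F.continuous_uncurry.comp (continuous_snd.prodMk (hXc.comp continuous_fst))
      exact hc.continuousAt.eventually (Metric.isOpen_ball.mem_nhds (hball r hr))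
    have e2 : ∀ᶠ s' in 𝓝 s, 2 * sqSum U (F.φ t (X s') - p) < ‖F.φ t (X s') - p‖ ^ 2 :=
      (isOpen_lt (((continuous_sqSum U).comp hcs).const_mul 2) (hcs.norm.pow 2)).mem_nhds hlt
    have e3 : ∀ᶠ s' in 𝓝 s, 0 < σ * (F.φ t (X s') - p) i :=
      (isOpen_lt continuous_const (((EuclideanSpace.proj (𝕜 := ℝ) i).continuous.comp
        hcs).const_mul σ)).mem_nhds hsgn
    filter_upwards [e1, e2, e3] with s' h1 h2 h3 using ⟨t, ht, h1, h2, h3⟩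
  -- Backwards in time an orbit outside the cone stays outside; its `i`-th displacement cannot
  -- vanish there and so keeps its sign.
  have hkeep : ∀ s σ t₁ t₂, t₂ ≤ t₁ → t₁ ≤ 0 → (∀ r ∈ Icc t₂ 0, F.φ r (X s) ∈ Metric.ball p ρ) →
      2 * sqSum U (F.φ t₁ (X s) - p) < ‖F.φ t₁ (X s) - p‖ ^ 2 →
      0 < σ * (F.φ t₁ (X s) - p) i → 0 < σ * (F.φ t₂ (X s) - p) i := by
    intro s σ t₁ t₂ h21 h10 hball hlt hpos
    have hder : ∀ t, ∃ d, t ∈ Icc t₂ t₁ → HasDerivAt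
        (fun r => 2 * sqSum U (F.φ r (X s) - F.φ r p) - ‖F.φ r (X s) - F.φ r p‖ ^ 2) d t ∧
        0 ≤ d := by
      intro t
      by_cases ht : t ∈ Icc t₂ t₁
      · obtain ⟨d, hd, hd'⟩ := h.hasDerivAt_cone
          (Metric.ball_subset_closedBall (hball t ⟨ht.1, ht.2.trans h10⟩)) (y := p)
          (by rw [hp]; exact Metric.mem_closedBall_self hρ.le)
        have := h.rate_pos
        exact ⟨d, fun _ => ⟨hd, le_trans (by positivity) hd'⟩⟩
      · exact ⟨0, fun h' => absurd h' ht⟩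
    choose d hd using hder
    have hm := monotoneOn_of_hasDerivAt_nonneg (convex_Icc t₂ t₁) (fun t ht => (hd t ht).1)
      fun t ht => (hd t ht).2
    by_contra hneg
    have hc : Continuous fun t => σ * (F.φ t (X s) - p) i :=
      ((EuclideanSpace.proj (𝕜 := ℝ) i).continuous.comp
        ((F.continuous_time (X s)).sub continuous_const)).const_mul σ
    obtain ⟨t, ht, h0⟩ := intermediate_value_Icc h21 hc.continuousOn ⟨not_lt.1 hneg, hpos.le⟩
    have hσ : σ ≠ 0 := by rintro rfl; simp at hpos
    have hi0 : (F.φ t (X s) - p) i = 0 := (mul_eq_zero.1 h0).resolve_left hσ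
    have h1 := hm ht (right_mem_Icc.2 h21) ht.2
    simp only [hp] at h1
    have h2 := hnorm s t
    rw [hi0] at h2
    have h3 := sqSum_nonneg U (F.φ t (X s) - p)
    nlinarith
  have hdisj : ∀ s, s ∈ A 1 → s ∈ A (-1) → False := by
    rintro s ⟨t₁, ht₁, hb₁, hl₁, hp₁⟩ ⟨t₂, ht₂, hb₂, hl₂, hp₂⟩
    rcases le_total t₂ t₁ with hle | hle
    · linarith [hkeep s 1 t₁ t₂ hle ht₁ hb₂ hl₁ hp₁]
    · linarith [hkeep s (-1) t₂ t₁ hle ht₂ hb₁ hl₂ hp₂]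
  have hin : ∀ s, |s| ≤ ρ / 2 → dist (X s) p < ρ := by
    intro s hs
    have h1 : X s - p = EuclideanSpace.single i s + w := by simp only [hX]; abel
    rw [dist_eq_norm, h1]
    refine (norm_add_le _ _).trans_lt ?_
    rw [PiLp.norm_single, Real.norm_eq_abs]
    linarith
  -- At displacement `±ρ/2` the point lies outside the cone already at time `0`, because `‖w‖ ≤ ρ /
  -- 4`.
  have hend : ∀ σ : ℝ, σ * σ = 1 → |σ * (ρ / 2)| ≤ ρ / 2 → σ * (ρ / 2) ∈ A σ := by
    intro σ hσ hs
    refine ⟨0, le_rfl, fun r hr => ?_, ?_, ?_⟩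
    · rw [le_antisymm hr.2 hr.1, F.map_zero]; exact hin _ hs
    · rw [hnorm]
      simp only [F.map_zero, hsqw, hXi]
      have h1 : (σ * (ρ / 2)) ^ 2 = ρ ^ 2 / 4 := by
        linear_combination (ρ ^ 2 / 4) * hσ
      nlinarith [norm_nonneg w]
    · simp only [F.map_zero, hXi]
      nlinarith
  have hcover : Icc (-(ρ / 2)) (ρ / 2) ⊆ A 1 ∪ A (-1) := by
    intro s hs
    by_contra hnot
    rw [mem_union, not_or] at hnot
    have hs' : |s| ≤ ρ / 2 := abs_le.2 hs
    have hcone : ∀ t ≤ 0, (∀ r ∈ Icc t 0, F.φ r (X s) ∈ Metric.ball p ρ) →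
        ‖F.φ t (X s) - p‖ ^ 2 ≤ 2 * sqSum U (F.φ t (X s) - p) := by
      intro t ht hb
      by_contra hlt
      rw [not_le] at hlt
      rcases lt_trichotomy ((F.φ t (X s) - p) i) 0 with hneg | h0 | hpos
      · exact hnot.2 ⟨t, ht, hb, hlt, by linarith⟩
      · have h2 := hnorm s t
        rw [h0] at h2
        nlinarith [sqSum_nonneg U (F.φ t (X s) - p)]
      · exact hnot.1 ⟨t, ht, hb, hlt, by linarith⟩
    have hex := hcon s
    unfold NetworkFlow.BackwardIn at hex
    push Not at hex
    obtain ⟨b, hb0, hb⟩ := hex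
    have hc : Continuous fun τ => dist (F.φ (-τ) (X s)) p :=
      ((F.continuous_time (X s)).comp continuous_neg).dist continuous_const
    obtain ⟨τ, hτ, hτe, hτl⟩ := exists_first_eq hc (a := 0) (b := -b) (c := ρ) (by linarith)
      (by simpa [F.map_zero] using hin s hs')
      (by rw [neg_neg]; exact (not_le.1 hb).le)
    have hopen : ∀ t ∈ Ioc (-τ) 0, F.φ t (X s) ∈ Metric.ball p ρ := by
      intro t ht
      have := hτl (-t) ⟨by linarith [ht.2], by linarith [ht.1]⟩
      simpa using this
    have hc1 : ∀ t ∈ Ioc (-τ) 0,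
        ‖F.φ t (X s) - p‖ ^ 2 ≤ 2 * sqSum U (F.φ t (X s) - p) :=
      fun t ht => hcone t ht.2 fun r hr => hopen r ⟨lt_of_lt_of_le ht.1 hr.1, hr.2⟩
    have hcτ : ‖F.φ (-τ) (X s) - p‖ ^ 2 ≤ 2 * sqSum U (F.φ (-τ) (X s) - p) := by
      have hct : Continuous fun t => F.φ t (X s) - p := (F.continuous_time _).sub continuous_const
      have hcl : IsClosed {t | ‖F.φ t (X s) - p‖ ^ 2 ≤ 2 * sqSum U (F.φ t (X s) - p)} :=
        isClosed_le (hct.norm.pow 2) (((continuous_sqSum U).comp hct).const_mul 2)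
      have hsub := hcl.closure_subset_iff.2 hc1
      rw [closure_Ioc (by linarith [hτ.1])] at hsub
      exact hsub (left_mem_Icc.2 (by linarith [hτ.1]))
    have hall : ∀ t ∈ Icc (-τ) 0, F.φ t (X s) ∈ Metric.closedBall p ρ ∧
        ‖F.φ t (X s) - p‖ ^ 2 ≤ 2 * sqSum U (F.φ t (X s) - p) := by
      intro t ht
      rcases ht.1.lt_or_eq with h' | h'
      · exact ⟨Metric.ball_subset_closedBall (hopen t ⟨h', ht.2⟩), hc1 t ⟨h', ht.2⟩⟩
      · rw [← h']; exact ⟨hτe.le, hcτ⟩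
    -- An orbit that reached the sphere while inside the cone would satisfy `ρ ^ 2 ≤ 2 * ‖w‖ ^ 2 ≤ ρ
    -- ^ 2 / 8`, since the unstable part decays backwards.
    have hdec := h.sqSum_map_le hp hfp (by linarith [hτ.1]) hall
    rw [← hU, hsqw] at hdec
    have hexp : Real.exp (μ * -τ) ≤ 1 := Real.exp_le_one_iff.2 (by nlinarith [h.rate_pos, hτ.1])
    have hw2 : ‖w‖ ^ 2 ≤ (ρ / 4) ^ 2 := pow_le_pow_left₀ (norm_nonneg _) hwn 2
    have hτe' : ‖F.φ (-τ) (X s) - p‖ = ρ := by rw [← dist_eq_norm]; exact hτe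
    rw [hτe'] at hcτ
    nlinarith [sq_nonneg ‖w‖]
  have habs : |ρ / 2| = ρ / 2 := abs_of_pos (by positivity)
  obtain ⟨s, -, h1, h2⟩ := isPreconnected_Icc (A 1) (A (-1)) (hAopen 1) (hAopen (-1)) hcover
    ⟨1 * (ρ / 2), ⟨by linarith, by linarith⟩, hend 1 (by norm_num) (by rw [one_mul, habs])⟩
    ⟨-1 * (ρ / 2), ⟨by linarith, by linarith⟩,
      hend (-1) (by norm_num) (by rw [neg_one_mul, abs_neg, habs])⟩
  exact hdisj s h1 h2

end IsHyperbolicBall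

end LocalUnstable

/-! ### Equilibria and connections of an ac-network -/

namespace IsACNetwork

variable {n : ℕ} {f : Phase n → Phase n} {Y : Set (Phase n)}

theorem contDiff_one (hY : IsACNetwork f Y) : ContDiff ℝ 1 f := hY.smooth.of_le (by simp)

theorem isCompact (hY : IsACNetwork f Y) : IsCompact Y := hY.clean.1

theorem exists_flow (hY : IsACNetwork f Y) : Nonempty (NetworkFlow f Y) :=
  exists_networkFlow hY.contDiff_one hY.equivariant hY.isCompact.isBounded hY.clean.2.1

theorem unstableSet_subset (hY : IsACNetwork f Y) {p : Phase n} (hp : p ∈ equilibriaIn f Y) :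
    unstableSet f {p} ⊆ Y := by
  refine hY.clean.2.2 {p} (singleton_subset_iff.2 hp.1) ?_
  rintro x rfl
  exact ⟨fun _ => x, fun t _ => by simpa [hp.2] using hasDerivWithinAt_const t univ x, rfl,
    fun _ => rfl⟩

theorem map_equilibrium (hY : IsACNetwork f Y) (F : NetworkFlow f Y) {p : Phase n}
    (hp : p ∈ equilibriaIn f Y) (t : ℝ) : F.φ t p = p :=
  F.map_equilibrium hY.contDiff_one hp t

theorem node_mem {N : ℕ} {X : Fin N → HeteroclinicCycle f} (hX : Y = ⋃ i, (X i).carrier)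
    (c : Fin N) (j : Fin (X c).length) : (X c).node j ∈ equilibriaIn f Y :=
  ⟨by rw [hX]; exact mem_iUnion.2 ⟨c, Or.inl ⟨j, rfl⟩⟩, ((X c).hyperbolic j).1⟩

/-- A point of the network that is not an equilibrium lies on a saddle-sink connection. -/
theorem exists_connection (hY : IsACNetwork f Y) {x : Phase n} (hx : x ∈ Y) (hfx : f x ≠ 0) :
    ∃ a ∈ equilibriaIn f Y, ∃ b ∈ equilibriaIn f Y, a ≠ b ∧ x ∈ connection f a b ∧
      ∃ P : Submodule ℝ (Phase n), connection f a b ⊆ P ∧ a ∈ P ∧ IsSinkIn f P b := by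
  obtain ⟨-, N, X, hrob, hX⟩ := hY.network
  rw [hX] at hx
  obtain ⟨c, hc⟩ := mem_iUnion.1 hx
  rcases hc with ⟨j, rfl⟩ | hc
  · exact absurd ((X c).hyperbolic j).1 hfx
  · obtain ⟨j, hj⟩ := mem_iUnion.1 hc
    obtain ⟨P, -, hP, hs, hsink⟩ := hrob c j
    exact ⟨_, node_mem hX c j, _, node_mem hX c (j + 1), (X c).heteroclinic j, hj, P, hP, hs.1,
      hsink⟩

/-- Every equilibrium of the network is a sink of some invariant subspace. -/
theorem exists_isSinkIn (hY : IsACNetwork f Y) (F : NetworkFlow f Y) {p : Phase n}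
    (hp : p ∈ equilibriaIn f Y) : ∃ P : Submodule ℝ (Phase n), IsSinkIn f P p := by
  obtain ⟨-, N, X, hrob, hX⟩ := hY.network
  have hpY := hp.1
  rw [hX] at hpY
  obtain ⟨c, hc⟩ := mem_iUnion.1 hpY
  rcases hc with ⟨j, rfl⟩ | hc
  -- The node is the end point of the preceding connection of its cycle.
  · obtain ⟨P, -, -, -, hsink⟩ := hrob c (j - 1)
    rw [sub_add_cancel] at hsink
    exact ⟨P, hsink⟩
  -- An equilibrium inside a connection would equal both of its end points, which are distinct.
  · obtain ⟨j, hj⟩ := mem_iUnion.1 hc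
    obtain ⟨h1, h2⟩ := (F.mem_connection_iff hY.contDiff_one hY.isCompact hY.subset_orthant
      hp.1).1 hj
    simp only [hY.map_equilibrium F hp] at h1 h2
    exact absurd ((tendsto_nhds_unique h1 tendsto_const_nhds).trans
      (tendsto_nhds_unique h2 tendsto_const_nhds).symm) ((X c).heteroclinic j)

/-- The origin lies on every axis, so it would be the only equilibrium of `Y`; a cycle needs two
different consecutive nodes. -/
theorem equilibrium_ne_zero (hY : IsACNetwork f Y) {p : Phase n} (hp : p ∈ equilibriaIn f Y) :
    p ≠ 0 := by
  rintro rfl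
  have hall : ∀ q ∈ equilibriaIn f Y, q = 0 := fun q hq => by
    obtain ⟨i, hi⟩ := hY.axial q hq
    exact hY.one_per_axis i ⟨hq, hi⟩ ⟨hp, fun k _ => rfl⟩
  obtain ⟨-, N, X, -, hX⟩ := hY.network
  have hpY := hp.1
  rw [hX] at hpY
  obtain ⟨c, -⟩ := mem_iUnion.1 hpY
  exact (X c).heteroclinic 0 ((hall _ (node_mem hX c 0)).trans (hall _ (node_mem hX c _)).symm)

theorem exists_axis (hY : IsACNetwork f Y) {p : Phase n}
    (hp : p ∈ equilibriaIn f Y) : ∃ i, p ∈ coordAxis i ∧ 0 < p i := by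
  obtain ⟨i, hi⟩ := hY.axial p hp
  refine ⟨i, hi, lt_of_le_of_ne (hY.subset_orthant hp.1 i) fun h0 => ?_⟩
  refine hY.equilibrium_ne_zero hp ?_
  ext k
  by_cases hk : k = i
  · rw [hk, ← h0]; rfl
  · exact hi k hk

theorem _root_.single_mem_of_mem_coordAxis {i : Fin n} {p : Phase n} (hi : p ∈ coordAxis i)
    (hpi : 0 < p i) {P : Submodule ℝ (Phase n)} (hp : p ∈ P) :
    EuclideanSpace.single i (1 : ℝ) ∈ P := by
  have : EuclideanSpace.single i (1 : ℝ) = (p i)⁻¹ • p := by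
    ext k
    by_cases hk : k = i
    · subst hk; simp [hpi.ne']
    · simp [hk, hi k hk]
  rw [this]
  exact P.smul_mem _ hp

/-- The axial direction is contracting. -/
theorem rate_axis_neg (hY : IsACNetwork f Y) (F : NetworkFlow f Y) {p : Phase n}
    (hp : p ∈ equilibriaIn f Y) {i : Fin n} (hi : p ∈ coordAxis i) (hpi : 0 < p i) :
    rate f p i < 0 := by
  obtain ⟨P, hP⟩ := hY.exists_isSinkIn F hp
  exact rate_neg_of_isSinkIn hY.contDiff_one hY.equivariant hi hP
    (single_mem_of_mem_coordAxis hi hpi hP.1)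

theorem coord_eq_zero_of_mem_unstableIdx (hY : IsACNetwork f Y) (F : NetworkFlow f Y)
    {p : Phase n} (hp : p ∈ equilibriaIn f Y) {l : Fin n} (hl : l ∈ unstableIdx f p) :
    p l = 0 := by
  obtain ⟨i, hi, hpi⟩ := hY.exists_axis hp
  refine hi l ?_
  rintro rfl
  exact absurd (mem_unstableIdx.1 hl) (hY.rate_axis_neg F hp hi hpi).not_gt

theorem exists_ball (hY : IsACNetwork f Y) (F : NetworkFlow f Y) {p : Phase n}
    (hp : p ∈ equilibriaIn f Y) : ∃ ρ μ, IsHyperbolicBall F p ρ μ := by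
  obtain ⟨i, hi, -⟩ := hY.exists_axis hp
  exact exists_isHyperbolicBall F hY.contDiff_one hY.equivariant hp hi (hY.hyperbolic p hp)

/-- A hyperbolic ball contains no other equilibrium. -/
theorem _root_.IsHyperbolicBall.eq_of_equilibrium {F : NetworkFlow f Y} {p q : Phase n} {ρ μ : ℝ}
    (h : IsHyperbolicBall F p ρ μ) (hp : f p = 0) (hq : f q = 0)
    (hqb : q ∈ Metric.closedBall p ρ) : q = p := by
  have h1 := h.cone q hqb p (Metric.mem_closedBall_self h.radius_pos.le)
  simp only [hp, hq, sub_zero, PiLp.zero_apply, mul_zero, Finset.sum_const_zero] at h1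
  have h2 : ‖q - p‖ ^ 2 ≤ 0 := nonpos_of_mul_nonpos_right h1 h.rate_pos
  have h3 : ‖q - p‖ = 0 := by nlinarith [norm_nonneg (q - p)]
  exact sub_eq_zero.1 (norm_eq_zero.1 h3)

theorem eq_of_mem_coordAxis (hY : IsACNetwork f Y) {p q : Phase n} (hp : p ∈ equilibriaIn f Y)
    (hq : q ∈ equilibriaIn f Y) {i : Fin n} (hpi : p ∈ coordAxis i) (hqi : q ∈ coordAxis i) :
    p = q := hY.one_per_axis i ⟨hp, hpi⟩ ⟨hq, hqi⟩

theorem mem_connection_iff (hY : IsACNetwork f Y) (F : NetworkFlow f Y) {x a b : Phase n}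
    (hx : x ∈ Y) : x ∈ connection f a b ↔ Tendsto (fun t => F.φ t x) atBot (𝓝 a) ∧
      Tendsto (fun t => F.φ t x) atTop (𝓝 b) :=
  F.mem_connection_iff hY.contDiff_one hY.isCompact hY.subset_orthant hx

/-- Every point of the network has limits in both directions of time; they are distinct
equilibria unless the point is an equilibrium itself. -/
theorem exists_limits (hY : IsACNetwork f Y) (F : NetworkFlow f Y) {x : Phase n} (hx : x ∈ Y)
    (hfx : f x ≠ 0) : ∃ a ∈ equilibriaIn f Y, ∃ b ∈ equilibriaIn f Y, a ≠ b ∧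
      Tendsto (fun t => F.φ t x) atBot (𝓝 a) ∧ Tendsto (fun t => F.φ t x) atTop (𝓝 b) ∧
      ∃ P : Submodule ℝ (Phase n), connection f a b ⊆ P ∧ a ∈ P ∧ IsSinkIn f P b := by
  obtain ⟨a, ha, b, hb, hab, hxc, hP⟩ := hY.exists_connection hx hfx
  obtain ⟨h1, h2⟩ := (hY.mem_connection_iff F hx).1 hxc
  exact ⟨a, ha, b, hb, hab, h1, h2, hP⟩

theorem ne_zero_of_tendsto (hY : IsACNetwork f Y) (F : NetworkFlow f Y) {x a : Phase n}
    (hx : x ∈ Y) (ha : Tendsto (fun t => F.φ t x) atBot (𝓝 a)) (hxa : x ≠ a) : f x ≠ 0 := by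
  intro h0
  simp only [hY.map_equilibrium F ⟨hx, h0⟩] at ha
  exact hxa (tendsto_nhds_unique tendsto_const_nhds ha)

/-- The forward limit of a point of an unstable set. -/
theorem exists_forward_limit (hY : IsACNetwork f Y) (F : NetworkFlow f Y) {x a : Phase n}
    (hx : x ∈ Y) (ha : Tendsto (fun t => F.φ t x) atBot (𝓝 a)) (hxa : x ≠ a) :
    ∃ b ∈ equilibriaIn f Y, a ≠ b ∧ Tendsto (fun t => F.φ t x) atTop (𝓝 b) ∧
      ∃ P : Submodule ℝ (Phase n), connection f a b ⊆ P ∧ a ∈ P ∧ IsSinkIn f P b := by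
  obtain ⟨a', -, b, hb, hab, h1, h2, hP⟩ :=
    hY.exists_limits F hx (hY.ne_zero_of_tendsto F hx ha hxa)
  obtain rfl := tendsto_nhds_unique h1 ha
  exact ⟨b, hb, hab, h2, hP⟩

theorem limit_mem_coordSubspace (F : NetworkFlow f Y) {x b : Phase n} {l : Filter ℝ} [l.NeBot]
    (hb : Tendsto (fun t => F.φ t x) l (𝓝 b)) {I : Finset (Fin n)} (hx : x ∈ coordSubspace I) :
    b ∈ coordSubspace I :=
  (isClosed_coordSubspace I).mem_of_tendsto hb
    (Eventually.of_forall fun t => (F.mem_coordSubspace_iff t x I).2 hx)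

/-- If `b` attracts in the coordinate subspace of `I`, then the points of the network in this
subspace near a point of the basin of `b` belong to the basin of `b`. -/
theorem eventually_tendsto_sink (hY : IsACNetwork f Y) (F : NetworkFlow f Y) {b : Phase n}
    (hb : b ∈ equilibriaIn f Y) {I : Finset (Fin n)} (hI : ∀ l ∈ I, l ∉ unstableIdx f b)
    (hbI : b ∈ coordSubspace I) {x : Phase n} (hx : Tendsto (fun t => F.φ t x) atTop (𝓝 b)) :
    ∀ᶠ y in 𝓝 x, y ∈ Y → y ∈ coordSubspace I → Tendsto (fun t => F.φ t y) atTop (𝓝 b) := by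
  obtain ⟨ρ, μ, h⟩ := hY.exists_ball F hb
  have hfix := hY.map_equilibrium F hb
  obtain ⟨T, hT⟩ := (hx.eventually (Metric.ball_mem_nhds b h.radius_pos)).exists
  filter_upwards [(F.continuous_map T).continuousAt.eventually
    (Metric.isOpen_ball.mem_nhds hT)] with y hy hyY hyI
  -- Trapping is enough: orbits in `Y` converge to equilibria, and the ball contains no equilibrium
  -- except `b`.
  have hin : ∀ t ≥ T, F.φ t y ∈ Metric.closedBall b ρ := by
    intro t ht
    have h1 := h.dist_map_le hfix hI hbI ((F.mem_coordSubspace_iff T y I).2 hyI) hy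
      (sub_nonneg.2 ht)
    rw [← F.map_add, sub_add_cancel] at h1
    exact h1.trans (le_of_lt hy)
  by_cases hfy : f y = 0
  · have h0 := hin T le_rfl
    rw [hY.map_equilibrium F ⟨hyY, hfy⟩] at h0
    have := h.eq_of_equilibrium hb.2 hfy h0
    rw [this]
    simp only [hfix]
    exact tendsto_const_nhds
  · obtain ⟨a, -, b', hb', -, -, h2, -⟩ := hY.exists_limits F hyY hfy
    have h3 : b' ∈ Metric.closedBall b ρ := Metric.isClosed_closedBall.mem_of_tendsto h2
      ((eventually_ge_atTop T).mono hin)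
    rwa [h.eq_of_equilibrium hb.2 hb'.2 h3] at h2

/-- In a coordinate subspace in which `b` attracts, only `b` itself tends backwards to `b`. -/
theorem eq_of_tendsto_atBot_sink (hY : IsACNetwork f Y) (F : NetworkFlow f Y) {b : Phase n}
    (hb : b ∈ equilibriaIn f Y) {I : Finset (Fin n)} (hI : ∀ l ∈ I, l ∉ unstableIdx f b)
    {x : Phase n} (hxI : x ∈ coordSubspace I)
    (hx : Tendsto (fun t => F.φ t x) atBot (𝓝 b)) : x = b := by
  obtain ⟨ρ, μ, h⟩ := hY.exists_ball F hb
  exact h.eq_of_tendsto (hY.map_equilibrium F hb)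
    (fun l hl => hY.coord_eq_zero_of_mem_unstableIdx F hb hl) hx
    fun l hl => hxI l fun h' => hI l h' hl

/-- Off its axis and its unstable directions, the coordinates vanish on the unstable set of an
equilibrium. -/
theorem mem_coordSubspace_of_tendsto (hY : IsACNetwork f Y) (F : NetworkFlow f Y) {p : Phase n}
    (hp : p ∈ equilibriaIn f Y) {i : Fin n} (hi : p ∈ coordAxis i) {x : Phase n}
    (hx : Tendsto (fun t => F.φ t x) atBot (𝓝 p)) :
    x ∈ coordSubspace (insert i (unstableIdx f p)) := by
  obtain ⟨ρ, μ, h⟩ := hY.exists_ball F hp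
  intro l hl
  rw [Finset.mem_insert, not_or] at hl
  exact h.coord_eq_zero_of_tendsto (hi l hl.1) hl.2 hx

/-- Points of the network that leave `p` in one and the same unstable direction lie on one
trajectory. -/
theorem exists_map_eq (hY : IsACNetwork f Y) (F : NetworkFlow f Y) {p : Phase n}
    (hp : p ∈ equilibriaIn f Y) {k : Fin n} (hk : k ∈ unstableIdx f p) {x y : Phase n}
    (hxY : x ∈ Y) (hyY : y ∈ Y) (hxp : x ≠ p) (hyp : y ≠ p)
    (hx : Tendsto (fun t => F.φ t x) atBot (𝓝 p)) (hy : Tendsto (fun t => F.φ t y) atBot (𝓝 p))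
    (hxU : ∀ l ∈ unstableIdx f p, l ≠ k → x l = 0)
    (hyU : ∀ l ∈ unstableIdx f p, l ≠ k → y l = 0) : ∃ t, F.φ t x = y := by
  obtain ⟨ρ, μ, h⟩ := hY.exists_ball F hp
  have hz := fun l hl => hY.coord_eq_zero_of_mem_unstableIdx F hp (l := l) hl
  -- The orthant excludes negative values, and a vanishing `k`-th coordinate would leave no unstable
  -- coordinate and force `z = p`.
  have hpos : ∀ z ∈ Y, z ≠ p → Tendsto (fun t => F.φ t z) atBot (𝓝 p) →
      (∀ l ∈ unstableIdx f p, l ≠ k → z l = 0) → 0 < z k := by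
    intro z hzY hzp hzt hzU
    refine lt_of_le_of_ne (hY.subset_orthant hzY k) fun h0 => hzp ?_
    refine h.eq_of_tendsto (hY.map_equilibrium F hp) hz hzt fun l hl => ?_
    by_cases hlk : l = k
    · rw [hlk, ← h0]
    · exact hzU l hl hlk
  exact h.exists_map_eq (hz k hk) hx hy hxU hyU (hpos x hxY hxp hx hxU) (hpos y hyY hyp hy hyU)

end IsACNetwork

/-! ### The dimension of a trajectory -/

/-- A nonconstant orbit has Hausdorff dimension one. -/
theorem NetworkFlow.dimH_orbit {n : ℕ} {f : Phase n → Phase n} {Y : Set (Phase n)}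
    (F : NetworkFlow f Y) {x : Phase n} {t : ℝ} (hx : F.φ t x ≠ x) :
    dimH (range fun t => F.φ t x) = 1 := by
  refine le_antisymm ((F.lipschitz x).dimH_range_le.trans_eq ?_) ?_
  · rw [Real.dimH_univ]
  -- The lower bound comes from a coordinate projection: it is `1`-Lipschitz and maps the orbit onto
  -- a set containing an interval.
  · obtain ⟨l, hl⟩ : ∃ l, F.φ t x l ≠ x l := by
      by_contra hcon
      push Not at hcon
      exact hx (PiLp.ext hcon)
    set g : Phase n → ℝ := fun y => y l
    have hg : LipschitzWith 1 g := LipschitzWith.of_dist_le_mul fun y z => by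
      rw [NNReal.coe_one, one_mul, Real.dist_eq, dist_eq_norm]
      exact PiLp.norm_apply_le (y - z) l
    refine le_trans ?_ (hg.dimH_image_le (range fun t => F.φ t x))
    rw [← range_comp]
    have hsub : uIcc (F.φ 0 x l) (F.φ t x l) ⊆ range (g ∘ fun t => F.φ t x) := fun y hy => by
      obtain ⟨s, -, hs⟩ := intermediate_value_uIcc (F.continuous_coord x l).continuousOn hy
      exact ⟨s, hs⟩
    have hinterior : (interior (range (g ∘ fun t => F.φ t x))).Nonempty := by
      refine Nonempty.mono (interior_mono hsub) ?_
      rw [F.map_zero, uIcc, interior_Icc, nonempty_Ioo]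
      exact inf_lt_sup.2 hl.symm
    rw [Real.dimH_of_nonempty_interior hinterior]
    simp

/-! ### A cross section of a two-dimensional unstable set -/

section CrossSection

variable {n : ℕ} {f : Phase n → Phase n} {Y : Set (Phase n)}

/-- `x` parametrises by `[0, 1]` a curve in the local unstable set of `p` that meets each trajectory
of the unstable set, except `p`, exactly once; the unstable coordinates `j`, `k` of `x θ` are
proportional to `√θ` and `√(1 - θ)`. -/
structure IsCrossSection (F : NetworkFlow f Y) (p : Phase n) (j k : Fin n) (ρ μ : ℝ)
    (x : ℝ → Phase n) : Prop where
  ball : IsHyperbolicBall F p ρ μ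
  continuousOn : ContinuousOn x (Icc 0 1)
  backwardIn : ∀ θ ∈ Icc (0 : ℝ) 1, F.BackwardIn p ρ (x θ)
  mem : ∀ θ ∈ Icc (0 : ℝ) 1, x θ ∈ Y
  coord_fst : ∀ θ ∈ Icc (0 : ℝ) 1, x θ j = ρ / 4 * √θ
  coord_snd : ∀ θ ∈ Icc (0 : ℝ) 1, x θ k = ρ / 4 * √(1 - θ)
  surj : ∀ y ∈ Y, y ≠ p → Tendsto (fun t => F.φ t y) atBot (𝓝 p) →
    ∃ θ ∈ Icc (0 : ℝ) 1, ∃ t, F.φ t (x θ) = y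
  inj : ∀ θ₁ ∈ Icc (0 : ℝ) 1, ∀ θ₂ ∈ Icc (0 : ℝ) 1, ∀ t, F.φ t (x θ₁) = x θ₂ → θ₁ = θ₂

theorem IsCrossSection.swap {F : NetworkFlow f Y} {p : Phase n} {j k : Fin n} {ρ μ : ℝ}
    {x : ℝ → Phase n} (h : IsCrossSection F p j k ρ μ x) :
    IsCrossSection F p k j ρ μ fun θ => x (1 - θ) := by
  have hm : ∀ θ ∈ Icc (0 : ℝ) 1, 1 - θ ∈ Icc (0 : ℝ) 1 :=
    fun θ hθ => ⟨by linarith [hθ.2], by linarith [hθ.1]⟩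
  refine ⟨h.ball, h.continuousOn.comp (by fun_prop) hm, fun θ hθ => h.backwardIn _ (hm θ hθ),
    fun θ hθ => h.mem _ (hm θ hθ), fun θ hθ => ?_, fun θ hθ => h.coord_fst _ (hm θ hθ),
    fun y hy hyp hyt => ?_, fun θ₁ h₁ θ₂ h₂ t ht => ?_⟩
  · rw [h.coord_snd _ (hm θ hθ), sub_sub_cancel]
  · obtain ⟨θ, hθ, t, ht⟩ := h.surj y hy hyp hyt
    exact ⟨1 - θ, hm θ hθ, t, by rwa [sub_sub_cancel]⟩
  · linarith [h.inj _ (hm _ h₁) _ (hm _ h₂) t ht]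

theorem sqSum_pair {j k : Fin n} (hjk : j ≠ k) (z : Phase n) :
    sqSum {j, k} z = z j ^ 2 + z k ^ 2 := Finset.sum_pair hjk

/-- The quarter circle of radius `ρ / 4` in the unstable coordinates is lifted to the local unstable
graph. The unstable radius decays strictly backwards along orbits, so no trajectory meets the lifted
curve twice. -/
theorem IsACNetwork.exists_isCrossSection (hY : IsACNetwork f Y) (F : NetworkFlow f Y)
    {p : Phase n} (hp : p ∈ equilibriaIn f Y) {j k : Fin n} (hjk : j ≠ k)
    (hU : unstableIdx f p = {j, k}) : ∃ ρ μ x, IsCrossSection F p j k ρ μ x := by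
  obtain ⟨i, hi, hpi⟩ := hY.exists_axis hp
  obtain ⟨ρ₀, μ, h₀⟩ := hY.exists_ball F hp
  -- A radius of at most `p i` keeps the axial coordinate nonnegative in the ball, so that the
  -- lifted points lie in the orthant and cleanness applies to them.
  set ρ := min ρ₀ (p i) with hρdef
  have hρ : 0 < ρ := lt_min h₀.radius_pos hpi
  have h : IsHyperbolicBall F p ρ μ := h₀.mono hρ (min_le_left _ _)
  have hfix := hY.map_equilibrium F hp
  have hiU : i ∉ unstableIdx f p := fun hmem =>
    absurd (mem_unstableIdx.1 hmem) (hY.rate_axis_neg F hp hi hpi).not_gt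
  have hij : i ≠ j := fun e => hiU (by rw [hU, e]; simp)
  have hik : i ≠ k := fun e => hiU (by rw [hU, e]; simp)
  have hpj : p j = 0 := hi j hij.symm
  have hpk : p k = 0 := hi k hik.symm
  have hex : ∀ θ, ∃ y, θ ∈ Icc (0 : ℝ) 1 → F.BackwardIn p ρ y ∧ y j = ρ / 4 * √θ ∧
      y k = ρ / 4 * √(1 - θ) := by
    intro θ
    by_cases hθ : θ ∈ Icc (0 : ℝ) 1
    · set w : Phase n := EuclideanSpace.single j (ρ / 4 * √θ) +
        EuclideanSpace.single k (ρ / 4 * √(1 - θ)) with hw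
      have hwU : w ∈ coordSubspace (unstableIdx f p) := by
        intro l hl
        rw [hU, Finset.mem_insert, Finset.mem_singleton, not_or] at hl
        simp [hw, hl.1, hl.2]
      have hwj : w j = ρ / 4 * √θ := by simp [hw, hjk]
      have hwk : w k = ρ / 4 * √(1 - θ) := by simp [hw, hjk.symm]
      have hwn : ‖w‖ ≤ ρ / 4 := by
        refine le_of_sq_le_sq ?_ (by positivity)
        have h1 : ‖w‖ ^ 2 = sqSum {j, k} w := by
          rw [← sqSum_univ, ← hU]
          exact (Finset.sum_subset (Finset.subset_univ _) fun l _ hl => by rw [hwU l hl]; simp).symm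
        rw [h1, sqSum_pair hjk, hwj, hwk, mul_pow, mul_pow, Real.sq_sqrt hθ.1,
          Real.sq_sqrt (by linarith [hθ.2])]
        linarith
      obtain ⟨s, hs⟩ := h.exists_backwardIn_over hfix hp.2 hi hiU hwU hwn
      refine ⟨_, fun _ => ⟨hs, ?_, ?_⟩⟩
      · simp [hpj, hwj, hij.symm]
      · simp [hpk, hwk, hik.symm]
    · exact ⟨0, fun h' => absurd h' hθ⟩
  choose x hx using hex
  have htend : ∀ θ ∈ Icc (0 : ℝ) 1, Tendsto (fun t => F.φ t (x θ)) atBot (𝓝 p) :=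
    fun θ hθ => h.tendsto_of_backwardIn hfix hp.2 (hx θ hθ).1
  have hmem : ∀ θ ∈ Icc (0 : ℝ) 1, x θ ∈ Y := by
    intro θ hθ
    refine hY.unstableSet_subset hp (F.mem_unstableSet_of_tendsto (fun l => ?_)
      (fun t ht => h.subset_dom ((hx θ hθ).1 t ht)) (htend θ hθ))
    by_cases hlj : l = j
    · rw [hlj, (hx θ hθ).2.1]; positivity
    by_cases hlk : l = k
    · rw [hlk, (hx θ hθ).2.2]; positivity
    by_cases hli : l = i
    · have h1 : |(x θ - p) i| ≤ ‖x θ - p‖ := PiLp.norm_apply_le (x θ - p) i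
      have h2 : ‖x θ - p‖ ≤ ρ := by rw [← dist_eq_norm]; exact (hx θ hθ).1.self
      have h3 : ρ ≤ p i := min_le_right _ _
      rw [PiLp.sub_apply] at h1
      have := (abs_le.1 (h1.trans h2)).1
      rw [hli]; linarith
    · exact (h.coord_eq_zero_of_backwardIn (hi l hli) (by rw [hU]; simp [hlj, hlk])
        (hx θ hθ).1).ge
  have hsq : ∀ y : Phase n, sqSum (unstableIdx f p) (y - p) = y j ^ 2 + y k ^ 2 := by
    intro y
    rw [hU, sqSum_pair hjk]
    simp [hpj, hpk]
  have hsqx : ∀ θ ∈ Icc (0 : ℝ) 1, sqSum (unstableIdx f p) (x θ - p) = (ρ / 4) ^ 2 := by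
    intro θ hθ
    rw [hsq, (hx θ hθ).2.1, (hx θ hθ).2.2, mul_pow, mul_pow, Real.sq_sqrt hθ.1,
      Real.sq_sqrt (by linarith [hθ.2])]
    ring
  refine ⟨ρ, μ, x, h, ?_, fun θ hθ => (hx θ hθ).1, hmem, fun θ hθ => (hx θ hθ).2.1,
    fun θ hθ => (hx θ hθ).2.2, fun y hy hyp hyt => ?_, ?_⟩
  -- Continuity follows from the cone estimate: the distance of two lifts is at most `√2` times that
  -- of their unstable coordinates.
  · intro θ₀ hθ₀
    set c : ℝ → ℝ := fun θ => 2 * ((ρ / 4 * √θ - ρ / 4 * √θ₀) ^ 2 +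
      (ρ / 4 * √(1 - θ) - ρ / 4 * √(1 - θ₀)) ^ 2) with hc
    have hcc : Continuous fun θ => √(c θ) := by fun_prop
    rw [ContinuousWithinAt, tendsto_iff_dist_tendsto_zero]
    have hlim : Tendsto (fun θ => √(c θ)) (𝓝[Icc 0 1] θ₀) (𝓝 0) := by
      have := (hcc.tendsto θ₀).mono_left (nhdsWithin_le_nhds (s := Icc 0 1))
      simpa [hc] using this
    refine squeeze_zero' (Eventually.of_forall fun _ => dist_nonneg) ?_ hlim
    filter_upwards [self_mem_nhdsWithin] with θ hθ
    refine Real.le_sqrt_of_sq_le ?_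
    have h1 := h.norm_sub_sq_le (hx θ hθ).1 (hx θ₀ hθ₀).1
    rw [hU, sqSum_pair hjk, PiLp.sub_apply, PiLp.sub_apply, (hx θ hθ).2.1, (hx θ hθ).2.2,
      (hx θ₀ hθ₀).2.1, (hx θ₀ hθ₀).2.2] at h1
    rw [dist_eq_norm]
    exact h1
  -- The orbit must leave the ball, as its forward limit is another equilibrium. At the exit the
  -- cone condition makes the unstable radius at least `ρ / 4`; it tends to zero backwards, so the
  -- value `ρ / 4` is taken in between.
  · obtain ⟨b, hb, hpb, hyb, -⟩ := hY.exists_forward_limit F hy hyt hyp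
    have hbout : b ∉ Metric.closedBall p ρ :=
      fun hmem => hpb (h.eq_of_equilibrium hp.2 hb.2 hmem).symm
    obtain ⟨T, -, hT⟩ := F.exists_backwardIn (half_pos hρ) hyt
    set y₁ := F.φ T y with hy₁
    have hy₁b : F.BackwardIn p (ρ / 2) y₁ := hT T le_rfl
    obtain ⟨S, hS0, hS⟩ := ((eventually_ge_atTop 0).and ((F.tendsto_atTop_map hyb T).eventually
      (Metric.isClosed_closedBall.isOpen_compl.mem_nhds hbout))).exists
    have hcont : Continuous fun s => dist (F.φ s y₁) p :=
      (F.continuous_time y₁).dist continuous_const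
    obtain ⟨τ, hτ, hτe, hτl⟩ := exists_first_eq hcont hS0 (c := ρ)
      (lt_of_le_of_lt (hy₁b 0 le_rfl) (by linarith)) (not_le.1 hS).le
    set y₂ := F.φ τ y₁ with hy₂
    have hy₂b : F.BackwardIn p ρ y₂ := by
      intro t ht
      rw [hy₂, ← F.map_add]
      rcases le_or_gt (t + τ) 0 with h' | h'
      · exact Metric.closedBall_subset_closedBall (by linarith) (hy₁b _ h')
      · rcases ht.lt_or_eq with h'' | h''
        · exact (hτl (t + τ) ⟨h'.le, by linarith⟩).le
        · rw [h'', zero_add]; exact hτe.le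
    have hbig : (ρ / 4) ^ 2 ≤ sqSum (unstableIdx f p) (y₂ - p) := by
      have h1 := h.norm_sub_sq_le_self hfix hy₂b
      rw [← dist_eq_norm, hτe] at h1
      nlinarith
    have hwc : Continuous fun t => sqSum (unstableIdx f p) (F.φ t y₂ - p) :=
      (continuous_sqSum _).comp ((F.continuous_time y₂).sub continuous_const)
    have hwlim : Tendsto (fun t => sqSum (unstableIdx f p) (F.φ t y₂ - p)) atBot (𝓝 0) := by
      have h1 : Tendsto (fun t => F.φ t y₂ - p) atBot (𝓝 (p - p)) :=
        (h.tendsto_of_backwardIn hfix hp.2 hy₂b).sub_const p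
      have h2 := ((continuous_sqSum (unstableIdx f p)).tendsto _).comp h1
      have h3 : sqSum (unstableIdx f p) (p - p) = 0 := by simp [sqSum]
      rwa [h3] at h2
    obtain ⟨S', hS'0, hS'⟩ := ((eventually_le_atBot 0).and (hwlim.eventually
      (gt_mem_nhds (show (0 : ℝ) < (ρ / 4) ^ 2 by positivity)))).exists
    obtain ⟨t, ht, hte⟩ := intermediate_value_Icc hS'0 hwc.continuousOn
      ⟨hS'.le, by rwa [F.map_zero]⟩
    set y₃ := F.φ t y₂ with hy₃
    have hy₃Y : y₃ ∈ Y := F.invariant _ (F.invariant _ (F.invariant _ hy _) _) _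
    have hy₃b : F.BackwardIn p ρ y₃ := hy₂b.map ht.2
    have hsum : y₃ j ^ 2 + y₃ k ^ 2 = (ρ / 4) ^ 2 := by rw [← hsq]; exact hte
    have hj0 := hY.subset_orthant hy₃Y j
    have hk0 := hY.subset_orthant hy₃Y k
    set θ := (y₃ j / (ρ / 4)) ^ 2 with hθ
    have hρ4 : 0 < ρ / 4 := by positivity
    have hθ1 : 1 - θ = (y₃ k / (ρ / 4)) ^ 2 := by
      rw [hθ, div_pow, div_pow]; field_simp; linarith
    have hθmem : θ ∈ Icc (0 : ℝ) 1 :=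
      ⟨by positivity, by have : 0 ≤ 1 - θ := by { rw [hθ1]; positivity }
                         linarith⟩
    have hxy : x θ = y₃ := by
      refine h.eq_of_backwardIn (hx θ hθmem).1 hy₃b fun l hl => ?_
      rw [hU, Finset.mem_insert, Finset.mem_singleton] at hl
      rcases hl with rfl | rfl
      · rw [(hx θ hθmem).2.1, hθ, Real.sqrt_sq (by positivity)]; field_simp
      · rw [(hx θ hθmem).2.2, hθ1, Real.sqrt_sq (by positivity)]; field_simp
    refine ⟨θ, hθmem, -T + (-τ + -t), ?_⟩
    rw [hxy, F.map_add, F.map_add, hy₃, F.map_neg_map, hy₂, F.map_neg_map, hy₁, F.map_neg_map]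
  · have key : ∀ θ₁ ∈ Icc (0 : ℝ) 1, ∀ θ₂ ∈ Icc (0 : ℝ) 1, ∀ t ≤ 0,
        F.φ t (x θ₁) = x θ₂ → θ₁ = θ₂ := by
      intro θ₁ h₁ θ₂ h₂ t ht hte
      rcases ht.lt_or_eq with h' | rfl
      · exfalso
        have hd := h.sqSum_map_le_of_backwardIn hfix hp.2 (hx θ₁ h₁).1 ht
        rw [hte, hsqx θ₁ h₁, hsqx θ₂ h₂] at hd
        have h3 : Real.exp (μ * t) < 1 :=
          by simpa using Real.exp_lt_exp.2 (mul_neg_of_pos_of_neg h.rate_pos h')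
        have h4 : 0 < (ρ / 4) ^ 2 := by positivity
        nlinarith
      · rw [F.map_zero] at hte
        have h3 := congrArg (fun y : Phase n => y j) hte
        simp only [(hx θ₁ h₁).2.1, (hx θ₂ h₂).2.1] at h3
        have h4 : √θ₁ = √θ₂ := mul_left_cancel₀ (by positivity) h3
        rwa [Real.sqrt_inj h₁.1 h₂.1] at h4
    intro θ₁ h₁ θ₂ h₂ t ht
    rcases le_total t 0 with h' | h'
    · exact key θ₁ h₁ θ₂ h₂ t h' ht
    · exact (key θ₂ h₂ θ₁ h₁ (-t) (by linarith) (by rw [← ht, F.map_neg_map])).symm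

end CrossSection

/-! ### The trajectories near the edge of a two-dimensional unstable set -/

section Clique

variable {n : ℕ} {f : Phase n → Phase n} {Y : Set (Phase n)}

theorem IsACNetwork.exists_axis_mem (hY : IsACNetwork f Y) {b : Phase n}
    (hb : b ∈ equilibriaIn f Y) {I : Finset (Fin n)} (hbI : b ∈ coordSubspace I) :
    ∃ m ∈ I, b ∈ coordAxis m ∧ 0 < b m := by
  obtain ⟨m, hm, hbm⟩ := hY.exists_axis hb
  refine ⟨m, ?_, hm, hbm⟩
  by_contra hmI
  exact hbm.ne' (hbI m hmI)

/-- An equilibrium `p` with the two unstable directions `j`, `k`, a cross section `x` of its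
unstable set, whose trajectories tend to `r`, except for the edge `x 1`, which tends to `q`. -/
structure IsCliqueConfiguration (F : NetworkFlow f Y) (p q r : Phase n) (i j k : Fin n) (ρ μ : ℝ)
    (x : ℝ → Phase n) : Prop where
  cross : IsCrossSection F p j k ρ μ x
  fst_mem : p ∈ equilibriaIn f Y
  snd_mem : q ∈ equilibriaIn f Y
  trd_mem : r ∈ equilibriaIn f Y
  ne_ij : i ≠ j
  ne_ik : i ≠ k
  ne_jk : j ≠ k
  fst_axis : p ∈ coordAxis i
  snd_axis : q ∈ coordAxis j
  trd_axis : r ∈ coordAxis k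
  fst_pos : 0 < p i
  snd_pos : 0 < q j
  trd_pos : 0 < r k
  fst_unstable : unstableIdx f p = {j, k}
  -- Nothing is claimed for other indices: `q` may have a second unstable direction outside these
  -- three.
  snd_unstable : ∀ l ∈ ({i, j, k} : Finset (Fin n)), l ∈ unstableIdx f q ↔ l = k
  trd_stable : ∀ l ∈ ({i, j, k} : Finset (Fin n)), l ∉ unstableIdx f r
  tendsto_snd : Tendsto (fun t => F.φ t (x 1)) atTop (𝓝 q)
  tendsto_trd : ∀ θ ∈ Ico (0 : ℝ) 1, Tendsto (fun t => F.φ t (x θ)) atTop (𝓝 r)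

namespace IsCliqueConfiguration

variable {F : NetworkFlow f Y} {p q r : Phase n} {i j k : Fin n} {ρ μ : ℝ} {x : ℝ → Phase n}

theorem fst_ne_snd (C : IsCliqueConfiguration F p q r i j k ρ μ x) : p ≠ q := by
  rintro rfl; exact C.snd_pos.ne' (C.fst_axis j C.ne_ij.symm)

theorem snd_ne_trd (C : IsCliqueConfiguration F p q r i j k ρ μ x) : q ≠ r := by
  rintro rfl; exact C.trd_pos.ne' (C.snd_axis k C.ne_jk.symm)

theorem fst_ne_trd (C : IsCliqueConfiguration F p q r i j k ρ μ x) : p ≠ r := by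
  rintro rfl; exact C.trd_pos.ne' (C.fst_axis k C.ne_ik.symm)

theorem trd_mem_coordSubspace (C : IsCliqueConfiguration F p q r i j k ρ μ x) :
    r ∈ coordSubspace {i, j, k} := fun l hl => C.trd_axis l fun h => hl (by simp [h])

theorem mem_coordSubspace (C : IsCliqueConfiguration F p q r i j k ρ μ x) (hY : IsACNetwork f Y)
    {y : Phase n} (hy : Tendsto (fun t => F.φ t y) atBot (𝓝 p)) :
    y ∈ coordSubspace {i, j, k} := by
  have := hY.mem_coordSubspace_of_tendsto F C.fst_mem C.fst_axis hy
  rwa [C.fst_unstable] at this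

theorem tendsto_fst (C : IsCliqueConfiguration F p q r i j k ρ μ x) (hY : IsACNetwork f Y)
    {θ : ℝ} (hθ : θ ∈ Icc (0 : ℝ) 1) : Tendsto (fun t => F.φ t (x θ)) atBot (𝓝 p) :=
  C.cross.ball.tendsto_of_backwardIn (hY.map_equilibrium F C.fst_mem) C.fst_mem.2
    (C.cross.backwardIn θ hθ)

/-- Equilibria of the network in the three-dimensional coordinate subspace of the clique. -/
theorem eq_or_eq_or_eq (C : IsCliqueConfiguration F p q r i j k ρ μ x) (hY : IsACNetwork f Y)
    {b : Phase n} (hb : b ∈ equilibriaIn f Y) (hbI : b ∈ coordSubspace {i, j, k}) :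
    b = p ∨ b = q ∨ b = r := by
  obtain ⟨m, hm, hbm, -⟩ := hY.exists_axis_mem hb hbI
  simp only [Finset.mem_insert, Finset.mem_singleton] at hm
  rcases hm with rfl | rfl | rfl
  · exact Or.inl (hY.eq_of_mem_coordAxis hb C.fst_mem hbm C.fst_axis)
  · exact Or.inr (Or.inl (hY.eq_of_mem_coordAxis hb C.snd_mem hbm C.snd_axis))
  · exact Or.inr (Or.inr (hY.eq_of_mem_coordAxis hb C.trd_mem hbm C.trd_axis))

/-- A point leaving `q` inside the coordinate subspace of the clique tends to `r`. -/
theorem tendsto_trd_of_tendsto_snd (C : IsCliqueConfiguration F p q r i j k ρ μ x)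
    (hY : IsACNetwork f Y) {e : Phase n} (he : e ∈ Y) (heI : e ∈ coordSubspace {i, j, k})
    (heq : e ≠ q) (het : Tendsto (fun t => F.φ t e) atBot (𝓝 q)) :
    Tendsto (fun t => F.φ t e) atTop (𝓝 r) := by
  obtain ⟨b, hb, hqb, hbt, -⟩ := hY.exists_forward_limit F he het heq
  -- Direction `i` is stable at `q` and off its axis, so it does not occur on the unstable set; this
  -- rules out `p` as forward limit.
  have hejk : e ∈ coordSubspace {j, k} := by
    intro l hl
    simp only [Finset.mem_insert, Finset.mem_singleton, not_or] at hl
    by_cases hli : l = i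
    · refine hY.mem_coordSubspace_of_tendsto F C.snd_mem C.snd_axis het l ?_
      rw [Finset.mem_insert, not_or]
      refine ⟨hl.1, fun hmem => hl.2 ?_⟩
      exact (C.snd_unstable l (by simp [hli])).1 hmem
    · exact heI l (by simp [hl.1, hl.2, hli])
  obtain ⟨m, hm, hbm, -⟩ := hY.exists_axis_mem hb
    (IsACNetwork.limit_mem_coordSubspace F hbt hejk)
  simp only [Finset.mem_insert, Finset.mem_singleton] at hm
  rcases hm with rfl | rfl
  · exact absurd (hY.eq_of_mem_coordAxis C.snd_mem hb C.snd_axis hbm) hqb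
  · rwa [hY.eq_of_mem_coordAxis hb C.trd_mem hbm C.trd_axis] at hbt

/-- Points leaving `q` inside the coordinate subspace of the clique lie on one trajectory. -/
theorem exists_map_eq_of_tendsto_snd (C : IsCliqueConfiguration F p q r i j k ρ μ x)
    (hY : IsACNetwork f Y) {e e' : Phase n} (he : e ∈ Y) (heI : e ∈ coordSubspace {i, j, k})
    (heq : e ≠ q) (het : Tendsto (fun t => F.φ t e) atBot (𝓝 q))
    (he' : e' ∈ Y) (heI' : e' ∈ coordSubspace {i, j, k})
    (heq' : e' ≠ q) (het' : Tendsto (fun t => F.φ t e') atBot (𝓝 q)) : ∃ t, F.φ t e = e' := by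
  have hk : k ∈ unstableIdx f q := (C.snd_unstable k (by simp)).2 rfl
  have hz : ∀ y ∈ coordSubspace {i, j, k}, ∀ l ∈ unstableIdx f q, l ≠ k → y l = 0 :=
    fun y hy l hl hlk => hy l fun hmem => hlk ((C.snd_unstable l hmem).1 hl)
  exact hY.exists_map_eq F C.snd_mem hk he he' heq heq' het het' (hz e heI) (hz e' heI')

/-- Trajectories of the cross section close to its edge pass near `q` and leave the neighbourhood of
`q` close to its unstable set. -/
theorem exists_exit (C : IsCliqueConfiguration F p q r i j k ρ μ x) (hY : IsACNetwork f Y)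
    {d ν : ℝ} (hd : IsHyperbolicBall F q d ν) {θ : ℕ → ℝ} (hθ : ∀ m, θ m ∈ Ico (0 : ℝ) 1)
    (hθ1 : Tendsto θ atTop (𝓝 1)) :
    ∃ τ ≥ 0, ∃ s : ℕ → ℕ, Tendsto s atTop atTop ∧ ∃ (σ : ℕ → ℝ) (e : Phase n), e ∈ Y ∧
      e ∈ coordSubspace {i, j, k} ∧ e ≠ q ∧ F.BackwardIn q d e ∧
      (∀ t ≥ τ, F.φ t (x 1) ∈ Metric.ball q d) ∧
      Tendsto (fun m => F.φ (σ m) (x (θ (s m)))) atTop (𝓝 e) ∧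
      ∀ m, τ ≤ σ m ∧ ∀ t ∈ Icc τ (σ m), F.φ t (x (θ (s m))) ∈ Metric.closedBall q d := by
  have hd0 := hd.radius_pos
  have hxlim : Tendsto (fun m => x (θ m)) atTop (𝓝 (x 1)) := by
    have h1 := C.cross.continuousOn 1 (right_mem_Icc.2 zero_le_one)
    refine h1.tendsto.comp (tendsto_nhdsWithin_iff.2 ⟨hθ1, Eventually.of_forall fun m => ?_⟩)
    exact Ico_subset_Icc_self (hθ m)
  obtain ⟨τ₀, hτ₀⟩ := eventually_atTop.1
    (C.tendsto_snd.eventually (Metric.ball_mem_nhds q hd0))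
  set τ := max τ₀ 0 with hτ
  have hedge : ∀ t ≥ τ, F.φ t (x 1) ∈ Metric.ball q d :=
    fun t ht => hτ₀ t ((le_max_left _ _).trans ht)
  -- By continuous dependence, trajectories near the edge stay near `q` on any prescribed bounded
  -- time interval starting at `τ`. Hence their exit times tend to infinity.
  have hnear : ∀ B, ∀ᶠ m in atTop, ∀ t ∈ Icc τ B, F.φ t (x (θ m)) ∈ Metric.ball q d := by
    intro B
    have h1 : ∀ᶠ y in 𝓝 (x 1), ∀ t ∈ Icc τ B, F.φ t y ∈ Metric.ball q d := by
      refine isCompact_Icc.eventually_forall_of_forall_eventually fun t ht => ?_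
      have hc : Continuous fun z : Phase n × ℝ => F.φ z.2 z.1 :=
        F.continuous_uncurry.comp (continuous_snd.prodMk continuous_fst)
      exact hc.continuousAt.eventually (Metric.isOpen_ball.mem_nhds (hedge t ht.1))
    exact hxlim.eventually h1
  obtain ⟨m₀, hm₀⟩ := eventually_atTop.1 (hnear τ)
  have hrout : r ∉ Metric.closedBall q d :=
    fun hmem => C.snd_ne_trd (hd.eq_of_equilibrium C.snd_mem.2 C.trd_mem.2 hmem).symm
  -- Every trajectory with `θ < 1` tends to `r`, which lies outside the ball. The shift by `m₀`
  -- guarantees that the trajectory is inside at time `τ`.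
  have hexit : ∀ m, ∃ σ, τ < σ ∧ dist (F.φ σ (x (θ (m + m₀)))) q = d ∧
      ∀ t ∈ Ico τ σ, dist (F.φ t (x (θ (m + m₀)))) q < d := by
    intro m
    obtain ⟨S, hSτ, hS⟩ := ((eventually_ge_atTop τ).and ((C.tendsto_trd _
      (hθ (m + m₀))).eventually (Metric.isClosed_closedBall.isOpen_compl.mem_nhds hrout))).exists
    have hcont : Continuous fun t => dist (F.φ t (x (θ (m + m₀)))) q :=
      (F.continuous_time _).dist continuous_const
    obtain ⟨σ, hσ, hσe, hσl⟩ := exists_first_eq hcont hSτ (c := d)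
      (hm₀ (m + m₀) (by omega) τ ⟨le_rfl, le_rfl⟩) (not_le.1 hS).le
    exact ⟨σ, hσ.1, hσe, hσl⟩
  choose σ hστ hσe hσl using hexit
  have hmemY : ∀ m, x (θ m) ∈ Y := fun m => C.cross.mem _ (Ico_subset_Icc_self (hθ m))
  have hmemI : ∀ m, x (θ m) ∈ coordSubspace {i, j, k} := fun m =>
    C.mem_coordSubspace hY (C.tendsto_fst hY (Ico_subset_Icc_self (hθ m)))
  obtain ⟨e, heY, s, hs, hse⟩ := hY.isCompact.tendsto_subseq
    (x := fun m => F.φ (σ m) (x (θ (m + m₀)))) fun m => F.invariant _ (hmemY _) _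
  have hσtop : ∀ B, ∀ᶠ m in atTop, B < σ (s m) := by
    intro B
    have h1 := ((tendsto_add_atTop_nat m₀).comp hs.tendsto_atTop).eventually (hnear B)
    filter_upwards [h1] with m hm
    by_contra hle
    have := hm (σ (s m)) ⟨(hστ _).le, not_lt.1 hle⟩
    exact absurd (hσe (s m)) (ne_of_lt this)
  have hin : ∀ m, ∀ t ∈ Icc τ (σ m), F.φ t (x (θ (m + m₀))) ∈ Metric.closedBall q d := by
    intro m t ht
    rcases ht.2.lt_or_eq with h' | h'
    · exact (hσl m t ⟨ht.1, h'⟩).le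
    · rw [h']; exact (hσe m).le
  refine ⟨τ, le_max_right _ _, fun m => s m + m₀,
    (tendsto_add_atTop_nat m₀).comp hs.tendsto_atTop, fun m => σ (s m), e, heY, ?_, ?_, ?_,
    hedge, hse, fun m => ⟨(hστ _).le, hin (s m)⟩⟩
  · exact (isClosed_coordSubspace _).mem_of_tendsto hse
      (Eventually.of_forall fun m => (F.mem_coordSubspace_iff _ _ _).2 (hmemI _))
  · have h1 : Tendsto (fun m => dist (F.φ (σ (s m)) (x (θ (s m + m₀)))) q) atTop (𝓝 (dist e q)) :=
      hse.dist tendsto_const_nhds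
    simp only [hσe] at h1
    have h2 := tendsto_nhds_unique tendsto_const_nhds h1
    intro h3
    rw [h3, dist_self] at h2
    exact hd0.ne' h2
  -- Since the exit times tend to infinity, any fixed time before the exit eventually falls into the
  -- stay near `q`; the limit of the exit points inherits a backward orbit in the ball.
  · intro t ht
    have h1 : Tendsto (fun m => F.φ t (F.φ (σ (s m)) (x (θ (s m + m₀))))) atTop (𝓝 (F.φ t e)) :=
      ((F.continuous_map t).tendsto e).comp hse
    refine Metric.isClosed_closedBall.mem_of_tendsto h1 ?_
    filter_upwards [hσtop (τ - t)] with m hm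
    rw [← F.map_add]
    exact hin (s m) _ ⟨by linarith, by linarith⟩

end IsCliqueConfiguration

end Clique

/-! ### Hausdorff convergence to the broken trajectory and the closure of the connection -/

section CliqueClosure

variable {n : ℕ} {f : Phase n → Phase n} {Y : Set (Phase n)}

theorem NetworkFlow.eventually_dist_lt (F : NetworkFlow f Y) (a : Phase n) (A B : ℝ) {ε : ℝ}
    (hε : 0 < ε) : ∀ᶠ y in 𝓝 a, ∀ t ∈ Icc A B, dist (F.φ t y) (F.φ t a) < ε := by
  refine isCompact_Icc.eventually_forall_of_forall_eventually fun t _ => ?_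
  have hc : Continuous fun z : Phase n × ℝ => dist (F.φ z.2 z.1) (F.φ z.2 a) :=
    (F.continuous_uncurry.comp (continuous_snd.prodMk continuous_fst)).dist
      ((F.continuous_time a).comp continuous_snd)
  exact hc.continuousAt.eventually (gt_mem_nhds (by simpa using hε))

namespace IsCliqueConfiguration

variable {F : NetworkFlow f Y} {p q r : Phase n} {i j k : Fin n} {ρ μ : ℝ} {x : ℝ → Phase n}

/-- The trajectory from `q` to `r` is not assumed: it passes through an accumulation point of the
exits from a ball around `q`. -/
theorem exists_edge (C : IsCliqueConfiguration F p q r i j k ρ μ x) (hY : IsACNetwork f Y) :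
    ∃ e ∈ Y, e ∈ coordSubspace {i, j, k} ∧ e ≠ q ∧ Tendsto (fun t => F.φ t e) atBot (𝓝 q) := by
  obtain ⟨d, ν, hd⟩ := hY.exists_ball F C.snd_mem
  have hθ : ∀ m : ℕ, 1 - 1 / ((m : ℝ) + 1) ∈ Ico (0 : ℝ) 1 := by
    intro m
    have h1 : (0 : ℝ) < (m : ℝ) + 1 := by positivity
    have h2 : 1 / ((m : ℝ) + 1) ≤ 1 := by rw [div_le_one h1]; linarith [m.cast_nonneg (α := ℝ)]
    have h3 : 0 < 1 / ((m : ℝ) + 1) := by positivity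
    exact ⟨by linarith, by linarith⟩
  have hθ1 : Tendsto (fun m : ℕ => 1 - 1 / ((m : ℝ) + 1)) atTop (𝓝 1) := by
    simpa using (tendsto_const_nhds (x := (1 : ℝ))).sub
      (tendsto_one_div_add_atTop_nhds_zero_nat (𝕜 := ℝ))
  obtain ⟨-, -, -, -, -, e, heY, heI, heq, heb, -⟩ := C.exists_exit hY hd hθ hθ1
  exact ⟨e, heY, heI, heq,
    hd.tendsto_of_backwardIn (hY.map_equilibrium F C.snd_mem) C.snd_mem.2 heb⟩

/-- Along a sequence approaching the edge the trajectories of the cross section come Hausdorff close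
to the broken trajectory through `q`. -/
theorem exists_hausdorffEDist_le (C : IsCliqueConfiguration F p q r i j k ρ μ x)
    (hY : IsACNetwork f Y) {e : Phase n} (heY : e ∈ Y) (heI : e ∈ coordSubspace {i, j, k})
    (heq : e ≠ q) (het : Tendsto (fun t => F.φ t e) atBot (𝓝 q))
    {θ : ℕ → ℝ} (hθ : ∀ m, θ m ∈ Ico (0 : ℝ) 1) (hθ1 : Tendsto θ atTop (𝓝 1))
    {ε : ℝ} (hε : 0 < ε) :
    ∃ m, Metric.hausdorffEDist (range fun t => F.φ t (x (θ m)))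
      ((range fun t => F.φ t (x 1)) ∪ {q} ∪ range fun t => F.φ t e) ≤ ENNReal.ofReal ε := by
  have hfixr := hY.map_equilibrium F C.trd_mem
  obtain ⟨ρq, ν, hq₀⟩ := hY.exists_ball F C.snd_mem
  obtain ⟨ρr, νr, hr₀⟩ := hY.exists_ball F C.trd_mem
  set d := min ρq (ε / 2) with hd_def
  have hdε : d ≤ ε / 2 := min_le_right _ _
  have hd : IsHyperbolicBall F q d ν :=
    hq₀.mono (lt_min hq₀.radius_pos (half_pos hε)) (min_le_left _ _)
  set η := min ρr (ε / 2) with hη_def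
  have hηε : η ≤ ε / 2 := min_le_right _ _
  have hr : IsHyperbolicBall F r η νr :=
    hr₀.mono (lt_min hr₀.radius_pos (half_pos hε)) (min_le_left _ _)
  obtain ⟨τ, -, s, hs, σ, e', heY', heI', heq', heb', hedge, hse, hin⟩ :=
    C.exists_exit hY hd hθ hθ1
  have het' : Tendsto (fun t => F.φ t e') atBot (𝓝 q) :=
    hd.tendsto_of_backwardIn (hY.map_equilibrium F C.snd_mem) C.snd_mem.2 heb'
  -- The limiting exit point depends on `ε` and the sequence, but always lies on the trajectory of
  -- `e`, so it may serve as base point.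
  obtain ⟨t₀, rfl⟩ := C.exists_map_eq_of_tendsto_snd hY heY heI heq het heY' heI' heq' het'
  rw [← F.range_map t₀ e]
  set e' := F.φ t₀ e
  have her : Tendsto (fun t => F.φ t e') atTop (𝓝 r) :=
    C.tendsto_trd_of_tendsto_snd hY heY' heI' heq' het'
  have h01 : (1 : ℝ) ∈ Icc (0 : ℝ) 1 := ⟨zero_le_one, le_rfl⟩
  have hmem : ∀ m, θ m ∈ Icc (0 : ℝ) 1 := fun m => Ico_subset_Icc_self (hθ m)
  have hxlim : Tendsto (fun m => x (θ (s m))) atTop (𝓝 (x 1)) :=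
    (C.cross.continuousOn 1 h01).tendsto.comp
      (tendsto_nhdsWithin_iff.2 ⟨hθ1.comp hs, Eventually.of_forall fun m => hmem _⟩)
  -- Before `T₀` all trajectories of the cross section are within `ε / 2` of `p`, uniformly in `θ`;
  -- only a compact time interval remains up to `τ`.
  obtain ⟨T₀, hT₀⟩ := eventually_atBot.1 ((eventually_le_atBot 0).and
    (C.cross.ball.tendsto_exp_bound.eventually
      (gt_mem_nhds (show (0 : ℝ) < (ε / 2) ^ 2 by positivity))))
  have hback : ∀ θ' ∈ Icc (0 : ℝ) 1, ∀ t ≤ T₀, dist (F.φ t (x θ')) p ≤ ε / 2 := by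
    intro θ' hθ' t ht
    obtain ⟨h1, h2⟩ := hT₀ t ht
    have h3 := C.cross.ball.dist_map_sq_le (hY.map_equilibrium F C.fst_mem) C.fst_mem.2
      (C.cross.backwardIn θ' hθ') h1
    exact le_of_sq_le_sq (h3.trans h2.le) (by positivity)
  obtain ⟨T₁, hT₁⟩ := eventually_atTop.1 ((eventually_ge_atTop 0).and
    (her.eventually (Metric.ball_mem_nhds r hr.radius_pos)))
  have hT₁0 : 0 ≤ T₁ := (hT₁ T₁ le_rfl).1
  have E1 := hxlim.eventually (F.eventually_dist_lt (x 1) T₀ τ hε)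
  have E2 := hse.eventually (F.eventually_dist_lt e' 0 T₁ hε)
  have E3 : ∀ᶠ m in atTop, F.φ T₁ (F.φ (σ m) (x (θ (s m)))) ∈ Metric.ball r η :=
    (((F.continuous_map T₁).tendsto e').comp hse).eventually
      (Metric.isOpen_ball.mem_nhds (hT₁ T₁ le_rfl).2)
  obtain ⟨m, h1, h2, h3⟩ := (E1.and (E2.and E3)).exists
  set y := x (θ (s m)) with hy
  have hyI : y ∈ coordSubspace {i, j, k} := C.mem_coordSubspace hY (C.tendsto_fst hY (hmem _))
  have hτq : F.φ τ y ∈ Metric.closedBall q d := (hin m).2 τ ⟨le_rfl, (hin m).1⟩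
  have hedgeclose : ∀ t ≤ τ, dist (F.φ t y) (F.φ t (x 1)) ≤ ε := by
    intro t ht
    rcases le_or_gt t T₀ with h' | h'
    · have h4 := hback _ (hmem (s m)) t h'
      have h5 := hback 1 h01 t h'
      linarith [dist_triangle_right (F.φ t y) (F.φ t (x 1)) p]
    · exact (h1 t ⟨h'.le, ht⟩).le
  have htrap : ∀ t ≥ T₁, dist (F.φ t (F.φ (σ m) y)) r ≤ ε / 2 := by
    intro t ht
    have h4 := hr.dist_map_le hfixr C.trd_stable C.trd_mem_coordSubspace
      ((F.mem_coordSubspace_iff _ _ _).2 ((F.mem_coordSubspace_iff _ _ _).2 hyI)) h3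
      (sub_nonneg.2 ht)
    rw [← F.map_add, sub_add_cancel] at h4
    exact h4.trans ((le_of_lt h3).trans hηε)
  have hetrap : ∀ t ≥ T₁, dist (F.φ t e') r ≤ ε / 2 :=
    fun t ht => (le_of_lt (hT₁ t ht).2).trans hηε
  refine ⟨s m, Metric.hausdorffEDist_le_of_mem_edist ?_ ?_⟩
  · suffices H : ∀ t, ∃ z ∈ ((range fun t => F.φ t (x 1)) ∪ {q} ∪ range fun t => F.φ t e'),
        dist (F.φ t y) z ≤ ε by
      rintro _ ⟨t, rfl⟩
      obtain ⟨z, hz, hdz⟩ := H t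
      exact ⟨z, hz, by rw [edist_dist]; exact ENNReal.ofReal_le_ofReal hdz⟩
    -- Four time ranges: along the edge until `τ`, near `q` until the exit time `σ m`, along the
    -- trajectory of `e'` for a further time `T₁`, and trapped near `r` from then on.
    intro t
    rcases le_or_gt t τ with ht | ht
    · exact ⟨_, Or.inl (Or.inl ⟨t, rfl⟩), hedgeclose t ht⟩
    rcases le_or_gt t (σ m) with ht' | ht'
    · refine ⟨q, Or.inl (Or.inr rfl), ?_⟩
      have : dist (F.φ t y) q ≤ d := (hin m).2 t ⟨ht.le, ht'⟩
      linarith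
    have hsplit : F.φ t y = F.φ (t - σ m) (F.φ (σ m) y) := by rw [← F.map_add, sub_add_cancel]
    rcases le_or_gt (t - σ m) T₁ with ht'' | ht''
    · refine ⟨_, Or.inr ⟨t - σ m, rfl⟩, ?_⟩
      rw [hsplit]
      exact (h2 (t - σ m) ⟨by linarith, ht''⟩).le
    · refine ⟨_, Or.inr ⟨T₁, rfl⟩, ?_⟩
      rw [hsplit]
      have h4 := htrap _ ht''.le
      have h5 := hetrap T₁ le_rfl
      linarith [dist_triangle_right (F.φ (t - σ m) (F.φ (σ m) y)) (F.φ T₁ e') r]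
  · suffices H : ∀ z ∈ ((range fun t => F.φ t (x 1)) ∪ {q} ∪ range fun t => F.φ t e'),
        ∃ t, dist z (F.φ t y) ≤ ε by
      intro z hz
      obtain ⟨t, hdz⟩ := H z hz
      exact ⟨_, ⟨t, rfl⟩, by rw [edist_dist]; exact ENNReal.ofReal_le_ofReal hdz⟩
    have hball : ∀ z ∈ Metric.closedBall q d, dist z (F.φ τ y) ≤ ε := by
      intro z hz
      rw [Metric.mem_closedBall] at hz hτq
      linarith [dist_triangle_right z (F.φ τ y) q]
    rintro z ((⟨t, rfl⟩ | rfl) | ⟨t, rfl⟩)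
    · rcases le_or_gt t τ with ht | ht
      · exact ⟨t, by rw [dist_comm]; exact hedgeclose t ht⟩
      · exact ⟨τ, hball _ (Metric.ball_subset_closedBall (hedge t ht.le))⟩
    · exact ⟨τ, hball _ (Metric.mem_closedBall_self hd.radius_pos.le)⟩
    · rcases le_or_gt t 0 with ht | ht
      · exact ⟨τ, hball _ (heb' t ht)⟩
      rcases le_or_gt t T₁ with ht' | ht'
      · refine ⟨t + σ m, ?_⟩
        rw [F.map_add, dist_comm]
        exact (h2 t ⟨ht.le, ht'⟩).le
      · refine ⟨T₁ + σ m, ?_⟩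
        rw [F.map_add]
        have h4 := htrap T₁ le_rfl
        have h5 := hetrap t ht'.le
        exact (dist_triangle_right (F.φ t e') (F.φ T₁ (F.φ (σ m) y)) r).trans (by linarith)

/-- Failure of convergence would give a sequence `θ → 1` with distances all above a fixed positive
bound, whereas every such sequence contains a close member. -/
theorem tendsto_hausdorffEDist (C : IsCliqueConfiguration F p q r i j k ρ μ x)
    (hY : IsACNetwork f Y) {e : Phase n} (heY : e ∈ Y) (heI : e ∈ coordSubspace {i, j, k})
    (heq : e ≠ q) (het : Tendsto (fun t => F.φ t e) atBot (𝓝 q)) :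
    Tendsto (fun θ => Metric.hausdorffEDist (range fun t => F.φ t (x θ))
      ((range fun t => F.φ t (x 1)) ∪ {q} ∪ range fun t => F.φ t e)) (𝓝[<] 1) (𝓝 0) := by
  rw [ENNReal.tendsto_nhds_zero]
  intro ε hε
  by_contra hcon
  obtain ⟨δ, hδ0, hδε⟩ := ENNReal.lt_iff_exists_nnreal_btwn.1 hε
  have hδ0' : (0 : ℝ) < δ := by exact_mod_cast hδ0
  have hfreq := (not_eventually.1 hcon).and_eventually
    (Ico_mem_nhdsLT (zero_lt_one (α := ℝ)))
  obtain ⟨θ, hθ, hθp⟩ := exists_seq_forall_of_frequently hfreq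
  obtain ⟨m, hm⟩ := C.exists_hausdorffEDist_le hY heY heI heq het (fun m => (hθp m).2)
    (hθ.mono_right nhdsWithin_le_nhds) hδ0'
  refine (hθp m).1 (hm.trans ?_)
  rw [ENNReal.ofReal_coe_nnreal]
  exact hδε.le

theorem mem_connection (C : IsCliqueConfiguration F p q r i j k ρ μ x) (hY : IsACNetwork f Y)
    {θ : ℝ} (hθ : θ ∈ Ico (0 : ℝ) 1) (t : ℝ) : F.φ t (x θ) ∈ connection f p r :=
  (hY.mem_connection_iff F (F.invariant _ (C.cross.mem θ (Ico_subset_Icc_self hθ)) t)).2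
    ⟨F.tendsto_atBot_map (C.tendsto_fst hY (Ico_subset_Icc_self hθ)) t,
      F.tendsto_atTop_map (C.tendsto_trd θ hθ) t⟩

/-- The closure of the two-dimensional connection of a clique configuration is a `Δ`-clique. -/
theorem isDeltaClique (C : IsCliqueConfiguration F p q r i j k ρ μ x) (hY : IsACNetwork f Y) :
    IsDeltaClique f p q r (closure (connection f p r)) := by
  obtain ⟨e, heY, heI, heq, het⟩ := C.exists_edge hY
  have her := C.tendsto_trd_of_tendsto_snd hY heY heI heq het
  have h01 : (1 : ℝ) ∈ Icc (0 : ℝ) 1 := ⟨zero_le_one, le_rfl⟩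
  have hx1Y := C.cross.mem 1 h01
  have htr : ∀ y ∈ Y, trajectory f y = range fun t => F.φ t y :=
    fun y hy => F.trajectory_eq hY.contDiff_one hy
  have hmemY : ∀ θ ∈ Ico (0 : ℝ) 1, x θ ∈ Y := fun θ hθ => C.cross.mem θ (Ico_subset_Icc_self hθ)
  have hlim := C.tendsto_hausdorffEDist hY heY heI heq het
  refine ⟨C.fst_mem.2, C.snd_mem.2, C.trd_mem.2, C.fst_ne_snd, C.snd_ne_trd, C.fst_ne_trd,
    trajectory f (x 1), trajectory f e, x,
    ⟨x 1, (hY.mem_connection_iff F hx1Y).2 ⟨C.tendsto_fst hY h01, C.tendsto_snd⟩, rfl⟩,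
    ⟨e, (hY.mem_connection_iff F heY).2 ⟨het, her⟩, rfl⟩,
    C.cross.continuousOn.mono Ico_subset_Icc_self, fun θ hθ => ?_, fun θ₁ h₁ θ₂ h₂ hne heq => ?_,
    ?_, ?_⟩
  · simpa [F.map_zero] using C.mem_connection hY hθ 0
  · rw [htr _ (hmemY θ₁ h₁), htr _ (hmemY θ₂ h₂)] at heq
    have : x θ₂ ∈ range fun t => F.φ t (x θ₁) := by rw [heq]; exact ⟨0, F.map_zero _⟩
    obtain ⟨t, ht⟩ := this
    exact hne (C.cross.inj θ₁ (Ico_subset_Icc_self h₁) θ₂ (Ico_subset_Icc_self h₂) t ht)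
  · rw [htr _ hx1Y, htr _ heY]
    refine hlim.congr' ?_
    filter_upwards [Ico_mem_nhdsLT (zero_lt_one (α := ℝ))] with θ hθ
    rw [htr _ (hmemY θ hθ)]
  · rw [htr _ hx1Y, htr _ heY]
    apply Subset.antisymm
    · intro z hz
      have hsub : connection f p r ⊆ Y ∩ coordSubspace {i, j, k} := fun y hy => by
        have hyY := hY.unstableSet_subset C.fst_mem hy.1
        exact ⟨hyY, C.mem_coordSubspace hY ((hY.mem_connection_iff F hyY).1 hy).1⟩
      obtain ⟨hzY, hzI⟩ := closure_minimal hsub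
        (hY.isCompact.isClosed.inter (isClosed_coordSubspace _)) hz
      -- A limit point stays in `Y` and in the span of the three axes, so it is `p`, `q` or `r`, or
      -- is classified by its backward limit: `p` gives the cross section, `q` the second broken
      -- piece, and `r` is excluded since it attracts there.
      by_cases hfz : f z = 0
      · rcases C.eq_or_eq_or_eq hY ⟨hzY, hfz⟩ hzI with rfl | rfl | rfl <;> simp
      obtain ⟨a, ha, b, -, -, hza, -, -⟩ := hY.exists_limits F hzY hfz
      rcases C.eq_or_eq_or_eq hY ha (IsACNetwork.limit_mem_coordSubspace F hza hzI) with
        rfl | rfl | rfl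
      · obtain ⟨θ, hθ, t, rfl⟩ := C.cross.surj z hzY (fun h => hfz (h ▸ ha.2)) hza
        rcases hθ.2.lt_or_eq with h' | rfl
        · refine Or.inr (mem_iUnion₂.2 ⟨θ, ⟨hθ.1, h'⟩, ?_⟩)
          rw [htr _ (hmemY θ ⟨hθ.1, h'⟩)]
          exact ⟨t, rfl⟩
        · exact Or.inl (Or.inl (Or.inr ⟨t, rfl⟩))
      · obtain ⟨t, rfl⟩ := C.exists_map_eq_of_tendsto_snd hY heY heI heq het hzY hzI
          (fun h => hfz (h ▸ ha.2)) hza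
        exact Or.inl (Or.inr ⟨t, rfl⟩)
      · have := hY.eq_of_tendsto_atBot_sink F ha C.trd_stable hzI hza
        exact absurd (this ▸ ha.2) hfz
    · have h00 : (0 : ℝ) ∈ Ico (0 : ℝ) 1 := ⟨le_rfl, zero_lt_one⟩
      have hbroken : ((range fun t => F.φ t (x 1)) ∪ {q} ∪ range fun t => F.φ t e) ⊆
          closure (connection f p r) := by
        intro z hz
        rw [EMetric.mem_closure_iff]
        intro ε hε
        obtain ⟨θ, hθd, hθ⟩ := ((hlim.eventually (gt_mem_nhds hε)).and
          (Ico_mem_nhdsLT (zero_lt_one (α := ℝ)))).exists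
        rw [Metric.hausdorffEDist_comm] at hθd
        obtain ⟨_, ⟨t, rfl⟩, hd⟩ := Metric.exists_edist_lt_of_hausdorffEDist_lt hz hθd
        exact ⟨_, C.mem_connection hY hθ t, hd⟩
      have hp : p ∈ closure (connection f p r) :=
        mem_closure_of_tendsto (C.tendsto_fst hY (Ico_subset_Icc_self h00))
          (Eventually.of_forall (C.mem_connection hY h00))
      have hr : r ∈ closure (connection f p r) :=
        mem_closure_of_tendsto (C.tendsto_trd 0 h00)
          (Eventually.of_forall (C.mem_connection hY h00))
      rintro z (((hz | hz) | hz) | hz)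
      · simp only [mem_insert_iff, mem_singleton_iff] at hz
        rcases hz with rfl | rfl | rfl
        · exact hp
        · exact hbroken (Or.inl (Or.inr rfl))
        · exact hr
      · exact hbroken (Or.inl (Or.inl hz))
      · exact hbroken (Or.inr hz)
      · obtain ⟨θ, hθ, hzθ⟩ := mem_iUnion₂.1 hz
        rw [htr _ (hmemY θ hθ)] at hzθ
        obtain ⟨t, rfl⟩ := hzθ
        exact subset_closure (C.mem_connection hY hθ t)

end IsCliqueConfiguration

end CliqueClosure

/-! ### The structure of ac-networks -/

section Structure

variable {n : ℕ} {f : Phase n → Phase n} {Y : Set (Phase n)}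

/-- Removing the two known components leaves a multiple of the third axis vector. Thus a robustness
subspace that meets the interior of a three-dimensional coordinate face is forced to contain its
span. -/
theorem single_mem_of_three {a b c : Fin n} (hca : c ≠ a) (hcb : c ≠ b) (hab : a ≠ b)
    {P : Submodule ℝ (Phase n)} {v : Phase n} (hv : v ∈ P) (hvI : v ∈ coordSubspace {a, b, c})
    (ha : EuclideanSpace.single a (1 : ℝ) ∈ P) (hb : EuclideanSpace.single b (1 : ℝ) ∈ P)
    (hvc : v c ≠ 0) : EuclideanSpace.single c (1 : ℝ) ∈ P := by
  have : EuclideanSpace.single c (1 : ℝ) = (v c)⁻¹ •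
      (v - v a • EuclideanSpace.single a (1 : ℝ) - v b • EuclideanSpace.single b (1 : ℝ)) := by
    ext l
    by_cases hla : l = a
    · subst hla; simp [hca.symm, hab]
    by_cases hlb : l = b
    · subst hlb; simp [hcb.symm, hab.symm]
    by_cases hlc : l = c
    · subst hlc; simp [hca, hcb, hvc]
    · simp [hla, hlb, hlc, hvI l (by simp [hla, hlb, hlc])]
  rw [this]
  exact P.smul_mem _ (P.sub_mem (P.sub_mem hv (P.smul_mem _ ha)) (P.smul_mem _ hb))

namespace IsACNetwork

variable {F : NetworkFlow f Y} {p : Phase n} {i j k : Fin n} {ρ μ : ℝ} {x : ℝ → Phase n}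

/-- If a trajectory in the interior of the cross section tends to `b`, then `b` attracts in the
coordinate subspace of the axis and the unstable directions of `p`. -/
theorem notMem_unstableIdx_of_interior (hY : IsACNetwork f Y) (S : IsCrossSection F p j k ρ μ x)
    (hp : p ∈ equilibriaIn f Y) (hi : p ∈ coordAxis i) (hpi : 0 < p i) (hij : i ≠ j) (hik : i ≠ k)
    (hjk : j ≠ k) (hU : unstableIdx f p = {j, k}) {θ : ℝ} (hθ : θ ∈ Ioo (0 : ℝ) 1) {b : Phase n}
    (hb : b ∈ equilibriaIn f Y) (hpb : p ≠ b)
    (hθb : Tendsto (fun t => F.φ t (x θ)) atTop (𝓝 b)) :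
    ∀ l ∈ ({i, j, k} : Finset (Fin n)), l ∉ unstableIdx f b := by
  have hθ' := Ioo_subset_Icc_self hθ
  have hxY := S.mem θ hθ'
  have hρ := S.ball.radius_pos
  have htend := S.ball.tendsto_of_backwardIn (hY.map_equilibrium F hp) hp.2 (S.backwardIn θ hθ')
  have hxI := hY.mem_coordSubspace_of_tendsto F hp hi htend
  rw [hU] at hxI
  have hxj : x θ j ≠ 0 := by
    rw [S.coord_fst θ hθ']; exact (mul_pos (by positivity) (Real.sqrt_pos.2 hθ.1)).ne'
  have hxk : x θ k ≠ 0 := by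
    rw [S.coord_snd θ hθ']
    exact (mul_pos (by positivity) (Real.sqrt_pos.2 (by linarith [hθ.2]))).ne'
  have hxp : x θ ≠ p := fun h => hxj (by rw [h]; exact hi j hij.symm)
  obtain ⟨b', -, -, hb't, P, hcP, hpP, hsink⟩ := hY.exists_forward_limit F hxY htend hxp
  obtain rfl := tendsto_nhds_unique hb't hθb
  have hxP : x θ ∈ P := hcP ((hY.mem_connection_iff F hxY).2 ⟨htend, hθb⟩)
  have hei := single_mem_of_mem_coordAxis hi hpi hpP
  obtain ⟨m, hm, hbm, hbpos⟩ := hY.exists_axis_mem hb (limit_mem_coordSubspace F hθb hxI)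
  have hem := single_mem_of_mem_coordAxis hbm hbpos hsink.1
  -- The subspace contains the axis of `p` and the axis of the limit; the point `x θ`, with both
  -- unstable coordinates nonzero, supplies the remaining axis.
  have hall : EuclideanSpace.single j (1 : ℝ) ∈ P ∧ EuclideanSpace.single k (1 : ℝ) ∈ P := by
    simp only [Finset.mem_insert, Finset.mem_singleton] at hm
    rcases hm with rfl | rfl | rfl
    · exact absurd (hY.eq_of_mem_coordAxis hp hb hi hbm) hpb
    · exact ⟨hem, single_mem_of_three hik.symm hjk.symm hij hxP hxI hei hem hxk⟩
    · refine ⟨single_mem_of_three hij.symm hjk hik hxP ?_ hei hem hxj, hem⟩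
      rwa [show ({i, m, j} : Finset (Fin n)) = {i, j, m} by ext; simp; tauto]
  intro l hl hlU
  have hneg : rate f b' l < 0 := by
    refine rate_neg_of_isSinkIn hY.contDiff_one hY.equivariant hbm hsink ?_
    simp only [Finset.mem_insert, Finset.mem_singleton] at hl
    rcases hl with rfl | rfl | rfl
    · exact hei
    · exact hall.1
    · exact hall.2
  exact absurd (mem_unstableIdx.1 hlU) hneg.not_gt

/-- The edge `x 1` of the cross section tends to an equilibrium on the axis `j`. -/
theorem exists_edge_limit (hY : IsACNetwork f Y) (S : IsCrossSection F p j k ρ μ x)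
    (hp : p ∈ equilibriaIn f Y) (hi : p ∈ coordAxis i) (hpi : 0 < p i) (hij : i ≠ j)
    (hU : unstableIdx f p = {j, k}) :
    ∃ q ∈ equilibriaIn f Y, q ∈ coordAxis j ∧ 0 < q j ∧
      Tendsto (fun t => F.φ t (x 1)) atTop (𝓝 q) ∧ i ∉ unstableIdx f q ∧ j ∉ unstableIdx f q := by
  have h01 : (1 : ℝ) ∈ Icc (0 : ℝ) 1 := ⟨zero_le_one, le_rfl⟩
  have hρ := S.ball.radius_pos
  have hxY := S.mem 1 h01
  have htend := S.ball.tendsto_of_backwardIn (hY.map_equilibrium F hp) hp.2 (S.backwardIn 1 h01)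
  have hxj : x 1 j ≠ 0 := by
    rw [S.coord_fst 1 h01, Real.sqrt_one]; positivity
  have hxk : x 1 k = 0 := by rw [S.coord_snd 1 h01]; simp
  have hxI : x 1 ∈ coordSubspace {i, j} := by
    intro l hl
    simp only [Finset.mem_insert, Finset.mem_singleton, not_or] at hl
    by_cases hlk : l = k
    · rw [hlk, hxk]
    · refine hY.mem_coordSubspace_of_tendsto F hp hi htend l ?_
      rw [hU]; simp [hl.1, hl.2, hlk]
  have hxp : x 1 ≠ p := fun h => hxj (by rw [h]; exact hi j hij.symm)
  obtain ⟨q, hq, hpq, hqt, P, -, hpP, hsink⟩ := hY.exists_forward_limit F hxY htend hxp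
  obtain ⟨m, hm, hqm, hqpos⟩ := hY.exists_axis_mem hq (limit_mem_coordSubspace F hqt hxI)
  simp only [Finset.mem_insert, Finset.mem_singleton] at hm
  rcases hm with rfl | rfl
  · exact absurd (hY.eq_of_mem_coordAxis hp hq hi hqm) hpq
  · have hneg : ∀ l, EuclideanSpace.single l (1 : ℝ) ∈ P → l ∉ unstableIdx f q :=
      fun l hl hmem => absurd (mem_unstableIdx.1 hmem)
        (rate_neg_of_isSinkIn hY.contDiff_one hY.equivariant hqm hsink hl).not_gt
    exact ⟨q, hq, hqm, hqpos, hqt, hneg i (single_mem_of_mem_coordAxis hi hpi hpP),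
      hneg m (single_mem_of_mem_coordAxis hqm hqpos hsink.1)⟩

/-- The parameters of the cross section near `θ₀` belong to the basin of `b` if `θ₀` does and `b`
attracts in the coordinate subspace. -/
theorem eventually_tendsto_of_stable (hY : IsACNetwork f Y) (S : IsCrossSection F p j k ρ μ x)
    (hp : p ∈ equilibriaIn f Y) (hi : p ∈ coordAxis i) (hU : unstableIdx f p = {j, k}) {θ₀ : ℝ}
    (hθ₀ : θ₀ ∈ Icc (0 : ℝ) 1) {b : Phase n} (hb : b ∈ equilibriaIn f Y)
    (hbI : ∀ l ∈ ({i, j, k} : Finset (Fin n)), l ∉ unstableIdx f b)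
    (hθb : Tendsto (fun t => F.φ t (x θ₀)) atTop (𝓝 b)) :
    ∀ᶠ θ in 𝓝[Icc 0 1] θ₀, Tendsto (fun t => F.φ t (x θ)) atTop (𝓝 b) := by
  have hI : ∀ θ ∈ Icc (0 : ℝ) 1, x θ ∈ coordSubspace {i, j, k} := by
    intro θ hθ
    have := hY.mem_coordSubspace_of_tendsto F hp hi
      (S.ball.tendsto_of_backwardIn (hY.map_equilibrium F hp) hp.2 (S.backwardIn θ hθ))
    rwa [hU] at this
  have h1 := hY.eventually_tendsto_sink F hb hbI (limit_mem_coordSubspace F hθb (hI θ₀ hθ₀)) hθb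
  filter_upwards [(S.continuousOn θ₀ hθ₀).eventually h1, self_mem_nhdsWithin] with θ h2 hθ
  exact h2 (S.mem θ hθ) (hI θ hθ)

/-- If all interior trajectories tend to the limit `r` of the edge `x 0`, the cross section belongs
to a clique configuration. -/
theorem exists_cliqueConfiguration_of_interior (hY : IsACNetwork f Y)
    (S : IsCrossSection F p j k ρ μ x) (hp : p ∈ equilibriaIn f Y) (hi : p ∈ coordAxis i)
    (hpi : 0 < p i) (hij : i ≠ j) (hik : i ≠ k) (hjk : j ≠ k) (hU : unstableIdx f p = {j, k})
    {r : Phase n} (hr : r ∈ equilibriaIn f Y) (hrk : r ∈ coordAxis k) (hrpos : 0 < r k)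
    (hall : ∀ θ ∈ Ico (0 : ℝ) 1, Tendsto (fun t => F.φ t (x θ)) atTop (𝓝 r)) :
    ∃ q, IsCliqueConfiguration F p q r i j k ρ μ x := by
  have h01 : (1 : ℝ) ∈ Icc (0 : ℝ) 1 := ⟨zero_le_one, le_rfl⟩
  obtain ⟨q, hq, hqj, hqpos, hqt, hqi', hqj'⟩ := hY.exists_edge_limit S hp hi hpi hij hU
  have hpr : p ≠ r := by rintro rfl; exact hrpos.ne' (hi k hik.symm)
  have hqr : q ≠ r := by rintro rfl; exact hrpos.ne' (hqj k hjk.symm)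
  have hhalf : (1 / 2 : ℝ) ∈ Ioo (0 : ℝ) 1 := by norm_num
  have hrI := hY.notMem_unstableIdx_of_interior S hp hi hpi hij hik hjk hU hhalf hr hpr
    (hall _ (Ioo_subset_Ico_self hhalf))
  -- Otherwise `q` would attract in the whole three-dimensional span, and trajectories near the edge
  -- would tend to `q` instead of `r`.
  have hqk : k ∈ unstableIdx f q := by
    by_contra hk
    have hqI : ∀ l ∈ ({i, j, k} : Finset (Fin n)), l ∉ unstableIdx f q := by
      intro l hl
      simp only [Finset.mem_insert, Finset.mem_singleton] at hl
      rcases hl with rfl | rfl | rfl <;> assumption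
    have hev := hY.eventually_tendsto_of_stable S hp hi hU h01 hq hqI hqt
    have hev' : ∀ᶠ θ in 𝓝[<] (1 : ℝ), Tendsto (fun t => F.φ t (x θ)) atTop (𝓝 q) := by
      refine nhdsWithin_le_iff.2 ?_ hev
      exact mem_of_superset (Ico_mem_nhdsLT (zero_lt_one (α := ℝ))) Ico_subset_Icc_self
    obtain ⟨θ, hθq, hθ⟩ := (hev'.and (Ico_mem_nhdsLT (zero_lt_one (α := ℝ)))).exists
    exact hqr (tendsto_nhds_unique hθq (hall θ hθ))
  refine ⟨q, S, hp, hq, hr, hij, hik, hjk, hi, hqj, hrk, hpi, hqpos, hrpos, hU, ?_, hrI, hqt, hall⟩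
  intro l hl
  simp only [Finset.mem_insert, Finset.mem_singleton] at hl
  constructor
  · intro hmem
    rcases hl with rfl | rfl | rfl
    · exact absurd hmem hqi'
    · exact absurd hmem hqj'
    · rfl
  · rintro rfl; exact hqk

/-- An equilibrium with two unstable directions begins a clique configuration. -/
theorem exists_cliqueConfiguration (hY : IsACNetwork f Y) (F : NetworkFlow f Y) {p : Phase n}
    (hp : p ∈ equilibriaIn f Y) (hcard : (unstableIdx f p).card = 2) :
    ∃ q r i j k ρ μ x, IsCliqueConfiguration F p q r i j k ρ μ x := by
  obtain ⟨j, k, hjk, hU⟩ := Finset.card_eq_two.1 hcard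
  obtain ⟨i, hi, hpi⟩ := hY.exists_axis hp
  have hiU : i ∉ unstableIdx f p := fun hmem =>
    absurd (mem_unstableIdx.1 hmem) (hY.rate_axis_neg F hp hi hpi).not_gt
  have hij : i ≠ j := fun e => hiU (by rw [hU, e]; simp)
  have hik : i ≠ k := fun e => hiU (by rw [hU, e]; simp)
  have hU' : unstableIdx f p = {k, j} := by rw [hU, Finset.pair_comm]
  obtain ⟨ρ, μ, x, S⟩ := hY.exists_isCrossSection F hp hjk hU
  obtain ⟨q, hq, hqj, hqpos, hqt, -⟩ := hY.exists_edge_limit S hp hi hpi hij hU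
  obtain ⟨r, hr, hrk, hrpos, hrt, -⟩ := hY.exists_edge_limit S.swap hp hi hpi hik hU'
  rw [sub_self] at hrt
  have hpq : p ≠ q := by rintro rfl; exact hqpos.ne' (hi j hij.symm)
  have hpr : p ≠ r := by rintro rfl; exact hrpos.ne' (hi k hik.symm)
  have hqr : q ≠ r := by rintro rfl; exact hrpos.ne' (hqj k hjk.symm)
  have hopen : ∀ b ∈ equilibriaIn f Y, p ≠ b →
      IsOpen {θ | θ ∈ Ioo (0 : ℝ) 1 ∧ Tendsto (fun t => F.φ t (x θ)) atTop (𝓝 b)} := by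
    intro b hb hpb
    rw [isOpen_iff_mem_nhds]
    rintro θ ⟨hθ, hθb⟩
    have hbI := hY.notMem_unstableIdx_of_interior S hp hi hpi hij hik hjk hU hθ hb hpb hθb
    have hev := hY.eventually_tendsto_of_stable S hp hi hU (Ioo_subset_Icc_self hθ) hb hbI hθb
    rw [nhdsWithin_eq_nhds.2 (Icc_mem_nhds hθ.1 hθ.2)] at hev
    filter_upwards [hev, Ioo_mem_nhds hθ.1 hθ.2] with θ' h1 h2 using ⟨h2, h1⟩
  have hcover : ∀ θ ∈ Ioo (0 : ℝ) 1, Tendsto (fun t => F.φ t (x θ)) atTop (𝓝 q) ∨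
      Tendsto (fun t => F.φ t (x θ)) atTop (𝓝 r) := by
    intro θ hθ
    have hθ' := Ioo_subset_Icc_self hθ
    have htend := S.ball.tendsto_of_backwardIn (hY.map_equilibrium F hp) hp.2 (S.backwardIn θ hθ')
    have hxp : x θ ≠ p := by
      intro h
      have h1 := S.coord_fst θ hθ'
      rw [h, hi j hij.symm] at h1
      have := S.ball.radius_pos
      exact (mul_pos (by positivity) (Real.sqrt_pos.2 hθ.1)).ne h1
    obtain ⟨b, hb, hpb, hbt, -⟩ := hY.exists_forward_limit F (S.mem θ hθ') htend hxp
    have hxI := hY.mem_coordSubspace_of_tendsto F hp hi htend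
    obtain ⟨m, hm, hbm, -⟩ := hY.exists_axis_mem hb (limit_mem_coordSubspace F hbt hxI)
    rw [hU] at hm
    simp only [Finset.mem_insert, Finset.mem_singleton] at hm
    rcases hm with rfl | rfl | rfl
    · exact absurd (hY.eq_of_mem_coordAxis hp hb hi hbm) hpb
    · rw [hY.eq_of_mem_coordAxis hq hb hqj hbm]; exact Or.inl hbt
    · rw [hY.eq_of_mem_coordAxis hr hb hrk hbm]; exact Or.inr hbt
  -- The two basins are open, disjoint and cover the interval, so one of them is everything. If it
  -- is the basin of `q`, reversing the cross section exchanges the roles of `q` and `r`.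
  by_cases hsome : ∃ θ ∈ Ioo (0 : ℝ) 1, Tendsto (fun t => F.φ t (x θ)) atTop (𝓝 r)
  · have hall : ∀ θ ∈ Ioo (0 : ℝ) 1, Tendsto (fun t => F.φ t (x θ)) atTop (𝓝 r) := by
      intro θ hθ
      by_contra hnot
      obtain ⟨θ', hθ', hθ'r⟩ := hsome
      obtain ⟨θ'', -, h1, h2⟩ := isPreconnected_Ioo (a := (0 : ℝ)) (b := 1) _ _
        (hopen q hq hpq) (hopen r hr hpr)
        (fun s hs => (hcover s hs).imp (fun h => ⟨hs, h⟩) fun h => ⟨hs, h⟩)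
        ⟨θ, hθ, hθ, (hcover θ hθ).resolve_right hnot⟩ ⟨θ', hθ', hθ', hθ'r⟩
      exact hqr (tendsto_nhds_unique h1.2 h2.2)
    obtain ⟨q', hC⟩ := hY.exists_cliqueConfiguration_of_interior S hp hi hpi hij hik hjk hU hr hrk
      hrpos fun θ hθ => by
        rcases hθ.1.lt_or_eq with h | h
        · exact hall θ ⟨h, hθ.2⟩
        · rw [← h]; exact hrt
    exact ⟨q', r, i, j, k, ρ, μ, x, hC⟩
  · obtain ⟨q', hC⟩ := hY.exists_cliqueConfiguration_of_interior S.swap hp hi hpi hik hij hjk.symm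
      hU' hq hqj hqpos fun θ hθ => by
        rcases hθ.1.lt_or_eq with h | h
        · have hθ' : 1 - θ ∈ Ioo (0 : ℝ) 1 := ⟨by linarith [hθ.2], by linarith⟩
          exact (hcover _ hθ').resolve_right fun h' => hsome ⟨_, hθ', h'⟩
        · rw [← h, sub_zero]; exact hqt
    exact ⟨q', q, i, k, j, ρ, μ, _, hC⟩

/-- A connection that consists of one trajectory is one-dimensional. -/
theorem dimH_connection_eq_one (hY : IsACNetwork f Y) (F : NetworkFlow f Y) {a b z : Phase n}
    (hz : z ∈ Y) (hab : a ≠ b) (hzc : z ∈ connection f a b)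
    (hone : ∀ y ∈ connection f a b, ∃ t, F.φ t z = y) : dimH (connection f a b) = 1 := by
  obtain ⟨h1, h2⟩ := (hY.mem_connection_iff F hz).1 hzc
  have heq : connection f a b = range fun t => F.φ t z := by
    apply Subset.antisymm hone
    rintro _ ⟨t, rfl⟩
    exact (hY.mem_connection_iff F (F.invariant z hz t)).2
      ⟨F.tendsto_atBot_map h1 t, F.tendsto_atTop_map h2 t⟩
  obtain ⟨t, ht⟩ : ∃ t, F.φ t z ≠ z := by
    by_contra hcon
    push Not at hcon
    simp only [hcon] at h1 h2
    exact hab ((tendsto_nhds_unique h1 tendsto_const_nhds).trans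
      (tendsto_nhds_unique tendsto_const_nhds h2))
  rw [heq, F.dimH_orbit ht]

/-- A connection between distinct equilibria is one-dimensional, or its closure is a `Δ`-clique. -/
theorem dimH_eq_one_or_isDeltaClique (hY : IsACNetwork f Y) {a b : Phase n}
    (ha : a ∈ equilibriaIn f Y) (hab : a ≠ b) (hne : (connection f a b).Nonempty) :
    dimH (connection f a b) = 1 ∨ ∃ q ∈ equilibriaIn f Y, b ∈ equilibriaIn f Y ∧
      IsDeltaClique f a q b (closure (connection f a b)) := by
  obtain ⟨F⟩ := hY.exists_flow
  obtain ⟨z, hz⟩ := hne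
  have hmem : ∀ y ∈ connection f a b, y ∈ Y ∧ y ≠ a ∧
      Tendsto (fun t => F.φ t y) atBot (𝓝 a) ∧ Tendsto (fun t => F.φ t y) atTop (𝓝 b) := by
    intro y hy
    have hyY := hY.unstableSet_subset ha hy.1
    obtain ⟨h1, h2⟩ := (hY.mem_connection_iff F hyY).1 hy
    refine ⟨hyY, fun h => hab ?_, h1, h2⟩
    rw [h] at h2
    simp only [hY.map_equilibrium F ha] at h2
    exact tendsto_nhds_unique tendsto_const_nhds h2
  obtain ⟨hzY, hza, hzt, hzb⟩ := hmem z hz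
  obtain ⟨i, hi, -⟩ := hY.exists_axis ha
  rcases hY.unstable_dim a ha with hdim | hdim <;>
    rw [← card_unstableIdx hY.contDiff_one hY.equivariant hi] at hdim
  · left
    obtain ⟨k, hU⟩ := Finset.card_eq_one.1 hdim
    have hsing : ∀ y : Phase n, ∀ l ∈ unstableIdx f a, l ≠ k → y l = 0 :=
      fun y l hl hlk => absurd (by simpa [hU] using hl) hlk
    refine hY.dimH_connection_eq_one F hzY hab hz fun y hy => ?_
    obtain ⟨hyY, hya, hyt, -⟩ := hmem y hy
    exact hY.exists_map_eq F ha (by simp [hU]) hzY hyY hza hya hzt hyt (hsing z) (hsing y)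
  · obtain ⟨q, r, i, j, k, ρ, μ, x, C⟩ := hY.exists_cliqueConfiguration F ha hdim
    obtain ⟨θ, hθ, t, ht⟩ := C.cross.surj z hzY hza hzt
    rcases hθ.2.lt_or_eq with hlt | rfl
    · right
      obtain rfl : b = r := tendsto_nhds_unique hzb
        (by rw [← ht]; exact F.tendsto_atTop_map (C.tendsto_trd θ ⟨hθ.1, hlt⟩) t)
      exact ⟨q, C.snd_mem, C.trd_mem, C.isDeltaClique hY⟩
    -- The trajectories of the cross section with `θ < 1` end at `r`, so the connection to `q` is
    -- the edge trajectory alone.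
    · left
      obtain rfl : b = q := tendsto_nhds_unique hzb
        (by rw [← ht]; exact F.tendsto_atTop_map C.tendsto_snd t)
      refine hY.dimH_connection_eq_one F hzY hab hz fun y hy => ?_
      obtain ⟨hyY, hya, hyt, hyb⟩ := hmem y hy
      obtain ⟨θ', hθ', t', ht'⟩ := C.cross.surj y hyY hya hyt
      rcases hθ'.2.lt_or_eq with hlt | rfl
      · exact absurd (tendsto_nhds_unique hyb
          (by rw [← ht']; exact F.tendsto_atTop_map (C.tendsto_trd θ' ⟨hθ'.1, hlt⟩) t'))
          C.snd_ne_trd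
      · exact ⟨t' + -t, by rw [F.map_add, ← ht, F.map_neg_map, ht']⟩

end IsACNetwork

end Structure

/-- An ac-network is the union of its equilibria, its one-dimensional connections and the
`Δ`-cliques it contains; and the closure of every two-dimensional connection `[p → r]` between its
equilibria is a `Δ`-clique beginning at `p` and ending at `r`. The dimension of a connection is its
Hausdorff dimension. -/
theorem mainTheorem5 {n : ℕ} (f : Phase n → Phase n) (Y : Set (Phase n))
    (hY : IsACNetwork f Y) :
    Y = equilibriaIn f Y
        ∪ ⋃₀ {C | C ⊆ Y ∧ dimH C = 1 ∧
            ∃ p ∈ equilibriaIn f Y, ∃ q ∈ equilibriaIn f Y, p ≠ q ∧ C = connection f p q}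
        ∪ ⋃₀ {D | D ⊆ Y ∧ ∃ p ∈ equilibriaIn f Y, ∃ q ∈ equilibriaIn f Y,
            ∃ r ∈ equilibriaIn f Y, IsDeltaClique f p q r D} ∧
    ∀ p ∈ equilibriaIn f Y, ∀ r ∈ equilibriaIn f Y, dimH (connection f p r) = 2 →
      ∃ q ∈ equilibriaIn f Y, IsDeltaClique f p q r (closure (connection f p r)) := by
  have hsub : ∀ a ∈ equilibriaIn f Y, ∀ b, connection f a b ⊆ Y :=
    fun a ha b y hy => hY.unstableSet_subset ha hy.1
  constructor
  · apply Subset.antisymm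
    · intro x hx
      by_cases hfx : f x = 0
      · exact Or.inl (Or.inl ⟨hx, hfx⟩)
      obtain ⟨a, ha, b, hb, hab, hxc, -⟩ := hY.exists_connection hx hfx
      rcases hY.dimH_eq_one_or_isDeltaClique ha hab ⟨x, hxc⟩ with hdim | ⟨q, hq, -, hD⟩
      · exact Or.inl (Or.inr ⟨_, ⟨hsub a ha b, hdim, a, ha, b, hb, hab, rfl⟩, hxc⟩)
      · exact Or.inr ⟨_, ⟨closure_minimal (hsub a ha b) hY.isCompact.isClosed, a, ha, q, hq, b, hb,
          hD⟩, subset_closure hxc⟩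
    · rintro x ((hx | ⟨C, ⟨hC, -⟩, hx⟩) | ⟨D, ⟨hD, -⟩, hx⟩)
      · exact hx.1
      · exact hC hx
      · exact hD hx
  · intro p hp r hr hdim
    obtain ⟨F⟩ := hY.exists_flow
    -- A connection reduced to `p` has dimension zero. A further point of it has a forward limit
    -- different from `p`, which rules out `p = r`.
    obtain ⟨y, hy, hyp⟩ : ∃ y ∈ connection f p r, y ≠ p := by
      by_contra hcon
      push Not at hcon
      have h0 : dimH (connection f p r) = 0 :=
        Subsingleton.dimH_zero fun a ha b hb => (hcon a ha).trans (hcon b hb).symm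
      rw [h0] at hdim
      exact two_ne_zero hdim.symm
    have hyY := hsub p hp r hy
    obtain ⟨h1, h2⟩ := (hY.mem_connection_iff F hyY).1 hy
    have hpr : p ≠ r := by
      obtain ⟨b, -, hpb, hb, -⟩ := hY.exists_forward_limit F hyY h1 hyp
      rwa [tendsto_nhds_unique h2 hb]
    rcases hY.dimH_eq_one_or_isDeltaClique hp hpr ⟨y, hy⟩ with h | ⟨q, hq, -, hD⟩
    · rw [h] at hdim
      norm_num at hdim
    · exact ⟨q, hq, hD⟩
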